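/- Let $\epsilon>0$ and $u_0(x)=\sum_{p=1}^P \frac{c_p}{x-z_p}+\mathrm{c.c.}$, where $c_p\in\mathbb{C}\setminus\{0\}$, $\mathrm{Im}\,z_p>0$, $\mathrm{Re}\,z_1<\dots<\mathrm{Re}\,z_P$ and $\sum_p(c_p+c_p^*)=0$. Let $f(x)=\sum_p c_p\left(\mathrm{Log}(i(x-z_p))+\frac{\pi i}{2}\right)+\mathrm{c.c.}$ (principal branch; c.c. in the sense of Schwarz reflection), $h(x;\lambda)=\lambda x+f(x)$, and let $G$ be the domain of analyticity of $f$, i.e. the plane cut along the vertical half-lines going up from each $z_p$ and down from each $z_p^*$. For $\lambda<0$, $\boldsymbol\phi\in\mathbb{C}^P$ and $x\in G$ put $$\Phi(x;\lambda)=-\frac{i}{\epsilon}e^{ih(x;\lambda)/\epsilon}\int_{-\infty}^x e^{-ih(z;\lambda)/\epsilon}\sum_{p=1}^P\frac{\phi_p}{z-z_p}\,dz ,$$ the integral being an improper integral along a path in $G$ that comes from $-\infty$ along the real axis. Let $\mathbf{A}^<(\lambda)\in\mathbb{C}^{P\times P}$ have the entries $A^<_{mp}(\lambda)=\int_{C_m^<}\frac{e^{-ih(z;\lambda)/\epsilon}}{z-z_p}\,dz$,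 and let $D(\lambda)=\det\mathbf{A}^<(\lambda)$. Here $C_m^<$ is a contour in $G$ from $i\infty$ in $\mathrm{Re}\,z<\mathrm{Re}\,z_1$ to $i\infty$ in the strip $\mathrm{Re}\,z_m<\mathrm{Re}\,z<\mathrm{Re}\,z_{m+1}$ (in $\mathrm{Re}\,z>\mathrm{Re}\,z_P$ if $m=P$), except that, if $ic_m/\epsilon$ is a strictly negative integer, it goes in $G$ from $i\infty$ in $\mathrm{Re}\,z<\mathrm{Re}\,z_1$ to the endpoint $z_m$. Then the improper integral converges for all $\lambda<0$, $\boldsymbol\phi\in\mathbb{C}^P$ and $x\in\mathbb{R}$, and the following hold. 1. For every $\lambda<0$ and $\boldsymbol\phi\in\mathbb{C}^P$: the function $\Phi(\cdot;\lambda)$ is nontrivial and analytic in the closed upper half-plane (i.e. it agrees on $G\cap\{\mathrm{Im}\,x\ge0\}$ with a function analytic in a neighborhood of $\{\mathrm{Im}\,x\ge 0\}$) if and only if $D(\lambda)=0$ and $\boldsymbol\phi$ is a nontrivial nullvector of $\mathbf{A}^<(\lambda)$. Whenever $\Phi(\cdot;\lambda)$ is analytic in the closed upper half-plane, $\phi_p=c_p\Phi(z_p;\lambda)$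 for all $p$. 2. For every $\lambda<0$, a nontrivial nullvector of $\mathbf{A}^<(\lambda)$ is unique up to a constant multiple. 3. $D$ is an Evans function: it extends to an analytic function on $\mathbb{C}\setminus[0,\infty)$ whose zeros are exactly the eigenvalues in $\mathbb{C}\setminus[0,\infty)$, i.e. those $\lambda$ for which there is a nonzero differentiable $w\in\mathbb{H}^+(\mathbb{R})$ with $i\epsilon w'+\lambda w=-\mathcal{C}^+[u_0w]$ on $\mathbb{R}$. Here $\mathbb{H}^+(\mathbb{R})\subset L^2(\mathbb{R})$ is the Hardy space of the upper half-plane and $\mathcal{C}^+[g](x)=\lim_{\delta\downarrow0}\frac{1}{2\pi i}\int_{-\infty}^\infty\frac{g(y)}{y-(x+i\delta)}\,dy$. -/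

import Mathlib

open Complex Filter Topology MeasureTheory Set
open scoped ComplexConjugate

namespace BenjaminOno

/-- The rational potential `u₀(x) = ∑ c_p / (x - z_p) + c.c.` (for complex `x` the complex conjugate
is taken in the sense of Schwarz reflection). -/
noncomputable def u0 {P : ℕ} (c z : Fin P → ℂ) (x : ℂ) : ℂ :=
  ∑ p, (c p / (x - z p) + conj (c p) / (x - conj (z p)))

/-- The antiderivative `f(x) = ∑ c_p (Log (i (x - z_p)) + π i / 2) + c.c.` of `u₀`, principal
branch of the logarithm. -/
noncomputable def f {P : ℕ} (c z : Fin P → ℂ) (x : ℂ) : ℂ :=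
  ∑ p, (c p * (Complex.log (I * (x - z p)) + Real.pi * I / 2) +
    conj (c p) * (Complex.log (-I * (x - conj (z p))) - Real.pi * I / 2))

/-- `h(x; l) = l x + f(x)`. -/
noncomputable def h {P : ℕ} (c z : Fin P → ℂ) (l : ℝ) (x : ℂ) : ℂ := l * x + f c z x

/-- The domain `G` of analyticity of `f`: the plane cut along the vertical half-lines going up from
each `z_p` and down from each `conj z_p`. -/
def G {P : ℕ} (z : Fin P → ℂ) : Set ℂ :=
  {x | ∀ p, ¬ (x.re = (z p).re ∧ (z p).im ≤ |x.im|)}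

/-- The integrand `exp (-i h(ζ; l) / ε) ∑ φ_p / (ζ - z_p)`. -/
noncomputable def integrand {P : ℕ} (ε : ℝ) (c z : Fin P → ℂ) (l : ℝ) (φ : Fin P → ℂ) (ζ : ℂ) : ℂ :=
  Complex.exp (-I * h c z l ζ / ε) * ∑ p, φ p / (ζ - z p)

/-- `Φ(x; l) = -(i/ε) exp (i h(x; l)/ε) ∫_{-∞}^x exp (-i h(ζ; l)/ε) ∑ φ_p / (ζ - z_p) dζ`, for
`x ∈ G`. The path inside `G` runs along the real axis from `-∞` to `re x` (a conditionally
convergent improper integral) and then along the vertical segment from `re x` to `x`, which lies in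
`G` for every `x ∈ G`. -/
noncomputable def Phi {P : ℕ} (ε : ℝ) (c z : Fin P → ℂ) (l : ℝ) (φ : Fin P → ℂ) (x : ℂ) : ℂ :=
  -(I / ε) * Complex.exp (I * h c z l x / ε) *
    (limUnder atTop (fun R : ℝ => ∫ t in (-R)..x.re, integrand ε c z l φ (t : ℂ)) +
      ∫ s in (0 : ℝ)..x.im, integrand ε c z l φ (x.re + s * I) * I)

/-- `F` is an analytic function on (a neighbourhood of) the closed upper half-plane which coincides
with `Φ(·; l)` wherever the latter is defined there. -/
def IsAnalyticExtension {P : ℕ} (ε : ℝ) (c z : Fin P → ℂ) (l : ℝ) (φ : Fin P → ℂ)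
    (F : ℂ → ℂ) : Prop :=
  AnalyticOnNhd ℂ F {x | 0 ≤ x.im} ∧ ∀ x ∈ G z, 0 ≤ x.im → F x = Phi ε c z l φ x

/-- `Φ(·; l)` is analytic in the closed upper half-plane. -/
def PhiAnalytic {P : ℕ} (ε : ℝ) (c z : Fin P → ℂ) (l : ℝ) (φ : Fin P → ℂ) : Prop :=
  ∃ F : ℂ → ℂ, IsAnalyticExtension ε c z l φ F

/-- `Φ(·; l)` does not vanish identically. -/
def PhiNontrivial {P : ℕ} (ε : ℝ) (c z : Fin P → ℂ) (l : ℝ) (φ : Fin P → ℂ) : Prop :=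
  ∃ x ∈ G z, 0 ≤ x.im ∧ Phi ε c z l φ x ≠ 0

/-- The integral of `g` over the vertical ray from the real point `a` up to `i∞`. -/
noncomputable def rayIntegral (g : ℂ → ℂ) (a : ℝ) : ℂ :=
  ∫ s in Ioi (0 : ℝ), g (a + s * I) * I

/-- The integral of `g` over the contour coming down from `i∞` along `re = a` to the real axis,
following the real axis from `a` to `b`, and going up along `re = b` to `i∞`. -/
noncomputable def integralU (g : ℂ → ℂ) (a b : ℝ) : ℂ :=
  -rayIntegral g a + (∫ t in a..b, g (t : ℂ)) + rayIntegral g b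

/-- The integral of `g` over the contour coming down from `i∞` along `re = a` to the real axis,
following the real axis from `a` to `re w`, and going up vertically to its endpoint `w`. -/
noncomputable def integralEll (g : ℂ → ℂ) (a : ℝ) (w : ℂ) : ℂ :=
  -rayIntegral g a + (∫ t in a..w.re, g (t : ℂ)) + ∫ s in (0 : ℝ)..w.im, g (w.re + s * I) * I

/-- `i c_m / ε` is a strictly negative integer. -/
def Exceptional (ε : ℝ) (cm : ℂ) : Prop := ∃ n : ℕ, 0 < n ∧ I * cm / ε = -(n : ℂ)

open Classical in
/-- The matrix `A^<(l)` with entries `∫_{C_m} exp (-i h(ζ; l)/ε) / (ζ - z_p) dζ`. The contour `C_m`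
starts at `i∞` on the line `re = a` to the left of all the `z_p`; it passes below `z_1, …, z_m` and
ends at `i∞` on the line `re = b m` between `z_m` and `z_{m+1}`, except that it ends at `z_m` if
`i c_m / ε` is a strictly negative integer. -/
noncomputable def A {P : ℕ} (ε : ℝ) (c z : Fin P → ℂ) (a : ℝ) (b : Fin P → ℝ) (l : ℝ) :
    Matrix (Fin P) (Fin P) ℂ :=
  Matrix.of fun m p =>
    if Exceptional ε (c m) then
      integralEll (fun ζ => Complex.exp (-I * h c z l ζ / ε) / (ζ - z p)) a (z m)
    else
      integralU (fun ζ => Complex.exp (-I * h c z l ζ / ε) / (ζ - z p)) a (b m)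

/-- `D(l) = det A^<(l)`. -/
noncomputable def D {P : ℕ} (ε : ℝ) (c z : Fin P → ℂ) (a : ℝ) (b : Fin P → ℝ) (l : ℝ) : ℂ :=
  (A ε c z a b l).det

/-- Membership in the Hardy space `ℍ⁺(ℝ)`: `w ∈ L²(ℝ)` is the boundary value of a function that is
holomorphic in the upper half-plane with uniformly bounded `L²` norms on horizontal lines. -/
def MemHardyPlus (w : ℝ → ℂ) : Prop :=
  MemLp w 2 volume ∧
  ∃ W : ℂ → ℂ, DifferentiableOn ℂ W {ζ | 0 < ζ.im} ∧
    (∃ C : NNReal, ∀ y : ℝ, 0 < y → eLpNorm (fun x : ℝ => W (x + y * I)) 2 volume ≤ C) ∧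
    ∀ᵐ x : ℝ, Tendsto (fun y : ℝ => W (x + y * I)) (𝓝[>] 0) (𝓝 (w x))

/-- `v = 𝒞⁺[g](x)`, the boundary value from above of the Cauchy integral of `g`. -/
def IsCauchyPlus (g : ℝ → ℂ) (x : ℝ) (v : ℂ) : Prop :=
  Tendsto (fun δ : ℝ => 1 / (2 * Real.pi * I) * ∫ y : ℝ, g y / (y - (x + δ * I))) (𝓝[>] 0) (𝓝 v)

/-- `l` is an eigenvalue: there is a nontrivial `w ∈ ℍ⁺(ℝ)` with `i ε w' + l w = -𝒞⁺[u₀ w]`. -/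
def IsEigenvalue {P : ℕ} (ε : ℝ) (c z : Fin P → ℂ) (l : ℂ) : Prop :=
  ∃ w : ℝ → ℂ, w ≠ 0 ∧ MemHardyPlus w ∧ Differentiable ℝ w ∧
    ∃ v : ℝ → ℂ, (∀ x, IsCauchyPlus (fun y => u0 c z y * w y) x (v x)) ∧
      ∀ x, I * ε * deriv w x + l * w x = -v x

end BenjaminOno

open BenjaminOno

/-! ### Primitives on comb-shaped domains. -/

/-- An open set `D` which is a union of vertical segments attached to the horizontal segment
`I + i y₀`. -/
structure IsComb (D : Set ℂ) (J : Set ℝ) (y₀ : ℝ) : Prop where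
  isOpen : IsOpen D
  ordConnected : J.OrdConnected
  base : ∀ t ∈ J, (t + y₀ * I : ℂ) ∈ D
  re_mem : ∀ ζ ∈ D, ζ.re ∈ J
  vert : ∀ ζ ∈ D, ∀ s ∈ uIcc y₀ ζ.im, (ζ.re + s * I : ℂ) ∈ D

/-- The integral of `g` from `t₀ + i y₀` to `ζ`, first horizontally and then vertically. -/
noncomputable def combInt (g : ℂ → ℂ) (t₀ y₀ : ℝ) (ζ : ℂ) : ℂ :=
  (∫ t in t₀..ζ.re, g (t + y₀ * I)) + ∫ s in y₀..ζ.im, g (ζ.re + s * I) * I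

/-- Points whose abscissa is close to that of `ζ` and whose ordinate is close to the segment between
`y₀` and `ζ.im` belong to a comb containing `ζ`. -/
theorem IsComb.exists_box {D : Set ℂ} {J : Set ℝ} {y₀ : ℝ} (hD : IsComb D J y₀) {ζ : ℂ}
    (hζ : ζ ∈ D) : ∃ δ > 0, ∀ x y : ℝ, |x - ζ.re| < δ → (∃ s ∈ uIcc y₀ ζ.im, |y - s| < δ) →
      (x + y * I : ℂ) ∈ D := by
  have hK : IsCompact ((fun s : ℝ => (ζ.re + s * I : ℂ)) '' uIcc y₀ ζ.im) :=
    isCompact_uIcc.image (by fun_prop)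
  obtain ⟨δ, hδ, hsub⟩ := hK.exists_thickening_subset_open hD.isOpen
    (by rintro _ ⟨s, hs, rfl⟩; exact hD.vert ζ hζ s hs)
  refine ⟨δ / 2, by positivity, fun x y hx ⟨s, hs, hy⟩ => hsub ?_⟩
  rw [Metric.mem_thickening_iff]
  refine ⟨_, ⟨s, hs, rfl⟩, ?_⟩
  rw [dist_eq_norm]
  calc ‖(x + y * I : ℂ) - (ζ.re + s * I)‖ = ‖((x - ζ.re : ℝ) : ℂ) + ((y - s : ℝ) : ℂ) * I‖ := by
        push_cast; ring_nf
    _ ≤ |x - ζ.re| + |y - s| := by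
        refine (norm_add_le _ _).trans ?_
        simp [-ofReal_sub, Complex.norm_real]
    _ < δ := by linarith

theorem IsComb.horizontal_intervalIntegrable {D : Set ℂ} {J : Set ℝ} {y₀ : ℝ} (hD : IsComb D J y₀)
    {g : ℂ → ℂ} (hg : ContinuousOn g D) {t₁ t₂ : ℝ} (h₁ : t₁ ∈ J) (h₂ : t₂ ∈ J) :
    IntervalIntegrable (fun t : ℝ => g (t + y₀ * I)) volume t₁ t₂ := by
  apply ContinuousOn.intervalIntegrable
  refine hg.comp (by fun_prop) fun t ht => hD.base t (hD.ordConnected.uIcc_subset h₁ h₂ ht)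

theorem IsComb.vertical_intervalIntegrable {D : Set ℂ} {J : Set ℝ} {y₀ : ℝ} (hD : IsComb D J y₀)
    {g : ℂ → ℂ} (hg : ContinuousOn g D) {ζ : ℂ} (hζ : ζ ∈ D) :
    IntervalIntegrable (fun s : ℝ => g (ζ.re + s * I)) volume y₀ ζ.im := by
  apply ContinuousOn.intervalIntegrable
  exact hg.comp (by fun_prop) fun t ht => hD.vert ζ hζ t ht

/-- Near `ζ` this integral differs by a constant from the wedge integral based at `ζ`. The only
global input is Cauchy's theorem on the thin rectangle between the abscissae of `ζ` and `ω` and the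
ordinates `y₀` and `ζ.im`, which `exists_box` places inside the comb. -/
theorem IsComb.hasDerivAt_combInt {D : Set ℂ} {J : Set ℝ} {y₀ : ℝ} (hD : IsComb D J y₀)
    {g : ℂ → ℂ} (hg : DifferentiableOn ℂ g D) {t₀ : ℝ} (ht₀ : t₀ ∈ J) {ζ : ℂ} (hζ : ζ ∈ D) :
    HasDerivAt (combInt g t₀ y₀) (g ζ) ζ := by
  obtain ⟨δ, hδ, hbox⟩ := hD.exists_box hζ
  have hball : Metric.ball ζ δ ⊆ D := by
    intro ω hω
    rw [Metric.mem_ball, dist_eq_norm] at hω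
    have h1 := (abs_re_le_norm (ω - ζ)).trans_lt hω
    have h2 := (abs_im_le_norm (ω - ζ)).trans_lt hω
    have := hbox ω.re ω.im (by simpa using h1) ⟨ζ.im, right_mem_uIcc, by simpa using h2⟩
    rwa [re_add_im] at this
  have hW := (hg.mono hball).isConservativeOn.hasDerivAt_wedgeIntegral
    (hg.mono hball).continuousOn (Metric.mem_ball_self hδ)
  have hW' := hW.add_const (combInt g t₀ y₀ ζ)
  refine hW'.congr_of_eventuallyEq ?_
  filter_upwards [Metric.ball_mem_nhds ζ hδ] with ω hω
  have hωD := hball hω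
  rw [Metric.mem_ball, dist_eq_norm] at hω
  have hre : |ω.re - ζ.re| < δ := by simpa using (abs_re_le_norm (ω - ζ)).trans_lt hω
  have him : |ω.im - ζ.im| < δ := by simpa using (abs_im_le_norm (ω - ζ)).trans_lt hω
  have hrect := integral_boundary_rect_eq_zero_of_differentiableOn g (ζ.re + y₀ * I)
    (ω.re + ζ.im * I) (hg.mono (by
      rintro v ⟨hv1, hv2⟩
      simp only [add_re, ofReal_re, mul_re, I_re, mul_zero, ofReal_im, I_im, mul_one, sub_self,
        add_zero, add_im, mul_im, zero_add, mem_preimage] at hv1 hv2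
      have := hbox v.re v.im ?_ ⟨v.im, hv2, by simpa using hδ⟩
      · rwa [re_add_im] at this
      · refine lt_of_le_of_lt ?_ hre
        rw [uIcc_comm] at hv1
        have := abs_sub_right_of_mem_uIcc hv1
        rw [abs_sub_comm] at this
        rwa [abs_sub_comm ω.re]))
  simp only [add_re, ofReal_re, mul_re, I_re, mul_zero, ofReal_im, I_im, mul_one, sub_self,
        add_zero, add_im, mul_im, zero_add, smul_eq_mul] at hrect
  have e1 : (∫ t in t₀..ω.re, g (t + y₀ * I)) = (∫ t in t₀..ζ.re, g (t + y₀ * I)) +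
      ∫ t in ζ.re..ω.re, g (t + y₀ * I) :=
    (intervalIntegral.integral_add_adjacent_intervals
      (hD.horizontal_intervalIntegrable hg.continuousOn ht₀ (hD.re_mem _ hζ))
      (hD.horizontal_intervalIntegrable hg.continuousOn (hD.re_mem _ hζ) (hD.re_mem _ hωD))).symm
  have hmix : IntervalIntegrable (fun s : ℝ => g (ω.re + s * I)) volume y₀ ζ.im := by
    apply ContinuousOn.intervalIntegrable
    exact hg.continuousOn.comp (by fun_prop) fun s hs =>
      hbox _ _ hre ⟨s, hs, by simpa using hδ⟩
  have hmix' : IntervalIntegrable (fun s : ℝ => g (ω.re + s * I)) volume ζ.im ω.im :=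
    hmix.symm.trans (hD.vertical_intervalIntegrable hg.continuousOn hωD)
  have e2 : (∫ s in y₀..ω.im, g (ω.re + s * I) * I) = (∫ s in y₀..ζ.im, g (ω.re + s * I) * I) +
      ∫ s in ζ.im..ω.im, g (ω.re + s * I) * I :=
    (intervalIntegral.integral_add_adjacent_intervals (hmix.mul_const I) (hmix'.mul_const I)).symm
  simp only [combInt, wedgeIntegral, smul_eq_mul, e1, e2, intervalIntegral.integral_mul_const]
  linear_combination hrect

/-- On a comb, two functions with equal derivatives differ by a constant. -/
theorem IsComb.eq_of_hasDerivAt_zero {D : Set ℂ} {J : Set ℝ} {y₀ : ℝ} (hD : IsComb D J y₀)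
    {F : ℂ → ℂ} (hF : ∀ ζ ∈ D, HasDerivAt F 0 ζ) {ζ ω : ℂ} (hζ : ζ ∈ D) (hω : ω ∈ D) :
    F ζ = F ω := by
  have seg : ∀ (γ : ℝ → ℂ) (v : ℂ) (x y : ℝ), (∀ s, HasDerivAt γ v s) →
      (∀ s ∈ uIcc x y, γ s ∈ D) → F (γ y) = F (γ x) := by
    intro γ v x y hγ hs
    have : ∫ s in x..y, (0 : ℂ) = F (γ y) - F (γ x) := by
      refine intervalIntegral.integral_eq_sub_of_hasDerivAt (f := fun s => F (γ s))
        (fun s hs' => ?_) (by simp)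
      have := (hF _ (hs s hs')).scomp s (hγ s)
      simpa [Function.comp_def] using this
    rw [intervalIntegral.integral_zero] at this
    exact sub_eq_zero.1 this.symm
  have vert : ∀ ζ ∈ D, F ζ = F (ζ.re + y₀ * I) := by
    intro ζ hζ
    have := seg (fun s => ζ.re + s * I) I y₀ ζ.im (fun s => by
      simpa using ((hasDerivAt_id s).ofReal_comp.mul_const I).const_add (ζ.re : ℂ)) (hD.vert ζ hζ)
    simpa [re_add_im] using this
  rw [vert ζ hζ, vert ω hω]
  refine seg (fun t => t + y₀ * I) 1 ω.re ζ.re (fun s => ?_) fun t ht => hD.base t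
    (hD.ordConnected.uIcc_subset (hD.re_mem _ hω) (hD.re_mem _ hζ) ht)
  simpa using (hasDerivAt_id s).ofReal_comp.add_const (y₀ * I)

/-! ### Holomorphic parameter integrals. -/

/-- Holomorphic dependence on a parameter of an integral with a locally uniform integrable bound. -/
theorem hasDerivAt_integral_of_locally_dominated {X : Type*} [MeasurableSpace X] {m : Measure X}
    {U : Set ℂ} (hU : IsOpen U) {F : ℂ → X → ℂ}
    (hF : ∀ᵐ s ∂m, DifferentiableOn ℂ (fun w => F w s) U)
    (hmeas : ∀ w ∈ U, AEStronglyMeasurable (F w) m)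
    (hb : ∀ w ∈ U, ∃ r > 0, ∃ bound : X → ℝ, Integrable bound m ∧
      ∀ᵐ s ∂m, ∀ v ∈ Metric.ball w r, ‖F v s‖ ≤ bound s) {w : ℂ} (hw : w ∈ U) :
    Integrable (fun s => deriv (fun v => F v s) w) m ∧
      HasDerivAt (fun v => ∫ s, F v s ∂m) (∫ s, deriv (fun v => F v s) w ∂m) w := by
  obtain ⟨r₁, hr₁, hball⟩ := Metric.isOpen_iff.1 hU w hw
  obtain ⟨r₂, hr₂, bound, hbi, hbound⟩ := hb w hw
  -- Half the radius: a circle of radius `r` about any point within `r` of `w` stays within both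
  -- `r₁` and `r₂` of `w`, as the Cauchy estimate for the derivative requires.
  set r := min r₁ r₂ / 2 with hr
  have hrpos : 0 < r := by positivity
  have hr1 : 2 * r ≤ r₁ := by rw [hr]; linarith [min_le_left r₁ r₂]
  have hr2 : 2 * r ≤ r₂ := by rw [hr]; linarith [min_le_right r₁ r₂]
  -- The derivative is measurable in `s` as a limit of difference quotients along a sequence.
  have hderivmeas : AEStronglyMeasurable (fun s => deriv (fun v => F v s) w) m := by
    have hseq : Tendsto (fun n : ℕ => w + ((r / (n + 1) : ℝ) : ℂ)) atTop (𝓝[≠] w) := by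
      refine tendsto_nhdsWithin_iff.2 ⟨?_, Eventually.of_forall fun n => ?_⟩
      · have h1 : Tendsto (fun n : ℕ => r / ((n : ℝ) + 1)) atTop (𝓝 0) :=
          tendsto_const_nhds.div_atTop (tendsto_natCast_atTop_atTop.atTop_add tendsto_const_nhds)
        simpa using (continuous_ofReal.tendsto 0 |>.comp h1).const_add w
      · have : r / ((n : ℝ) + 1) ≠ 0 := by positivity
        simpa using (by exact_mod_cast this : ((r / (n + 1) : ℝ) : ℂ) ≠ 0)
    refine aestronglyMeasurable_of_tendsto_ae atTop
      (f := fun (n : ℕ) s => slope (fun v => F v s) w (w + ((r / (n + 1) : ℝ) : ℂ))) ?_ ?_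
    · intro n
      simp only [slope_def_module]
      refine AEStronglyMeasurable.const_smul ((hmeas _ (hball ?_)).sub (hmeas w hw)) (_ : ℂ)
      rw [Metric.mem_ball, dist_eq_norm]
      simp only [add_sub_cancel_left, norm_real, Real.norm_eq_abs]
      rw [abs_of_pos (by positivity)]
      have : r / ((n : ℝ) + 1) ≤ r := div_le_self hrpos.le (by linarith [n.cast_nonneg (α := ℝ)])
      linarith
    · filter_upwards [hF] with s hs
      exact (hasDerivAt_iff_tendsto_slope.1
        (hs.differentiableAt (hU.mem_nhds hw)).hasDerivAt).comp hseq
  refine hasDerivAt_integral_of_dominated_loc_of_deriv_le (bound := fun s => bound s / r)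
    (F' := fun v s => deriv (fun u => F u s) v)
    (Metric.ball_mem_nhds w hrpos) ?_ ?_ hderivmeas ?_ (hbi.div_const r) ?_
  · filter_upwards [hU.mem_nhds hw] with v hv using hmeas v hv
  · refine hbi.mono' (hmeas w hw) ?_
    filter_upwards [hbound] with s hs using hs w (Metric.mem_ball_self hr₂)
  · filter_upwards [hF, hbound] with s hs hs' v hv
    refine Complex.norm_deriv_le_of_forall_mem_sphere_norm_le hrpos ?_ fun u hu => hs' u ?_
    · refine DifferentiableOn.diffContOnCl (hs.mono (subset_trans ?_ hball))
      refine (Metric.closure_ball_subset_closedBall).trans fun u hu => ?_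
      rw [Metric.mem_closedBall] at hu
      rw [Metric.mem_ball] at hv ⊢
      linarith [dist_triangle u v w]
    · rw [Metric.mem_sphere] at hu
      rw [Metric.mem_ball] at hv ⊢
      linarith [dist_triangle u v w]
  · filter_upwards [hF] with s hs v hv
    refine (hs.differentiableAt (hU.mem_nhds (hball ?_))).hasDerivAt
    rw [Metric.mem_ball] at hv ⊢
    linarith

/-! ### Regular singular points of first-order equations. -/

/-- A solution on a punctured disc of `(ζ - z₀) F' = q F + r` has at most a pole at `z₀`. -/
theorem meromorphicAt_of_ode {z₀ : ℂ} {ρ : ℝ} (hρ : 0 < ρ) {F q r : ℂ → ℂ}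
    (hF : DifferentiableOn ℂ F (Metric.ball z₀ ρ \ {z₀}))
    (hode : ∀ ζ ∈ Metric.ball z₀ ρ \ {z₀}, (ζ - z₀) * deriv F ζ = q ζ * F ζ + r ζ)
    (hq : ContinuousOn q (Metric.ball z₀ ρ)) (hr : ContinuousOn r (Metric.ball z₀ ρ)) :
    MeromorphicAt F z₀ := by
  have hopen : IsOpen (Metric.ball z₀ ρ \ {z₀}) := Metric.isOpen_ball.sdiff isClosed_singleton
  set σ := ρ / 2 with hσ
  have hσ0 : 0 < σ := by positivity
  have hsub : Metric.closedBall z₀ σ ⊆ Metric.ball z₀ ρ :=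
    Metric.closedBall_subset_ball (by rw [hσ]; linarith)
  obtain ⟨Kq, hKq⟩ := (isCompact_closedBall z₀ σ).exists_bound_of_continuousOn (hq.mono hsub)
  obtain ⟨Kr, hKr⟩ := (isCompact_closedBall z₀ σ).exists_bound_of_continuousOn (hr.mono hsub)
  obtain ⟨M, hM⟩ := (isCompact_sphere z₀ σ).exists_bound_of_continuousOn
    (hF.continuousOn.mono (fun ζ hζ => ⟨hsub (Metric.sphere_subset_closedBall hζ), fun h => by
      rw [mem_singleton_iff.1 h, Metric.mem_sphere, dist_self] at hζ; linarith⟩))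
  -- `N` dominates both coefficients on the disc, so `‖(ζ - z₀) F'‖ ≤ N ‖F‖ + N` and Gronwall's
  -- inequality limits the growth of `F` to order `N`.
  obtain ⟨N, hN⟩ := exists_nat_ge (max (max Kq Kr) 1)
  have hN1 : (1 : ℝ) ≤ N := (le_max_right _ _).trans hN
  have hNq : Kq ≤ N := ((le_max_left _ _).trans (le_max_left _ _)).trans hN
  have hNr : Kr ≤ N := ((le_max_right _ _).trans (le_max_left _ _)).trans hN
  have hN0 : N ≠ 0 := by rintro rfl; norm_num at hN1
  have key : ∀ ζ, ζ ≠ z₀ → ‖ζ - z₀‖ ≤ σ → ‖(ζ - z₀) ^ N * F ζ‖ ≤ (|M| + 1) * σ ^ N := by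
    intro ζ hζ hζσ
    have hd : 0 < ‖ζ - z₀‖ := norm_pos_iff.2 (sub_ne_zero.2 hζ)
    set d := ‖ζ - z₀‖
    set u : ℂ := (ζ - z₀) / d with hu
    have hdC : (d : ℂ) ≠ 0 := by exact_mod_cast hd.ne'
    have hun : ‖u‖ = 1 := by
      rw [hu, norm_div, norm_real, norm_norm]; exact div_self hd.ne'
    -- The radius through `ζ` in logarithmic parametrization, starting on the circle where `F` is
    -- bounded: along it `(ζ - z₀) F'` is minus the `τ`-derivative of `F (γ τ)`. The point `ζ` is
    -- reached at `τ = log (σ/d)`, so the Gronwall factor `exp (N τ)` is `(σ/d) ^ N`.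
    set γ : ℝ → ℂ := fun τ => z₀ + ((σ * Real.exp (-τ) : ℝ) : ℂ) * u with hγ
    have hγn : ∀ τ, ‖γ τ - z₀‖ = σ * Real.exp (-τ) := fun τ => by
      simp only [hγ]
      rw [add_sub_cancel_left, norm_mul, hun, mul_one, norm_real, Real.norm_of_nonneg (by positivity)]
    have hγmem : ∀ τ, 0 ≤ τ → γ τ ∈ Metric.closedBall z₀ σ ∧ γ τ ≠ z₀ := fun τ hτ => by
      constructor
      · rw [Metric.mem_closedBall, dist_eq_norm, hγn]
        exact mul_le_of_le_one_right hσ0.le (Real.exp_le_one_iff.2 (by linarith))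
      · intro h
        have := hγn τ
        rw [h, sub_self, norm_zero] at this
        have : 0 < σ * Real.exp (-τ) := by positivity
        linarith
    have hγd : ∀ τ, HasDerivAt γ (-(γ τ - z₀)) τ := fun τ => by
      have h1 : HasDerivAt (fun τ : ℝ => σ * Real.exp (-τ)) (-(σ * Real.exp (-τ))) τ := by
        simpa using ((Real.hasDerivAt_exp (-τ)).comp τ (hasDerivAt_neg τ)).const_mul σ
      have := (h1.ofReal_comp.mul_const u).const_add z₀
      convert! this using 1
      simp [hγ]
    have hfd : ∀ τ, 0 ≤ τ → HasDerivAt (fun τ => F (γ τ))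
        (-(q (γ τ) * F (γ τ) + r (γ τ))) τ := fun τ hτ => by
      have hmem : γ τ ∈ Metric.ball z₀ ρ \ {z₀} := ⟨hsub (hγmem τ hτ).1, (hγmem τ hτ).2⟩
      have := (hF.differentiableAt (hopen.mem_nhds hmem)).hasDerivAt.scomp τ (hγd τ)
      rw [← hode _ hmem]
      convert! this using 1
      rw [smul_eq_mul, neg_mul]
    have hexp : Real.exp (Real.log (σ / d)) = σ / d := Real.exp_log (by positivity)
    have hT : 0 ≤ Real.log (σ / d) := Real.log_nonneg ((one_le_div hd).2 hζσ)
    have hend : γ (Real.log (σ / d)) = ζ := by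
      simp only [hγ, Real.exp_neg, hexp, hu]
      have hσC : (σ : ℂ) ≠ 0 := by exact_mod_cast hσ0.ne'
      push_cast
      field_simp
      ring
    have hg := norm_le_gronwallBound_of_norm_deriv_right_le (f := fun τ => F (γ τ))
      (f' := fun τ => -(q (γ τ) * F (γ τ) + r (γ τ))) (δ := |M|) (K := N) (ε := N)
      (a := 0) (b := Real.log (σ / d))
      (fun τ hτ => (hfd τ hτ.1).continuousAt.continuousWithinAt)
      (fun τ hτ => (hfd τ hτ.1).hasDerivWithinAt)
      ((hM _ (by rw [Metric.mem_sphere, dist_eq_norm, hγn]; simp)).trans (le_abs_self M))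
      (fun τ hτ => by
        have h1 := hKq _ (hγmem τ hτ.1).1
        have h2 := hKr _ (hγmem τ hτ.1).1
        rw [norm_neg]
        refine (norm_add_le _ _).trans (add_le_add ?_ (h2.trans hNr))
        rw [norm_mul]
        exact mul_le_mul_of_nonneg_right (h1.trans hNq) (norm_nonneg _))
      _ ⟨hT, le_rfl⟩
    simp only [hend, sub_zero] at hg
    simp only [gronwallBound_of_K_ne_0 (show (N : ℝ) ≠ 0 by linarith)] at hg
    rw [Real.exp_nat_mul, hexp, div_self (by linarith)] at hg
    have hpow : 0 < (σ / d) ^ N := by positivity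
    calc ‖(ζ - z₀) ^ N * F ζ‖ = d ^ N * ‖F ζ‖ := by rw [norm_mul, norm_pow]
      _ ≤ d ^ N * ((|M| + 1) * (σ / d) ^ N) := by gcongr; linarith
      _ = (|M| + 1) * σ ^ N := by rw [div_pow]; field_simp
  -- One power more than in the bound makes the product tend to zero at `z₀`, so the singularity is
  -- removable.
  refine ⟨N + 1, ?_⟩
  have hnhds : Metric.ball z₀ σ ∈ 𝓝 z₀ := Metric.ball_mem_nhds _ hσ0
  suffices DifferentiableOn ℂ (fun ζ => (ζ - z₀) ^ (N + 1) • F ζ) (Metric.ball z₀ σ) from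
    this.analyticAt hnhds
  rw [← differentiableOn_compl_singleton_and_continuousAt_iff hnhds]
  constructor
  · have h1 : DifferentiableOn ℂ (fun ζ : ℂ => (ζ - z₀) ^ (N + 1)) (Metric.ball z₀ σ \ {z₀}) := by
      fun_prop
    exact h1.smul (hF.mono (sdiff_subset_sdiff_left (Metric.ball_subset_closedBall.trans hsub)))
  · rw [ContinuousAt]
    simp only [sub_self, zero_pow (Nat.succ_ne_zero N), zero_smul]
    refine squeeze_zero_norm' (a := fun ζ => ‖ζ - z₀‖ * ((|M| + 1) * σ ^ N)) ?_ ?_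
    · filter_upwards [hnhds] with ζ hζ
      by_cases h : ζ = z₀
      · simp [h]
      · rw [Metric.mem_ball, dist_eq_norm] at hζ
        rw [smul_eq_mul, pow_succ', mul_assoc, norm_mul]
        exact mul_le_mul_of_nonneg_left (key ζ h hζ.le) (norm_nonneg _)
    · have : Tendsto (fun ζ : ℂ => ‖ζ - z₀‖ * ((|M| + 1) * σ ^ N)) (𝓝 z₀)
          (𝓝 (‖z₀ - z₀‖ * ((|M| + 1) * σ ^ N))) :=
        Continuous.tendsto (by fun_prop) _
      simpa using this

/-- A solution on a punctured disc of `(ζ - z₀) F' = q F + r` either extends analytically to `z₀` or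
has a pole of order `k = -q(z₀)` there. -/
theorem removable_or_pole_of_ode {z₀ : ℂ} {ρ : ℝ} (hρ : 0 < ρ) {F q r : ℂ → ℂ}
    (hF : DifferentiableOn ℂ F (Metric.ball z₀ ρ \ {z₀}))
    (hode : ∀ ζ ∈ Metric.ball z₀ ρ \ {z₀}, (ζ - z₀) * deriv F ζ = q ζ * F ζ + r ζ)
    (hq : ContinuousOn q (Metric.ball z₀ ρ)) (hr : ContinuousOn r (Metric.ball z₀ ρ)) :
    (∃ k : ℕ, 0 < k ∧ q z₀ = -k ∧ ∃ K : ℂ → ℂ, AnalyticAt ℂ K z₀ ∧ K z₀ ≠ 0 ∧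
      ∀ᶠ ζ in 𝓝[≠] z₀, (ζ - z₀) ^ k * F ζ = K ζ) ∨
    ∃ K : ℂ → ℂ, AnalyticAt ℂ K z₀ ∧ ∀ᶠ ζ in 𝓝[≠] z₀, F ζ = K ζ := by
  have hmer := meromorphicAt_of_ode hρ hF hode hq hr
  have hopen : IsOpen (Metric.ball z₀ ρ \ {z₀}) := Metric.isOpen_ball.sdiff isClosed_singleton
  by_cases htop : meromorphicOrderAt F z₀ = ⊤
  · exact Or.inr ⟨0, analyticAt_const, by simpa using meromorphicOrderAt_eq_top_iff.1 htop⟩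
  obtain ⟨K, hK, hK0, hFK⟩ := (meromorphicOrderAt_ne_top_iff hmer).1 htop
  generalize (meromorphicOrderAt F z₀).untop₀ = n at hFK
  rcases le_or_gt 0 n with hn | hn
  · lift n to ℕ using hn
    refine Or.inr ⟨fun ζ => (ζ - z₀) ^ n * K ζ, by fun_prop, ?_⟩
    filter_upwards [hFK] with ζ h
    simpa using h
  · left
    obtain ⟨k, rfl⟩ : ∃ k : ℕ, n = -(k : ℤ) := ⟨n.natAbs, by omega⟩
    have hk : 0 < k := by omega
    have hFK' : ∀ᶠ ζ in 𝓝[≠] z₀, (ζ - z₀) ^ k * F ζ = K ζ := by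
      filter_upwards [hFK, self_mem_nhdsWithin] with ζ h hne
      have : ζ - z₀ ≠ 0 := sub_ne_zero.2 hne
      rw [h, smul_eq_mul, zpow_neg, zpow_natCast, ← mul_assoc, mul_inv_cancel₀ (pow_ne_zero _ this),
        one_mul]
    refine ⟨k, hk, ?_, K, hK, hK0, hFK'⟩
    -- `(ζ - z₀) K' = (k + q) K + (ζ - z₀) ^ k r`, and the left-hand side vanishes at `z₀`
    have hball : ∀ᶠ ζ in 𝓝[≠] z₀, ζ ∈ Metric.ball z₀ ρ \ {z₀} := by
      filter_upwards [nhdsWithin_le_nhds (Metric.ball_mem_nhds z₀ hρ), self_mem_nhdsWithin]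
        with ζ h1 h2 using ⟨h1, h2⟩
    have hode' : ∀ᶠ ζ in 𝓝[≠] z₀, (ζ - z₀) * deriv K ζ =
        (k + q ζ) * K ζ + (ζ - z₀) ^ k * r ζ := by
      filter_upwards [eventually_nhdsNE_eventually_nhds_iff.2 hFK', hball] with ζ h hζ
      have hd : HasDerivAt (fun ζ => (ζ - z₀) ^ k * F ζ)
          (k * (ζ - z₀) ^ (k - 1) * 1 * F ζ + (ζ - z₀) ^ k * deriv F ζ) ζ :=
        (((hasDerivAt_id ζ).sub_const z₀).pow k).mul
          (hF.differentiableAt (hopen.mem_nhds hζ)).hasDerivAt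
      have hd' := (hd.congr_of_eventuallyEq (h.mono fun _ h => h.symm)).deriv
      rw [hd', ← h.self_of_nhds]
      have e : (ζ - z₀) ^ k = (ζ - z₀) ^ (k - 1) * (ζ - z₀) := by
        rw [← pow_succ, Nat.sub_add_cancel hk]
      linear_combination (ζ - z₀) ^ k * hode ζ hζ - (k * F ζ) * e
    have hne : (𝓝[≠] z₀).NeBot := inferInstance
    have hl : Tendsto (fun ζ => (ζ - z₀) * deriv K ζ) (𝓝[≠] z₀) (𝓝 ((z₀ - z₀) * deriv K z₀)) :=
      (ContinuousAt.mul (by fun_prop) hK.deriv.continuousAt).tendsto.mono_left nhdsWithin_le_nhds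
    have hqc : ContinuousAt q z₀ := hq.continuousAt (Metric.ball_mem_nhds z₀ hρ)
    have hrc : ContinuousAt r z₀ := hr.continuousAt (Metric.ball_mem_nhds z₀ hρ)
    have hr' : Tendsto (fun ζ => (k + q ζ) * K ζ + (ζ - z₀) ^ k * r ζ) (𝓝[≠] z₀)
        (𝓝 ((k + q z₀) * K z₀ + (z₀ - z₀) ^ k * r z₀)) := by
      refine Tendsto.mono_left ?_ nhdsWithin_le_nhds
      exact (((continuousAt_const.add hqc).mul hK.continuousAt).add
        (ContinuousAt.mul (by fun_prop) hrc)).tendsto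
    have := tendsto_nhds_unique (hl.congr' hode') hr'
    simp only [sub_self, zero_mul, zero_pow hk.ne', add_zero] at this
    have := (mul_eq_zero.1 this.symm).resolve_right hK0
    linear_combination this

/-! ### The Hardy space of the upper half-plane and Cauchy's formula. -/

/-- `w` is the boundary value of the function `W` in the Hardy space of the upper half-plane. -/
structure IsHardyPair (W : ℂ → ℂ) (w : ℝ → ℂ) : Prop where
  memLp : MemLp w 2 volume
  diff : DifferentiableOn ℂ W {ζ | 0 < ζ.im}
  bound : ∃ C : NNReal, ∀ y : ℝ, 0 < y → eLpNorm (fun x : ℝ => W (x + y * I)) 2 volume ≤ C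
  lim : ∀ᵐ x : ℝ, Tendsto (fun y : ℝ => W (x + y * I)) (𝓝[>] 0) (𝓝 (w x))

theorem isOpen_upperHalfPlane (y : ℝ) : IsOpen {ζ : ℂ | y < ζ.im} :=
  isOpen_lt continuous_const continuous_im

theorem sub_ne_zero_of_im_ne {ζ : ℂ} (hζ : ζ.im ≠ 0) (x : ℝ) : (x - ζ : ℂ) ≠ 0 := by
  intro h
  apply hζ
  simpa using congrArg Complex.im h

theorem norm_inv_sub_sq {ζ : ℂ} (hζ : ζ.im ≠ 0) (x : ℝ) :
    ‖(x - ζ : ℂ)⁻¹‖ ^ 2 = (ζ.im ^ 2)⁻¹ * (1 + ((x - ζ.re) / ζ.im) ^ 2)⁻¹ := by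
  rw [norm_inv, inv_pow, ← normSq_eq_norm_sq, normSq_apply]
  simp only [sub_re, ofReal_re, sub_im, ofReal_im, zero_sub]
  rw [← mul_inv]
  congr 1
  field_simp
  ring

theorem memLp_inv_sub {ζ : ℂ} (hζ : ζ.im ≠ 0) : MemLp (fun x : ℝ => (x - ζ : ℂ)⁻¹) 2 volume := by
  have hcont : Continuous (fun x : ℝ => (x - ζ : ℂ)⁻¹) :=
    Continuous.inv₀ (by fun_prop) (sub_ne_zero_of_im_ne hζ)
  rw [memLp_two_iff_integrable_sq_norm hcont.aestronglyMeasurable]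
  simp_rw [norm_inv_sub_sq hζ]
  exact (((integrable_inv_one_add_sq.comp_div hζ).comp_sub_right ζ.re)).const_mul _

theorem integral_norm_inv_sub_sq {ζ : ℂ} (hζ : ζ.im ≠ 0) :
    ∫ x : ℝ, ‖(x - ζ : ℂ)⁻¹‖ ^ 2 = Real.pi / |ζ.im| := by
  simp_rw [norm_inv_sub_sq hζ]
  rw [integral_const_mul, integral_sub_right_eq_self (f := fun x : ℝ => (1 + (x / ζ.im) ^ 2)⁻¹),
    Measure.integral_comp_div (g := fun x : ℝ => (1 + x ^ 2)⁻¹), integral_univ_inv_one_add_sq,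
    smul_eq_mul, ← sq_abs]
  have := abs_pos.2 hζ
  field_simp

theorem eLpNorm_inv_sub {ζ : ℂ} (hζ : ζ.im ≠ 0) :
    eLpNorm (fun x : ℝ => (x - ζ : ℂ)⁻¹) 2 volume = ENNReal.ofReal (√(Real.pi / |ζ.im|)) := by
  rw [(memLp_inv_sub hζ).eLpNorm_eq_integral_rpow_norm (by norm_num) (by norm_num)]
  simp only [ENNReal.toReal_ofNat, Real.rpow_ofNat]
  rw [integral_norm_inv_sub_sq hζ, Real.sqrt_eq_rpow]
  norm_num

theorem lintegral_mul_le_eLpNorm {f g : ℝ → ℂ} (hf : AEStronglyMeasurable f)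
    (hg : AEStronglyMeasurable g) :
    ∫⁻ x, ‖f x * g x‖ₑ ≤ eLpNorm f 2 volume * eLpNorm g 2 volume := by
  have := eLpNorm_smul_le_mul_eLpNorm (p := 2) (q := 2) (r := 1) hg hf
  rw [eLpNorm_one_eq_lintegral_enorm] at this
  simpa using this

/-- A sequence which is bounded in `L²` and tends to zero almost everywhere tends to zero weakly. -/
theorem tendsto_lintegral_mul_of_ae {d : ℕ → ℝ → ℂ} {q : ℝ → ℂ} (hd : ∀ n, Measurable (d n))
    {C : NNReal} (hC : ∀ n, eLpNorm (d n) 2 volume ≤ C) (hq : MemLp q 2 volume)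
    (hqm : Measurable q)
    (hlim : ∀ᵐ x, Tendsto (fun n => d n x) atTop (𝓝 0)) :
    Tendsto (fun n => ∫⁻ x, ‖d n x‖ₑ * ‖q x‖ₑ) atTop (𝓝 0) := by
  have hsq : ∀ f : ℝ → ℂ, ∫⁻ x, ‖f x‖ₑ ^ 2 = eLpNorm f 2 volume ^ 2 := fun f => by
    rw [eLpNorm_eq_lintegral_rpow_enorm_toReal (by norm_num) (by norm_num)]
    simp only [ENNReal.toReal_ofNat, ENNReal.rpow_ofNat]
    rw [← ENNReal.rpow_natCast, ← ENNReal.rpow_mul]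
    norm_num
  -- Truncation at `M ‖q‖²` permits dominated convergence. Where the truncation is active, `M ‖q‖ ≤
  -- ‖d‖`, so the excess is at most `‖d‖²/M`, whose integral is at most `C²/M` uniformly in `n`.
  have hmain : ∀ M : ℕ, Tendsto (fun n => ∫⁻ x, min (‖d n x‖ₑ * ‖q x‖ₑ) (M * ‖q x‖ₑ ^ 2))
      atTop (𝓝 0) := by
    intro M
    have := tendsto_lintegral_of_dominated_convergence (μ := volume)
      (F := fun n x => min (‖d n x‖ₑ * ‖q x‖ₑ) (M * ‖q x‖ₑ ^ 2)) (f := fun _ => 0)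
      (fun x => M * ‖q x‖ₑ ^ 2)
      (fun n => by have := hd n; fun_prop) (fun n => Eventually.of_forall fun x => min_le_right _ _)
      ?_ ?_
    · simpa using this
    · rw [lintegral_const_mul _ (by fun_prop), hsq]
      exact ENNReal.mul_ne_top (by simp) (ENNReal.pow_ne_top hq.2.ne)
    · filter_upwards [hlim] with x hx
      have h1 : Tendsto (fun n => ‖d n x‖ₑ * ‖q x‖ₑ) atTop (𝓝 (0 * ‖q x‖ₑ)) := by
        refine ENNReal.Tendsto.mul_const ?_ (Or.inr (by simp))
        simpa using hx.enorm
      rw [zero_mul] at h1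
      exact tendsto_of_tendsto_of_tendsto_of_le_of_le tendsto_const_nhds h1 (fun _ => zero_le)
        fun _ => min_le_left _ _
  have hle : ∀ M : ℕ, M ≠ 0 → ∀ n, ∫⁻ x, ‖d n x‖ₑ * ‖q x‖ₑ ≤
      (∫⁻ x, min (‖d n x‖ₑ * ‖q x‖ₑ) (M * ‖q x‖ₑ ^ 2)) + (C : ENNReal) ^ 2 / M := by
    intro M hM n
    have hM' : (M : ENNReal) ≠ 0 := by exact_mod_cast hM
    have h1 : ∀ x, ‖d n x‖ₑ * ‖q x‖ₑ ≤
        min (‖d n x‖ₑ * ‖q x‖ₑ) (M * ‖q x‖ₑ ^ 2) + ‖d n x‖ₑ ^ 2 / M := by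
      intro x
      rcases le_total (‖d n x‖ₑ * ‖q x‖ₑ) (M * ‖q x‖ₑ ^ 2) with h | h
      · rw [min_eq_left h]; exact le_self_add
      · refine le_trans ?_ le_add_self
        rw [ENNReal.le_div_iff_mul_le (Or.inl hM') (Or.inl (by simp))]
        by_cases hq0 : ‖q x‖ₑ = 0
        · simp [hq0]
        · have : ‖q x‖ₑ * M ≤ ‖d n x‖ₑ := by
            rw [← ENNReal.mul_le_mul_iff_left hq0 (by simp)]
            calc _ = M * ‖q x‖ₑ ^ 2 := by ring
              _ ≤ _ := h
          calc _ = ‖d n x‖ₑ * (‖q x‖ₑ * M) := by ring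
            _ ≤ ‖d n x‖ₑ * ‖d n x‖ₑ := by gcongr
            _ = _ := by ring
    refine (lintegral_mono h1).trans ?_
    rw [lintegral_add_right _ (by have := hd n; fun_prop)]
    gcongr
    simp_rw [div_eq_mul_inv]
    rw [lintegral_mul_const _ (by have := hd n; fun_prop), hsq]
    gcongr
    exact hC n
  rw [ENNReal.tendsto_nhds_zero]
  intro e he
  obtain ⟨M, hM⟩ : ∃ M : ℕ, (C : ENNReal) ^ 2 / M ≤ e / 2 ∧ M ≠ 0 := by
    have h1 : Tendsto (fun M : ℕ => (C : ENNReal) ^ 2 / M) atTop (𝓝 0) :=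
      ENNReal.Tendsto.const_div ENNReal.tendsto_nat_nhds_top (Or.inr (by simp)) |>.trans (by simp)
    exact ((ENNReal.tendsto_nhds_zero.1 h1 (e / 2) (by simpa using he.ne')).and
      (eventually_ne_atTop 0)).exists
  filter_upwards [ENNReal.tendsto_nhds_zero.1 (hmain M) (e / 2) (by simpa using he.ne')] with n hn
  calc _ ≤ _ := hle M hM.2 n
    _ ≤ e / 2 + e / 2 := add_le_add hn hM.1
    _ = e := ENNReal.add_halves e

theorem IsHardyPair.continuous_line {W : ℂ → ℂ} {w : ℝ → ℂ} (hW : IsHardyPair W w) {y : ℝ}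
    (hy : 0 < y) : Continuous fun x : ℝ => W (x + y * I) :=
  hW.diff.continuousOn.comp_continuous (by fun_prop) fun x => by simpa using hy

/-- A contour shift through growing rectangles. The vertical sides are not known to tend to zero,
but they are bounded by a function `m` of the abscissa that is integrable over the line. If the two
integrals differed, `m R + m (-R)` would stay bounded below for all large `R`. -/
theorem IsHardyPair.integral_line_eq {W : ℂ → ℂ} {w : ℝ → ℂ} (hW : IsHardyPair W w) {ζ : ℂ}
    (hζ : ζ.im < 0) {y₁ y₂ : ℝ} (hy₁ : 0 < y₁) (hy : y₁ ≤ y₂) :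
    ∫ x : ℝ, W (x + y₁ * I) * (x + y₁ * I - ζ)⁻¹ = ∫ x : ℝ, W (x + y₂ * I) * (x + y₂ * I - ζ)⁻¹ := by
  set k : ℂ → ℂ := fun v => W v * (v - ζ)⁻¹ with hk
  have hkd : DifferentiableOn ℂ k {v | 0 < v.im} := by
    refine hW.diff.mul (DifferentiableOn.inv (by fun_prop) fun v hv h => ?_)
    have h1 : v.im - ζ.im = 0 := by simpa using congrArg Complex.im h
    have h2 : 0 < v.im := hv
    linarith
  obtain ⟨C, hC⟩ := hW.bound
  have him : ∀ y : ℝ, 0 < y → (ζ - y * I).im ≠ 0 := fun y h => by simp; linarith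
  have hq : ∀ y : ℝ, 0 < y → eLpNorm (fun x : ℝ => ((x : ℂ) + y * I - ζ)⁻¹) 2 volume ≤
      ENNReal.ofReal (√(Real.pi / |ζ.im|)) := fun y h => by
    have h1 : (fun x : ℝ => ((x : ℂ) + y * I - ζ)⁻¹) = fun x : ℝ => ((x : ℂ) - (ζ - y * I))⁻¹ := by
      ext x; congr 1; ring
    rw [h1, eLpNorm_inv_sub (him y h)]
    refine ENNReal.ofReal_le_ofReal (Real.sqrt_le_sqrt (div_le_div_of_nonneg_left Real.pi_pos.le
      (abs_pos.2 hζ.ne) ?_))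
    simp only [sub_im, mul_im, ofReal_re, I_im, mul_one, ofReal_im, I_re, mul_zero, add_zero]
    rw [abs_of_neg hζ, abs_of_neg (by linarith)]
    linarith
  have hqc : ∀ y : ℝ, 0 < y → Continuous fun x : ℝ => ((x : ℂ) + y * I - ζ)⁻¹ := fun y h => by
    refine Continuous.inv₀ (by fun_prop) fun x h' => ?_
    have : y - ζ.im = 0 := by simpa using congrArg Complex.im h'
    linarith
  have hline : ∀ y : ℝ, 0 < y → ∫⁻ x : ℝ, ‖k (x + y * I)‖ₑ ≤
      C * ENNReal.ofReal (√(Real.pi / |ζ.im|)) := fun y h =>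
    (lintegral_mul_le_eLpNorm (hW.continuous_line h).aestronglyMeasurable
      (hqc y h).aestronglyMeasurable).trans (mul_le_mul' (hC y h) (hq y h))
  have hkc : ∀ y : ℝ, 0 < y → Continuous fun x : ℝ => k (x + y * I) := fun y h =>
    (hW.continuous_line h).mul (hqc y h)
  have hint : ∀ y : ℝ, 0 < y → Integrable fun x : ℝ => k (x + y * I) := fun y h =>
    ⟨(hkc y h).aestronglyMeasurable,
      (hline y h).trans_lt (ENNReal.mul_lt_top (by simp) (by simp))⟩
  have hvert : ∀ x : ℝ, ContinuousOn (fun y : ℝ => k (x + y * I)) (Ioc y₁ y₂) := fun x =>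
    hkd.continuousOn.comp (by fun_prop) fun y h => by simpa using hy₁.trans h.1
  set m : ℝ → ENNReal := fun x => ∫⁻ y in Ioc y₁ y₂, ‖k (x + y * I)‖ₑ with hm
  have hmeas : AEMeasurable (Function.uncurry fun (x y : ℝ) => ‖k (x + y * I)‖ₑ)
      ((volume : Measure ℝ).prod (volume.restrict (Ioc y₁ y₂))) := by
    have e : (volume : Measure ℝ).prod (volume.restrict (Ioc y₁ y₂)) =
        ((volume : Measure ℝ).prod volume).restrict (univ ×ˢ Ioc y₁ y₂) := by
      rw [← Measure.prod_restrict, Measure.restrict_univ]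
    rw [e]
    refine (ContinuousOn.aemeasurable (f := fun p : ℝ × ℝ => k (p.1 + p.2 * I)) ?_
      (MeasurableSet.univ.prod measurableSet_Ioc)).enorm
    refine hkd.continuousOn.comp (by fun_prop) fun p hp => ?_
    have : y₁ < p.2 := hp.2.1
    simpa using hy₁.trans this
  have hmfin : ∫⁻ x, m x < ⊤ := by
    rw [lintegral_lintegral_swap hmeas]
    calc _ ≤ ∫⁻ y in Ioc y₁ y₂, C * ENNReal.ofReal (√(Real.pi / |ζ.im|)) :=
          setLIntegral_mono measurable_const fun y h => hline y (hy₁.trans h.1)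
      _ < ⊤ := by
          rw [lintegral_const]
          exact ENNReal.mul_lt_top (ENNReal.mul_lt_top (by simp) (by simp)) (by simp)
  by_contra hne
  set J₁ := ∫ x : ℝ, k (x + y₁ * I)
  set J₂ := ∫ x : ℝ, k (x + y₂ * I)
  have hpos : 0 < ‖J₁ - J₂‖ := norm_pos_iff.2 (sub_ne_zero.2 hne)
  have hlim : Tendsto (fun R : ℝ => ‖(∫ x in (-R)..R, k (x + y₁ * I)) -
      ∫ x in (-R)..R, k (x + y₂ * I)‖) atTop (𝓝 ‖J₁ - J₂‖) :=
    ((intervalIntegral_tendsto_integral (hint _ hy₁) tendsto_neg_atTop_atBot tendsto_id).sub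
      (intervalIntegral_tendsto_integral (hint _ (hy₁.trans_le hy)) tendsto_neg_atTop_atBot
        tendsto_id)).norm
  obtain ⟨R₀, hR₀⟩ := eventually_atTop.1 (hlim.eventually (lt_mem_nhds (half_lt_self hpos)))
  have hside : ∀ x : ℝ, ‖∫ y in y₁..y₂, k (x + y * I)‖ₑ ≤ m x := fun x => by
    rw [intervalIntegral.integral_of_le hy]
    exact enorm_integral_le_lintegral_enorm _
  have hbig : ∀ R ∈ Ici R₀, ENNReal.ofReal (‖J₁ - J₂‖ / 2) ≤ m R + m (-R) := by
    intro R hR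
    have hrect := integral_boundary_rect_eq_zero_of_differentiableOn k (((-R : ℝ) : ℂ) + y₁ * I)
      (R + y₂ * I) (hkd.mono (by
        rintro v ⟨_, hv2⟩
        simp only [add_im, ofReal_im, mul_im, ofReal_re, I_im, mul_one, I_re, mul_zero, add_zero,
          zero_add, mem_preimage, uIcc_of_le hy] at hv2
        exact hy₁.trans_le hv2.1))
    simp only [add_re, ofReal_re, mul_re, I_re, mul_zero, ofReal_im, I_im, mul_one, sub_self,
        add_zero, add_im, mul_im, zero_add, smul_eq_mul] at hrect
    have e : (∫ x in (-R)..R, k (x + y₁ * I)) - ∫ x in (-R)..R, k (x + y₂ * I) =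
        I * (∫ y in y₁..y₂, k (((-R : ℝ) : ℂ) + y * I)) - I * ∫ y in y₁..y₂, k (R + y * I) := by
      linear_combination hrect
    have h1 := (hR₀ R hR).le
    rw [e] at h1
    calc _ ≤ ENNReal.ofReal _ := ENNReal.ofReal_le_ofReal h1
      _ = _ := ofReal_norm _
      _ ≤ _ := enorm_sub_le
      _ ≤ _ := by
        rw [enorm_mul, enorm_mul, add_comm]
        have : ‖I‖ₑ = 1 := by simp [← ofReal_norm]
        rw [this, one_mul, one_mul]
        exact add_le_add (hside R) (hside (-R))
  have htop : ∫⁻ R in Ici R₀, ENNReal.ofReal (‖J₁ - J₂‖ / 2) = ⊤ := by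
    rw [lintegral_const]
    simp [ENNReal.mul_top, hpos]
  have hmm : AEMeasurable m := hmeas.lintegral_prod_right'
  have hle : (⊤ : ENNReal) ≤ (∫⁻ x, m x) + ∫⁻ x, m x := by
    rw [← htop]
    calc _ ≤ ∫⁻ R in Ici R₀, (m R + m (-R)) := setLIntegral_mono' measurableSet_Ici hbig
      _ ≤ ∫⁻ R, (m R + m (-R)) := setLIntegral_le_lintegral _ _
      _ = (∫⁻ R, m R) + ∫⁻ R, m (-R) := lintegral_add_left' hmm _
      _ = _ := by rw [lintegral_neg_eq_self]
  exact (not_lt_of_ge hle) (ENNReal.add_lt_top.2 ⟨hmfin, hmfin⟩)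

theorem enorm_inv_add_sub_le {ζ : ℂ} (hζ : ζ.im < 0) {y : ℝ} (hy : 0 ≤ y) (x : ℝ) :
    ‖((x : ℂ) + y * I - ζ)⁻¹‖ₑ ≤ ‖(x - ζ : ℂ)⁻¹‖ₑ := by
  rw [enorm_le_iff_norm_le, norm_inv, norm_inv]
  have h0 : 0 < ‖(x - ζ : ℂ)‖ := norm_pos_iff.2 (sub_ne_zero_of_im_ne hζ.ne x)
  refine inv_anti₀ h0 ?_
  rw [Complex.norm_eq_sqrt_sq_add_sq, Complex.norm_eq_sqrt_sq_add_sq]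
  refine Real.sqrt_le_sqrt ?_
  simp only [sub_re, add_re, ofReal_re, mul_re, I_re, mul_zero, ofReal_im, I_im, mul_one,
    sub_im, add_im, mul_im, zero_sub, sub_self, add_zero, zero_add]
  nlinarith

/-- The Cauchy integral of a boundary value of a Hardy function vanishes in the lower half-plane. -/
theorem IsHardyPair.integral_mul_inv_eq_zero {W : ℂ → ℂ} {w : ℝ → ℂ} (hW : IsHardyPair W w) {ζ : ℂ}
    (hζ : ζ.im < 0) : ∫ x : ℝ, w x * (x - ζ : ℂ)⁻¹ = 0 := by
  obtain ⟨C, hC⟩ := hW.bound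
  set J : ℝ → ℂ := fun y => ∫ x : ℝ, W (x + y * I) * (x + y * I - ζ)⁻¹ with hJ
  have him : ∀ y : ℝ, 0 ≤ y → (ζ - y * I).im ≠ 0 := fun y h => by simp; linarith
  have hq1 : ∀ y : ℝ, (fun x : ℝ => ((x : ℂ) + y * I - ζ)⁻¹) =
      fun x : ℝ => ((x : ℂ) - (ζ - y * I))⁻¹ := fun y => by ext x; congr 1; ring
  have hJ1 : ∀ y : ℝ, 0 < y → ‖J y‖ₑ ≤ C * ENNReal.ofReal (√(Real.pi / y)) := fun y h => by
    refine (enorm_integral_le_lintegral_enorm _).trans ((lintegral_mul_le_eLpNorm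
      (hW.continuous_line h).aestronglyMeasurable ?_).trans (mul_le_mul' (hC y h) ?_))
    · rw [hq1]; exact (memLp_inv_sub (him y h.le)).1
    · rw [hq1, eLpNorm_inv_sub (him y h.le)]
      gcongr
      simp only [sub_im, mul_im, ofReal_re, I_im, mul_one, ofReal_im, I_re, mul_zero, add_zero]
      rw [abs_of_neg (by linarith)]
      linarith
  -- The integral does not depend on the height, while the `L²` bounds make it `O(y^(-1/2))`.
  have hJ0 : ∀ y : ℝ, 0 < y → J y = 0 := fun y h => by
    have hconst : ∀ᶠ y' : ℝ in atTop, ‖J y‖ₑ ≤ C * ENNReal.ofReal (√(Real.pi / y')) := by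
      filter_upwards [eventually_ge_atTop y] with y' h'
      have : J y = J y' := hW.integral_line_eq hζ h h'
      rw [this]
      exact hJ1 y' (h.trans_le h')
    have hlim : Tendsto (fun y' : ℝ => (C : ENNReal) * ENNReal.ofReal (√(Real.pi / y'))) atTop
        (𝓝 (C * ENNReal.ofReal (√0))) := by
      refine ENNReal.Tendsto.const_mul (ENNReal.tendsto_ofReal
        ((Real.continuous_sqrt.tendsto 0).comp ?_)) (Or.inr (by simp))
      exact tendsto_const_nhds.div_atTop tendsto_id
    have := ge_of_tendsto hlim hconst
    simpa using this
  -- pass to the limit `y → 0`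
  set y : ℕ → ℝ := fun n => 1 / ((n : ℝ) + 1) with hy
  have hy0 : ∀ n, 0 < y n := fun n => by positivity
  have hylim : Tendsto y atTop (𝓝[>] 0) := tendsto_nhdsWithin_iff.2
    ⟨tendsto_one_div_add_atTop_nhds_zero_nat, Eventually.of_forall hy0⟩
  obtain ⟨w', hw'm, hww'⟩ := hW.memLp.1
  have hw'L : MemLp w' 2 volume := hW.memLp.ae_eq hww'
  have hint : ∫ x : ℝ, w x * (x - ζ : ℂ)⁻¹ = ∫ x : ℝ, w' x * (x - ζ : ℂ)⁻¹ :=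
    integral_congr_ae (by filter_upwards [hww'] with x hx; rw [hx])
  rw [hint]
  have hqm : MemLp (fun x : ℝ => (x - ζ : ℂ)⁻¹) 2 volume := memLp_inv_sub hζ.ne
  have hqc : Continuous (fun x : ℝ => (x - ζ : ℂ)⁻¹) :=
    Continuous.inv₀ (by fun_prop) (sub_ne_zero_of_im_ne hζ.ne)
  obtain ⟨B, hB⟩ : ∃ B : NNReal, eLpNorm w' 2 volume ≤ B := ⟨_, (ENNReal.coe_toNNReal hw'L.2.ne).ge⟩
  -- The boundary values are attained only almost everywhere, with an `L²` bound; this gives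
  -- convergence against the fixed kernel. The displacement of the kernel itself is treated by
  -- dominated convergence in `hqdiff`.
  have hweak := tendsto_lintegral_mul_of_ae (d := fun n x => W (x + y n * I) - w' x)
    (C := C + B) (q := fun x : ℝ => (x - ζ : ℂ)⁻¹)
    (fun n => (hW.continuous_line (hy0 n)).measurable.sub hw'm.measurable)
    (fun n => by
      refine (eLpNorm_sub_le (hW.continuous_line (hy0 n)).aestronglyMeasurable hw'L.1
        (by norm_num)).trans ?_
      push_cast
      exact add_le_add (hC _ (hy0 n)) hB) hqm hqc.measurable (by
      filter_upwards [hW.lim, hww'] with x hx hx'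
      have := (hx.comp hylim).sub_const (w' x)
      rw [hx', sub_self] at this
      exact this)
  have hqdiff : Tendsto (fun n => ∫⁻ x : ℝ, ‖w' x * (((x : ℂ) + y n * I - ζ)⁻¹ -
      (x - ζ : ℂ)⁻¹)‖ₑ) atTop (𝓝 0) := by
    have := tendsto_lintegral_of_dominated_convergence (μ := volume)
      (F := fun n x => ‖w' x * (((x : ℂ) + y n * I - ζ)⁻¹ - (x - ζ : ℂ)⁻¹)‖ₑ) (f := fun _ => 0)
      (fun x => 2 * ‖w' x * (x - ζ : ℂ)⁻¹‖ₑ)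
      (fun n => by have := hw'm.measurable; fun_prop)
      (fun n => Eventually.of_forall fun x => ?_) ?_ (Eventually.of_forall fun x => ?_)
    · simpa using this
    · dsimp only
      rw [enorm_mul, enorm_mul, mul_left_comm]
      gcongr
      calc _ ≤ _ := enorm_sub_le
        _ ≤ _ := add_le_add (enorm_inv_add_sub_le hζ (hy0 n).le x) le_rfl
        _ = _ := (two_mul _).symm
    · rw [lintegral_const_mul _ (by have := hw'm.measurable; fun_prop)]
      exact ENNReal.mul_ne_top (by simp) ((lintegral_mul_le_eLpNorm hw'L.1 hqm.1).trans_lt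
        (ENNReal.mul_lt_top hw'L.2 hqm.2)).ne
    · have h0 : ((x : ℂ) + (0 : ℝ) * I - ζ) ≠ 0 := by
        simpa using sub_ne_zero_of_im_ne hζ.ne x
      have hi : ContinuousAt (fun t : ℝ => ((x : ℂ) + t * I - ζ)⁻¹) 0 :=
        ContinuousAt.inv₀ (by fun_prop) h0
      have hc : ContinuousAt (fun t : ℝ => ‖w' x * (((x : ℂ) + t * I - ζ)⁻¹ - (x - ζ : ℂ)⁻¹)‖ₑ) 0 := by
        fun_prop
      have := hc.tendsto.comp (hylim.mono_right nhdsWithin_le_nhds)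
      simpa [Function.comp_def] using this
  have hsum := hweak.add hqdiff
  rw [add_zero] at hsum
  have hbd : ∀ n, ‖∫ x : ℝ, w' x * (x - ζ : ℂ)⁻¹‖ₑ ≤
      (∫⁻ x : ℝ, ‖W (x + y n * I) - w' x‖ₑ * ‖(x - ζ : ℂ)⁻¹‖ₑ) +
      ∫⁻ x : ℝ, ‖w' x * (((x : ℂ) + y n * I - ζ)⁻¹ - (x - ζ : ℂ)⁻¹)‖ₑ := fun n => by
    have hi1 : Integrable fun x : ℝ => w' x * (x - ζ : ℂ)⁻¹ := MemLp.integrable_mul (p := 2) (q := 2) hw'L hqm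
    have hi2 : Integrable fun x : ℝ => W (x + y n * I) * (x + y n * I - ζ)⁻¹ := by
      refine MemLp.integrable_mul (p := 2) (q := 2) ⟨(hW.continuous_line
        (hy0 n)).aestronglyMeasurable, (hC _ (hy0 n)).trans_lt (by simp)⟩ ?_
      rw [hq1]; exact memLp_inv_sub (him _ (hy0 n).le)
    have e : ∫ x : ℝ, w' x * (x - ζ : ℂ)⁻¹ = -∫ x : ℝ, (W (x + y n * I) * (x + y n * I - ζ)⁻¹ -
        w' x * (x - ζ : ℂ)⁻¹) := by
      rw [integral_sub hi2 hi1]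
      have : ∫ x : ℝ, W (x + y n * I) * (x + y n * I - ζ)⁻¹ = 0 := hJ0 _ (hy0 n)
      rw [this]; ring
    rw [e, enorm_neg, ← lintegral_add_right _ (by have := hw'm.measurable; fun_prop)]
    refine (enorm_integral_le_lintegral_enorm _).trans (lintegral_mono fun x => ?_)
    have e2 : W (x + y n * I) * (x + y n * I - ζ)⁻¹ - w' x * (x - ζ : ℂ)⁻¹ =
        (W (x + y n * I) - w' x) * (x + y n * I - ζ)⁻¹ +
        w' x * (((x : ℂ) + y n * I - ζ)⁻¹ - (x - ζ : ℂ)⁻¹) := by ring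
    rw [e2]
    refine (enorm_add_le _ _).trans (add_le_add ?_ le_rfl)
    rw [enorm_mul]
    exact mul_le_mul' le_rfl (enorm_inv_add_sub_le hζ (hy0 n).le x)
  have := ge_of_tendsto hsum (Eventually.of_forall hbd)
  simpa using this

/-- The Hardy pair obtained by subtracting a simple fraction and dividing out a zero. -/
theorem IsHardyPair.blaschke {W : ℂ → ℂ} {w : ℝ → ℂ} (hW : IsHardyPair W w) {ζ : ℂ}
    (hζ : 0 < ζ.im) :
    ∃ K : ℂ → ℂ, IsHardyPair K fun x : ℝ =>
      (w x - W ζ * (ζ - conj ζ) * (x - conj ζ : ℂ)⁻¹) * (x - conj ζ) * (x - ζ : ℂ)⁻¹ := by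
  have hcne : ∀ v : ℂ, 0 ≤ v.im → v - conj ζ ≠ 0 := fun v hv h => by
    have : v.im + ζ.im = 0 := by simpa using congrArg Complex.im h
    linarith
  set H : ℂ → ℂ := fun v => W v - W ζ * (ζ - conj ζ) * (v - conj ζ)⁻¹ with hH
  have hopen := isOpen_upperHalfPlane 0
  have hHd : DifferentiableOn ℂ H {v | 0 < v.im} :=
    hW.diff.sub ((differentiableOn_const _).mul
      (DifferentiableOn.inv (by fun_prop) fun v hv => hcne v (le_of_lt hv)))
  have hHζ : H ζ = 0 := by
    simp only [hH]
    rw [mul_assoc, mul_inv_cancel₀ (hcne ζ hζ.le), mul_one, sub_self]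
  -- Since `H ζ = 0`, the divided slope is the holomorphic form of `H/(v - ζ)`.
  set K : ℂ → ℂ := fun v => dslope H ζ v * (v - conj ζ) with hK
  have hKd : DifferentiableOn ℂ K {v | 0 < v.im} :=
    ((Complex.differentiableOn_dslope (hopen.mem_nhds hζ)).2 hHd).mul (by fun_prop)
  have hKne : ∀ v, v ≠ ζ → K v = H v * (v - conj ζ) * (v - ζ)⁻¹ := fun v hv => by
    simp only [hK]
    rw [dslope_of_ne _ hv, slope_def_field, hHζ, sub_zero]
    ring
  obtain ⟨r, hr, hball⟩ : ∃ r > 0, Metric.closedBall ζ r ⊆ {v : ℂ | 0 < v.im} :=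
    Metric.nhds_basis_closedBall.mem_iff.1 (hopen.mem_nhds hζ)
  obtain ⟨M, hM⟩ := (isCompact_closedBall ζ r).exists_bound_of_continuousOn
    (f := fun v => K v * (v - conj ζ)) ((hKd.continuousOn.mono hball).mul (by fun_prop))
  have hM0 : 0 ≤ M := (norm_nonneg _).trans (hM ζ (Metric.mem_closedBall_self hr.le))
  -- `A` bounds `‖v - conj ζ‖/‖v - ζ‖` outside the disc of radius `r` about `ζ`; inside it
  -- compactness supplies `M`.
  set A : ℝ := 1 + 2 * ζ.im / r
  have hA0 : 0 ≤ A := by positivity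
  set B : ℝ := A * ‖W ζ * (ζ - conj ζ)‖ + M
  have hKle : ∀ v : ℂ, 0 < v.im → ‖K v‖ ≤ A * ‖W v‖ + B * ‖(v - conj ζ)⁻¹‖ := by
    intro v hv
    by_cases hvr : ‖v - ζ‖ ≤ r
    · have h1 := hM v (by rwa [Metric.mem_closedBall, dist_eq_norm])
      rw [norm_mul] at h1
      have h2 : 0 < ‖v - conj ζ‖ := norm_pos_iff.2 (hcne v hv.le)
      have h3 : ‖K v‖ ≤ M * ‖(v - conj ζ)⁻¹‖ := by
        rw [norm_inv, ← div_eq_mul_inv, le_div_iff₀ h2]; exact h1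
      have h4 : M * ‖(v - conj ζ)⁻¹‖ ≤ B * ‖(v - conj ζ)⁻¹‖ := by
        gcongr; simp only [B]; linarith [mul_nonneg hA0 (norm_nonneg (W ζ * (ζ - conj ζ)))]
      linarith [mul_nonneg hA0 (norm_nonneg (W v))]
    · push Not at hvr
      have hv0 : 0 < ‖v - ζ‖ := hr.trans hvr
      have hvζ : v ≠ ζ := fun h => by simp [h] at hv0
      rw [hKne v hvζ]
      have h1 : ‖v - conj ζ‖ ≤ A * ‖v - ζ‖ := by
        have e : v - conj ζ = (v - ζ) + (ζ - conj ζ) := by ring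
        have e2 : ‖ζ - conj ζ‖ = 2 * ζ.im := by
          rw [Complex.sub_conj]; simp [abs_of_pos hζ]
        calc ‖v - conj ζ‖ ≤ ‖v - ζ‖ + 2 * ζ.im := by rw [e, ← e2]; exact norm_add_le _ _
          _ ≤ ‖v - ζ‖ + 2 * ζ.im / r * ‖v - ζ‖ := by
            have : 2 * ζ.im ≤ 2 * ζ.im / r * ‖v - ζ‖ := by
              rw [div_mul_eq_mul_div, le_div_iff₀ hr]
              exact mul_le_mul_of_nonneg_left hvr.le (by positivity)
            linarith
          _ = _ := by simp only [A]; ring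
      have h2 : ‖(v - conj ζ) * (v - ζ)⁻¹‖ ≤ A := by
        rw [norm_mul, norm_inv, ← div_eq_mul_inv, div_le_iff₀ hv0]; exact h1
      have h3 : ‖H v‖ ≤ ‖W v‖ + ‖W ζ * (ζ - conj ζ)‖ * ‖(v - conj ζ)⁻¹‖ := by
        rw [← norm_mul]; exact norm_sub_le _ _
      calc ‖H v * (v - conj ζ) * (v - ζ)⁻¹‖ = ‖H v‖ * ‖(v - conj ζ) * (v - ζ)⁻¹‖ := by
            rw [mul_assoc, norm_mul]
        _ ≤ (‖W v‖ + ‖W ζ * (ζ - conj ζ)‖ * ‖(v - conj ζ)⁻¹‖) * A := by gcongr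
        _ ≤ _ := by
          simp only [B]
          linarith [mul_nonneg hM0 (norm_nonneg (v - conj ζ)⁻¹)]
  have hcim : (conj ζ).im < 0 := by simpa using hζ
  obtain ⟨C, hC⟩ := hW.bound
  set Q : NNReal := (eLpNorm (fun x : ℝ => (x - conj ζ : ℂ)⁻¹) 2 volume).toNNReal
  have hQ : eLpNorm (fun x : ℝ => (x - conj ζ : ℂ)⁻¹) 2 volume = Q :=
    (ENNReal.coe_toNNReal (memLp_inv_sub hcim.ne).2.ne).symm
  refine ⟨K, ?_, hKd, ⟨A.toNNReal * C + B.toNNReal * Q, fun y hy => ?_⟩, ?_⟩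
  · have hcont : Continuous fun x : ℝ => ((x : ℂ) - conj ζ) * (x - ζ : ℂ)⁻¹ :=
      Continuous.mul (by fun_prop)
        (Continuous.inv₀ (by fun_prop) (sub_ne_zero_of_im_ne hζ.ne'))
    have h1 : MemLp (fun x : ℝ => w x - W ζ * (ζ - conj ζ) * (x - conj ζ : ℂ)⁻¹) 2 volume :=
      hW.memLp.sub ((memLp_inv_sub hcim.ne).const_mul _)
    refine h1.of_le ?_ (Eventually.of_forall fun x => ?_)
    · simp_rw [mul_assoc]
      simp_rw [mul_assoc] at h1
      exact h1.1.mul hcont.aestronglyMeasurable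
    · have e : ‖(x - conj ζ : ℂ)‖ = ‖(x - ζ : ℂ)‖ := by
        have : (x - conj ζ : ℂ) = conj (x - ζ : ℂ) := by simp
        rw [this, Complex.norm_conj]
      have h0 : 0 < ‖(x - ζ : ℂ)‖ := norm_pos_iff.2 (sub_ne_zero_of_im_ne hζ.ne' x)
      rw [norm_mul, norm_mul, norm_inv (x - ζ : ℂ), e, mul_assoc, mul_inv_cancel₀ h0.ne', mul_one]
  · have hcimy : ∀ x : ℝ, ((x : ℂ) + y * I - conj ζ)⁻¹ = (x - (conj ζ - y * I) : ℂ)⁻¹ := fun x => by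
      congr 1; ring
    have hqm : AEStronglyMeasurable (fun x : ℝ => ((x : ℂ) + y * I - conj ζ)⁻¹) volume := by
      simp_rw [hcimy]
      exact (memLp_inv_sub (by simp; linarith)).1
    have hq : eLpNorm (fun x : ℝ => ((x : ℂ) + y * I - conj ζ)⁻¹) 2 volume ≤ Q := by
      rw [← hQ]
      exact eLpNorm_mono fun x => enorm_le_iff_norm_le.1 (enorm_inv_add_sub_le hcim hy.le x)
    have h1 : eLpNorm (fun x : ℝ => K (x + y * I)) 2 volume ≤
        eLpNorm (fun x : ℝ => A * ‖W (x + y * I)‖ + B * ‖((x : ℂ) + y * I - conj ζ)⁻¹‖) 2 volume :=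
      eLpNorm_mono_real fun x => hKle _ (by simpa using hy)
    have hB0 : 0 ≤ B := by positivity
    refine h1.trans ((eLpNorm_add_le ((hW.continuous_line hy).norm.const_mul
      A).aestronglyMeasurable (hqm.norm.const_mul B) (by norm_num)).trans ?_)
    have e1 : eLpNorm (fun x : ℝ => A * ‖W (x + y * I)‖) 2 volume ≤ A.toNNReal * C := by
      refine (eLpNorm_const_smul_le (c := A) (f := fun x : ℝ => ‖W (x + y * I)‖)).trans ?_
      rw [eLpNorm_norm, Real.enorm_eq_ofReal hA0]
      exact mul_le_mul' le_rfl (hC y hy)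
    have e2 : eLpNorm (fun x : ℝ => B * ‖((x : ℂ) + y * I - conj ζ)⁻¹‖) 2 volume ≤
        B.toNNReal * Q := by
      refine (eLpNorm_const_smul_le (c := B)
        (f := fun x : ℝ => ‖((x : ℂ) + y * I - conj ζ)⁻¹‖)).trans ?_
      rw [eLpNorm_norm, Real.enorm_eq_ofReal hB0]
      exact mul_le_mul' le_rfl hq
    push_cast
    exact add_le_add e1 e2
  · have hne : ∀ᵐ x : ℝ, x ≠ ζ.re := by simp [ae_iff, measure_singleton]
    filter_upwards [hW.lim, hne] with x hx hxne
    have h0 : ((x : ℂ) + (0 : ℝ) * I - conj ζ) ≠ 0 := by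
      simpa using sub_ne_zero_of_im_ne hcim.ne x
    have h0' : ((x : ℂ) + (0 : ℝ) * I - ζ) ≠ 0 := by
      simpa using sub_ne_zero_of_im_ne hζ.ne' x
    have c1 : ContinuousAt (fun y : ℝ => ((x : ℂ) + y * I - conj ζ)⁻¹) 0 :=
      ContinuousAt.inv₀ (by fun_prop) h0
    have c2 : ContinuousAt (fun y : ℝ => ((x : ℂ) + y * I - ζ)⁻¹) 0 :=
      ContinuousAt.inv₀ (by fun_prop) h0'
    have c3 : ContinuousAt (fun y : ℝ => (x : ℂ) + y * I - conj ζ) 0 := by fun_prop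
    have t1 := c1.tendsto.mono_left (nhdsWithin_le_nhds (s := Ioi (0 : ℝ)))
    have t2 := c2.tendsto.mono_left (nhdsWithin_le_nhds (s := Ioi (0 : ℝ)))
    have t3 := c3.tendsto.mono_left (nhdsWithin_le_nhds (s := Ioi (0 : ℝ)))
    simp only [ofReal_zero, zero_mul, add_zero] at t1 t2 t3
    refine (((hx.sub (t1.const_mul (W ζ * (ζ - conj ζ)))).mul t3).mul t2).congr fun y => ?_
    rw [hKne]
    intro h
    apply hxne
    simpa using congrArg Complex.re h

/-- Cauchy's integral formula for the Hardy space of the upper half-plane. -/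
theorem IsHardyPair.integral_mul_inv {W : ℂ → ℂ} {w : ℝ → ℂ} (hW : IsHardyPair W w) {ζ : ℂ}
    (hζ : 0 < ζ.im) : ∫ x : ℝ, w x * (x - ζ : ℂ)⁻¹ = 2 * Real.pi * I * W ζ := by
  obtain ⟨K, hK⟩ := hW.blaschke hζ
  have hcim : (conj ζ).im < 0 := by simpa using hζ
  -- The kernel at `conj ζ` annihilates the quotient. Expanded, the integrand is `w/(x - ζ)` minus
  -- `W ζ (ζ - conj ζ)/|x - ζ|²`, and the last fraction has the explicit integral `π/Im ζ`.
  have h0 := hK.integral_mul_inv_eq_zero hcim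
  have hm1 := memLp_inv_sub hζ.ne'
  have hm2 := memLp_inv_sub hcim.ne
  have e : ∀ x : ℝ, (w x - W ζ * (ζ - conj ζ) * (x - conj ζ : ℂ)⁻¹) * (x - conj ζ) *
      (x - ζ : ℂ)⁻¹ * (x - conj ζ : ℂ)⁻¹ = w x * (x - ζ : ℂ)⁻¹ -
      W ζ * (ζ - conj ζ) * ((‖(x - ζ : ℂ)⁻¹‖ ^ 2 : ℝ) : ℂ) := fun x => by
    have h1 := sub_ne_zero_of_im_ne hcim.ne x
    have h2 := sub_ne_zero_of_im_ne hζ.ne' x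
    have h3 : ((‖(x - ζ : ℂ)⁻¹‖ ^ 2 : ℝ) : ℂ) = (x - ζ : ℂ)⁻¹ * (x - conj ζ : ℂ)⁻¹ := by
      rw [← normSq_eq_norm_sq, ← mul_conj]; simp
    rw [h3]
    field_simp
  simp_rw [e] at h0
  have hi : Integrable fun x : ℝ => w x * (x - ζ : ℂ)⁻¹ :=
    MemLp.integrable_mul (p := 2) (q := 2) hW.memLp hm1
  have hi2 : Integrable fun x : ℝ => ((‖(x - ζ : ℂ)⁻¹‖ ^ 2 : ℝ) : ℂ) :=
    ((memLp_two_iff_integrable_sq_norm hm1.1).1 hm1).ofReal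
  rw [integral_sub hi (hi2.const_mul _), integral_const_mul, integral_complex_ofReal, integral_norm_inv_sub_sq hζ.ne', sub_eq_zero] at h0
  rw [h0, Complex.sub_conj, abs_of_pos hζ]
  have : (ζ.im : ℂ) ≠ 0 := by exact_mod_cast hζ.ne'
  push_cast
  field_simp

theorem isHardyPair_inv_sub {ζ : ℂ} (hζ : ζ.im < 0) :
    IsHardyPair (fun v => (v - ζ)⁻¹) (fun x : ℝ => (x - ζ : ℂ)⁻¹) where
  memLp := memLp_inv_sub hζ.ne
  diff := DifferentiableOn.inv (by fun_prop) fun v (hv : 0 < v.im) h => by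
    have : v.im - ζ.im = 0 := by simpa using congrArg Complex.im h
    linarith
  bound := by
    refine ⟨(eLpNorm (fun x : ℝ => (x - ζ : ℂ)⁻¹) 2 volume).toNNReal, fun y hy => ?_⟩
    rw [ENNReal.coe_toNNReal (memLp_inv_sub hζ.ne).2.ne]
    exact eLpNorm_mono fun x => enorm_le_iff_norm_le.1 (enorm_inv_add_sub_le hζ hy.le x)
  lim := Eventually.of_forall fun x => by
    have h0 : ((x : ℂ) + (0 : ℝ) * I - ζ) ≠ 0 := by simpa using sub_ne_zero_of_im_ne hζ.ne x
    have c : ContinuousAt (fun y : ℝ => ((x : ℂ) + y * I - ζ)⁻¹) 0 :=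
      ContinuousAt.inv₀ (by fun_prop) h0
    simpa using c.tendsto.mono_left (nhdsWithin_le_nhds (s := Ioi (0 : ℝ)))

/-- Conjugation moves both poles to the lower half-plane, where the Cauchy integral of a Hardy
function vanishes. -/
theorem integral_inv_mul_inv_eq_zero {ζ ω : ℂ} (hζ : 0 < ζ.im) (hω : 0 < ω.im) :
    ∫ x : ℝ, (x - ζ : ℂ)⁻¹ * (x - ω : ℂ)⁻¹ = 0 := by
  have h := (isHardyPair_inv_sub (ζ := conj ζ) (by simpa using hζ)).integral_mul_inv_eq_zero
    (ζ := conj ω) (by simpa using hω)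
  have h2 := congrArg conj h
  rw [← integral_conj, map_zero] at h2
  simpa using h2

theorem IsHardyPair.integrable_mul_inv {W : ℂ → ℂ} {w : ℝ → ℂ} (hW : IsHardyPair W w) {ζ : ℂ}
    (hζ : ζ.im ≠ 0) : Integrable fun x : ℝ => w x * (x - ζ : ℂ)⁻¹ :=
  MemLp.integrable_mul (p := 2) (q := 2) hW.memLp (memLp_inv_sub hζ)

/-- A function that is analytic in the closed upper half-plane and `O(1/ζ)` is a Hardy function. -/
theorem isHardyPair_of_decay {F : ℂ → ℂ} (hF : AnalyticOnNhd ℂ F {x | 0 ≤ x.im}) {C : ℝ}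
    (hC : ∀ ζ : ℂ, 0 ≤ ζ.im → ‖F ζ‖ ≤ C * (1 + ‖ζ‖)⁻¹) :
    IsHardyPair F fun x : ℝ => F x := by
  have hC0 : 0 ≤ C := by
    have := (norm_nonneg _).trans (hC 0 (by simp))
    simpa using this
  have hcont : ∀ y : ℝ, 0 ≤ y → Continuous fun x : ℝ => F (x + y * I) := fun y hy =>
    hF.continuousOn.comp_continuous (by fun_prop) fun x => by simpa using hy
  have hle : ∀ y : ℝ, 0 ≤ y → ∀ x : ℝ, ‖F (x + y * I)‖ ≤ C * ‖(x - (-I) : ℂ)⁻¹‖ := fun y hy x => by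
    refine (hC _ (by simpa using hy)).trans ?_
    rw [norm_inv]
    have h0 : 0 < ‖(x - (-I) : ℂ)‖ := norm_pos_iff.2 (sub_ne_zero_of_im_ne (by simp) x)
    gcongr
    have h1 : |x| ≤ ‖(x + y * I : ℂ)‖ := by simpa using abs_re_le_norm (x + y * I : ℂ)
    calc ‖(x - (-I) : ℂ)‖ ≤ ‖(x : ℂ)‖ + ‖-I‖ := norm_sub_le _ _
      _ = 1 + |x| := by simp [add_comm]
      _ ≤ _ := by gcongr
  have hm := memLp_inv_sub (ζ := -I) (by simp)
  refine ⟨?_, fun ζ hζ => (hF ζ (le_of_lt (show 0 < ζ.im from hζ) : 0 ≤ ζ.im)).differentiableAt.differentiableWithinAt,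
    ⟨C.toNNReal * (eLpNorm (fun x : ℝ => (x - (-I) : ℂ)⁻¹) 2 volume).toNNReal, fun y hy => ?_⟩,
    Eventually.of_forall fun x => ?_⟩
  · have h0 := hcont 0 le_rfl
    simp only [ofReal_zero, zero_mul, add_zero] at h0
    refine MemLp.of_le_mul (c := C) hm h0.aestronglyMeasurable (Eventually.of_forall fun x => ?_)
    simpa using hle 0 le_rfl x
  · rw [ENNReal.coe_mul, ENNReal.coe_toNNReal hm.2.ne]
    exact eLpNorm_le_mul_eLpNorm_of_ae_le_mul (Eventually.of_forall (hle y hy.le)) 2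
  · have c : ContinuousAt (fun y : ℝ => F (x + y * I)) 0 := by
      refine ContinuousAt.comp (g := F) ?_ (by fun_prop)
      simpa using (hF x (by simp)).continuousAt
    simpa using c.tendsto.mono_left (nhdsWithin_le_nhds (s := Ioi (0 : ℝ)))

/-! ### The Cauchy projection of `u₀ w`. -/

namespace BenjaminOno

variable {P : ℕ} {c z : Fin P → ℂ}

/-- The rational function with simple poles at the `z_p` and residues `φ_p`. -/
noncomputable def rat (z φ : Fin P → ℂ) (ζ : ℂ) : ℂ := ∑ p, φ p / (ζ - z p)

theorem conj_u0 (c z : Fin P → ℂ) (x : ℝ) : conj (u0 c z x) = u0 c z x := by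
  simp only [u0, map_sum, map_add, map_div₀, map_sub, conj_ofReal, conj_conj]
  exact Finset.sum_congr rfl fun p _ => add_comm _ _

theorem u0_eq_sum_inv (c z : Fin P → ℂ) (x : ℂ) :
    u0 c z x = ∑ p, (c p * (x - z p)⁻¹ + conj (c p) * (x - conj (z p))⁻¹) := by
  simp only [u0, div_eq_mul_inv]

theorem norm_inv_sub_le {ζ : ℂ} (hζ : ζ.im ≠ 0) (x : ℝ) : ‖(x - ζ : ℂ)⁻¹‖ ≤ |ζ.im|⁻¹ := by
  rw [norm_inv]
  refine inv_anti₀ (abs_pos.2 hζ) ?_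
  simpa using abs_im_le_norm (x - ζ : ℂ)

theorem continuous_u0 (hz : ∀ p, 0 < (z p).im) : Continuous fun x : ℝ => u0 c z x := by
  simp_rw [u0_eq_sum_inv]
  refine continuous_finsetSum _ fun p _ => ((continuous_const.mul ?_).add (continuous_const.mul ?_))
  · exact Continuous.inv₀ (by fun_prop) (sub_ne_zero_of_im_ne (hz p).ne')
  · exact Continuous.inv₀ (by fun_prop) (sub_ne_zero_of_im_ne (by simpa using (hz p).ne'))

theorem exists_norm_u0_le (hz : ∀ p, 0 < (z p).im) : ∃ M, ∀ x : ℝ, ‖u0 c z x‖ ≤ M := by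
  refine ⟨∑ p, (‖c p‖ * |(z p).im|⁻¹ + ‖c p‖ * |(conj (z p)).im|⁻¹), fun x => ?_⟩
  rw [u0_eq_sum_inv]
  refine (norm_sum_le _ _).trans (Finset.sum_le_sum fun p _ => (norm_add_le _ _).trans ?_)
  rw [norm_mul, norm_mul, Complex.norm_conj]
  gcongr
  · exact norm_inv_sub_le (hz p).ne' x
  · exact norm_inv_sub_le (by simpa using (hz p).ne') x

theorem memLp_rat (hz : ∀ p, 0 < (z p).im) (φ : Fin P → ℂ) :
    MemLp (fun x : ℝ => rat z φ x) 2 volume := by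
  simp only [rat, div_eq_mul_inv]
  exact memLp_finsetSum _ fun p _ => (memLp_inv_sub (hz p).ne').const_mul _

theorem memLp_u0_mul (hz : ∀ p, 0 < (z p).im) {w : ℝ → ℂ} (hw : MemLp w 2 volume) :
    MemLp (fun x : ℝ => u0 c z x * w x) 2 volume := by
  obtain ⟨M, hM⟩ := exists_norm_u0_le (c := c) hz
  refine MemLp.of_le_mul (c := M) hw ((continuous_u0 hz).aestronglyMeasurable.mul hw.1)
    (Eventually.of_forall fun x => ?_)
  rw [norm_mul]
  exact mul_le_mul_of_nonneg_right (hM x) (norm_nonneg _)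

/-- The Cauchy integral of `u₀ w`. -/
theorem integral_u0_mul_inv (hz : ∀ p, 0 < (z p).im) {W : ℂ → ℂ} {w : ℝ → ℂ}
    (hW : IsHardyPair W w) {ζ : ℂ} (hζ : 0 < ζ.im) (hζz : ∀ p, ζ ≠ z p) :
    ∫ x : ℝ, u0 c z x * w x * (x - ζ : ℂ)⁻¹ =
      2 * Real.pi * I * (u0 c z ζ * W ζ - rat z (fun p => c p * W (z p)) ζ) := by
  have hcne : ∀ p, ζ - conj (z p) ≠ 0 := fun p h => by
    have : ζ.im + (z p).im = 0 := by simpa using congrArg Complex.im h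
    linarith [hz p]
  have hcim : ∀ p, (conj (z p)).im < 0 := fun p => by simpa using hz p
  -- Partial fractions turn each product of two simple poles into a difference of Cauchy kernels;
  -- those at `conj (z p)` integrate to zero against `w`.
  have e : ∀ x : ℝ, u0 c z x * w x * (x - ζ : ℂ)⁻¹ = ∑ p,
      (c p * (ζ - z p)⁻¹ * (w x * (x - ζ : ℂ)⁻¹ - w x * (x - z p : ℂ)⁻¹) +
      conj (c p) * (ζ - conj (z p))⁻¹ * (w x * (x - ζ : ℂ)⁻¹ - w x * (x - conj (z p) : ℂ)⁻¹)) := by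
    intro x
    rw [u0_eq_sum_inv, mul_assoc, Finset.sum_mul]
    refine Finset.sum_congr rfl fun p _ => ?_
    have h1 := sub_ne_zero_of_im_ne hζ.ne' x
    have h2 := sub_ne_zero_of_im_ne (hz p).ne' x
    have h3 := sub_ne_zero_of_im_ne (hcim p).ne x
    have h4 := sub_ne_zero.2 (hζz p)
    have h5 := hcne p
    rw [add_mul]
    congr 1
    · field_simp; ring
    · field_simp; ring
  have i1 := hW.integrable_mul_inv hζ.ne'
  have i2 : ∀ p, Integrable fun x : ℝ => c p * (ζ - z p)⁻¹ *
      (w x * (x - ζ : ℂ)⁻¹ - w x * (x - z p : ℂ)⁻¹) := fun p =>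
    (i1.sub (hW.integrable_mul_inv (hz p).ne')).const_mul _
  have i3 : ∀ p, Integrable fun x : ℝ => conj (c p) * (ζ - conj (z p))⁻¹ *
      (w x * (x - ζ : ℂ)⁻¹ - w x * (x - conj (z p) : ℂ)⁻¹) := fun p =>
    (i1.sub (hW.integrable_mul_inv (hcim p).ne)).const_mul _
  simp_rw [e]
  rw [integral_finsetSum]
  swap
  · exact fun p _ => (i2 p).add (i3 p)
  have e2 : ∀ p, ∫ x : ℝ, (c p * (ζ - z p)⁻¹ * (w x * (x - ζ : ℂ)⁻¹ - w x * (x - z p : ℂ)⁻¹) +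
      conj (c p) * (ζ - conj (z p))⁻¹ * (w x * (x - ζ : ℂ)⁻¹ - w x * (x - conj (z p) : ℂ)⁻¹)) =
      2 * Real.pi * I * ((c p / (ζ - z p) + conj (c p) / (ζ - conj (z p))) * W ζ -
        c p * W (z p) / (ζ - z p)) := fun p => by
    rw [integral_add (i2 p) (i3 p), integral_const_mul, integral_const_mul,
      integral_sub i1 (hW.integrable_mul_inv (hz p).ne'),
      integral_sub i1 (hW.integrable_mul_inv (hcim p).ne), hW.integral_mul_inv hζ,
      hW.integral_mul_inv (hz p), hW.integral_mul_inv_eq_zero (hcim p)]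
    ring
  simp_rw [e2]
  rw [← Finset.mul_sum, Finset.sum_sub_distrib, ← Finset.sum_mul]
  rfl

theorem cauchyPlus_eq (hz : ∀ p, 0 < (z p).im) {W : ℂ → ℂ} {w : ℝ → ℂ}
    (hW : IsHardyPair W w) (x : ℝ) {δ : ℝ} (hδ : 0 < δ) (hδz : ∀ p, δ ≠ (z p).im) :
    1 / (2 * Real.pi * I) * ∫ y : ℝ, u0 c z y * w y / (y - (x + δ * I)) =
      u0 c z (x + δ * I) * W (x + δ * I) - rat z (fun p => c p * W (z p)) (x + δ * I) := by
  have h := integral_u0_mul_inv (c := c) hz hW (ζ := x + δ * I) (by simpa using hδ)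
    fun p h => hδz p (by simpa using congrArg Complex.im h)
  simp only [div_eq_mul_inv (u0 c z _ * w _)]
  rw [h]
  have : (Real.pi : ℂ) ≠ 0 := by exact_mod_cast Real.pi_ne_zero
  field_simp

theorem rat_differentiableAt {φ : Fin P → ℂ} {ζ : ℂ} (hζ : ∀ p, ζ ≠ z p) :
    DifferentiableAt ℂ (rat z φ) ζ := by
  unfold rat
  refine DifferentiableAt.fun_sum fun p _ => ?_
  have := sub_ne_zero.2 (hζ p)
  fun_prop (disch := assumption)

theorem u0_differentiableAt {ζ : ℂ} (hζ : ∀ p, ζ ≠ z p) (hζ' : ∀ p, ζ ≠ conj (z p)) :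
    DifferentiableAt ℂ (u0 c z) ζ := by
  unfold u0
  refine DifferentiableAt.fun_sum fun p _ => ?_
  have := sub_ne_zero.2 (hζ p)
  have := sub_ne_zero.2 (hζ' p)
  fun_prop (disch := assumption)

theorem ofReal_ne (hz : ∀ p, 0 < (z p).im) (x : ℝ) (p : Fin P) : (x : ℂ) ≠ z p := fun h => by
  have := congrArg Complex.im h
  rw [ofReal_im] at this
  exact (hz p).ne this

theorem ofReal_ne_conj (hz : ∀ p, 0 < (z p).im) (x : ℝ) (p : Fin P) : (x : ℂ) ≠ conj (z p) :=
  fun h => by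
    have := congrArg Complex.im h
    rw [ofReal_im, conj_im] at this
    linarith [hz p]

/-- If the boundary values `w` are attained at `x`, then `𝒞⁺[u₀ w](x)` is given by `u₀ w` minus the
principal parts of `u₀ W` at the poles. -/
theorem isCauchyPlus_u0_mul (hz : ∀ p, 0 < (z p).im) {W : ℂ → ℂ} {w : ℝ → ℂ}
    (hW : IsHardyPair W w) {x : ℝ}
    (hx : Tendsto (fun y : ℝ => W (x + y * I)) (𝓝[>] 0) (𝓝 (w x))) :
    IsCauchyPlus (fun y => u0 c z y * w y) x
      (u0 c z x * w x - rat z (fun p => c p * W (z p)) x) := by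
  have c1 : ContinuousAt (fun y : ℝ => u0 c z (x + y * I)) 0 := by
    refine ContinuousAt.comp (g := u0 c z) ?_ (by fun_prop)
    simpa using (u0_differentiableAt (ofReal_ne hz x) (ofReal_ne_conj hz x)).continuousAt
  have c2 : ContinuousAt (fun y : ℝ => rat z (fun p => c p * W (z p)) (x + y * I)) 0 := by
    refine ContinuousAt.comp (g := rat z _) ?_ (by fun_prop)
    simpa using (rat_differentiableAt (ofReal_ne hz x)).continuousAt
  have t1 := c1.tendsto.mono_left (nhdsWithin_le_nhds (s := Ioi (0 : ℝ)))
  have t2 := c2.tendsto.mono_left (nhdsWithin_le_nhds (s := Ioi (0 : ℝ)))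
  simp only [ofReal_zero, zero_mul, add_zero] at t1 t2
  refine ((t1.mul hx).sub t2).congr' ?_
  have hev : ∀ᶠ δ : ℝ in 𝓝[>] 0, ∀ p, δ ≠ (z p).im := by
    refine nhdsWithin_le_nhds (eventually_all.2 fun p => ?_)
    exact (isOpen_ne.mem_nhds (hz p).ne : {δ : ℝ | δ ≠ (z p).im} ∈ 𝓝 0)
  filter_upwards [hev, self_mem_nhdsWithin] with δ h1 h2
  exact (cauchyPlus_eq hz hW x h2 h1).symm

end BenjaminOno

/-! ### From eigenfunctions to a differential equation; the norm identity. -/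

namespace BenjaminOno

variable {P : ℕ} {c z : Fin P → ℂ}

theorem conj_rat (φ : Fin P → ℂ) (x : ℝ) :
    conj (rat z φ x) = ∑ p, conj (φ p) * (x - conj (z p) : ℂ)⁻¹ := by
  simp [rat, div_eq_mul_inv]

theorem integrable_mul_conj_rat (hz : ∀ p, 0 < (z p).im) {W : ℂ → ℂ} {w : ℝ → ℂ}
    (hW : IsHardyPair W w) (φ : Fin P → ℂ) : Integrable fun x : ℝ => w x * conj (rat z φ x) := by
  simp_rw [conj_rat, Finset.mul_sum]
  refine integrable_finsetSum _ fun p _ => ?_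
  simp_rw [mul_left_comm (w _)]
  exact (hW.integrable_mul_inv (by simpa using (hz p).ne')).const_mul _

/-- Hardy functions are orthogonal to the rational functions with poles in the upper half-plane. -/
theorem integral_mul_conj_rat (hz : ∀ p, 0 < (z p).im) {W : ℂ → ℂ} {w : ℝ → ℂ}
    (hW : IsHardyPair W w) (φ : Fin P → ℂ) : ∫ x : ℝ, w x * conj (rat z φ x) = 0 := by
  simp_rw [conj_rat, Finset.mul_sum, mul_left_comm (w _)]
  rw [integral_finsetSum]
  · refine Finset.sum_eq_zero fun p _ => ?_
    rw [integral_const_mul, hW.integral_mul_inv_eq_zero (by simpa using hz p), mul_zero]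
  · exact fun p _ => (hW.integrable_mul_inv (by simpa using (hz p).ne')).const_mul _

theorem integral_rat_mul_inv (hz : ∀ p, 0 < (z p).im) (φ : Fin P → ℂ) {ζ : ℂ} (hζ : 0 < ζ.im) :
    ∫ x : ℝ, rat z φ x * (x - ζ : ℂ)⁻¹ = 0 := by
  simp only [rat, div_eq_mul_inv, Finset.sum_mul, mul_assoc]
  rw [integral_finsetSum]
  · refine Finset.sum_eq_zero fun p _ => ?_
    rw [integral_const_mul, integral_inv_mul_inv_eq_zero (hz p) hζ, mul_zero]
  · exact fun p _ => Integrable.const_mul (MemLp.integrable_mul (p := 2) (q := 2)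
      (memLp_inv_sub (hz p).ne') (memLp_inv_sub hζ.ne')) _

/-- The data extracted from an eigenfunction. -/
theorem eigen_ode_real {ε : ℝ} (hε : 0 < ε) (hz : ∀ p, 0 < (z p).im) {l : ℂ} {W : ℂ → ℂ}
    {w v : ℝ → ℂ} (hW : IsHardyPair W w)
    (hv : ∀ x, IsCauchyPlus (fun y => u0 c z y * w y) x (v x))
    (heq : ∀ x, I * ε * deriv w x + l * w x = -v x) :
    ∀ᵐ x : ℝ, deriv w x =
      (I * ε)⁻¹ * (rat z (fun p => c p * W (z p)) x - (l + u0 c z x) * w x) := by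
  filter_upwards [hW.lim] with x hx
  have h1 := tendsto_nhds_unique (hv x) (isCauchyPlus_u0_mul hz hW hx)
  have h2 := heq x
  have h3 : (I * ε : ℂ) ≠ 0 := mul_ne_zero I_ne_zero (by exact_mod_cast hε.ne')
  rw [h1] at h2
  rw [eq_inv_mul_iff_mul_eq₀ h3]
  linear_combination h2

/-- The equation expresses `w'` through square-integrable functions. This is what justifies
integrating by parts against the Cauchy kernel. -/
theorem eigen_deriv_memLp {ε : ℝ} (hz : ∀ p, 0 < (z p).im) {l : ℂ} {φ : Fin P → ℂ}
    {w : ℝ → ℂ} (hw : MemLp w 2 volume)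
    (hode : ∀ᵐ x : ℝ, deriv w x = (I * ε)⁻¹ * (rat z φ x - (l + u0 c z x) * w x)) :
    MemLp (deriv w) 2 volume := by
  have h : MemLp (fun x : ℝ => (I * ε : ℂ)⁻¹ * (rat z φ x - (l * w x + u0 c z x * w x))) 2 volume :=
    ((memLp_rat hz φ).sub ((hw.const_mul l).add (memLp_u0_mul hz hw))).const_mul _
  refine h.ae_eq ?_
  filter_upwards [hode] with x hx
  rw [hx]
  ring

/-- Cauchy's formula differentiated under the integral sign: within distance `v.im/2` of `v` the
kernel is at most twice its size at `v`. -/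
theorem IsHardyPair.hasDerivAt {W : ℂ → ℂ} {w : ℝ → ℂ} (hW : IsHardyPair W w) {ζ : ℂ}
    (hζ : 0 < ζ.im) : Integrable (fun x : ℝ => w x * ((x - ζ : ℂ)⁻¹) ^ 2) ∧
      2 * Real.pi * I * deriv W ζ = ∫ x : ℝ, w x * ((x - ζ : ℂ)⁻¹) ^ 2 := by
  have hopen := isOpen_upperHalfPlane 0
  have hder : ∀ (x : ℝ) (v : ℂ), 0 < v.im →
      HasDerivAt (fun v : ℂ => w x * (x - v)⁻¹) (w x * ((x - v : ℂ)⁻¹) ^ 2) v := fun x v hv => by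
    have h0 := sub_ne_zero_of_im_ne hv.ne' x
    convert! (((hasDerivAt_id v).const_sub (x : ℂ)).inv h0).const_mul (w x) using 1
    simp only [id]
    field_simp
  have key := hasDerivAt_integral_of_locally_dominated (m := volume) hopen
    (F := fun v (x : ℝ) => w x * (x - v)⁻¹)
    (Eventually.of_forall fun x v hv => (hder x v hv).differentiableAt.differentiableWithinAt)
    (fun v (hv : 0 < v.im) => (hW.integrable_mul_inv hv.ne').1)
    (fun v (hv : 0 < v.im) => ⟨v.im / 2, by positivity, fun x => 2 * ‖w x * (x - v : ℂ)⁻¹‖,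
      (hW.integrable_mul_inv hv.ne').norm.const_mul 2, Eventually.of_forall fun x u hu => by
        rw [Metric.mem_ball, dist_eq_norm] at hu
        have h0 : 0 < ‖(x - v : ℂ)‖ := norm_pos_iff.2 (sub_ne_zero_of_im_ne hv.ne' x)
        have h1 : v.im ≤ ‖(x - v : ℂ)‖ := by
          have := abs_im_le_norm (x - v : ℂ)
          simp only [sub_im, ofReal_im, zero_sub, abs_neg] at this
          rwa [abs_of_pos hv] at this
        have h2 : ‖(x - v : ℂ)‖ / 2 ≤ ‖(x - u : ℂ)‖ := by
          have e : (x - v : ℂ) = (x - u) + (u - v) := by ring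
          have := norm_add_le (x - u : ℂ) (u - v)
          rw [← e] at this
          linarith
        simp only [norm_mul, norm_inv]
        calc ‖w x‖ * ‖(x - u : ℂ)‖⁻¹ ≤ ‖w x‖ * (‖(x - v : ℂ)‖ / 2)⁻¹ := by gcongr
          _ = _ := by rw [inv_div]; ring⟩) (w := ζ) hζ
  have e : ∀ x : ℝ, deriv (fun v : ℂ => w x * (x - v)⁻¹) ζ = w x * ((x - ζ : ℂ)⁻¹) ^ 2 :=
    fun x => (hder x ζ hζ).deriv
  simp only [e] at key
  refine ⟨key.1, ?_⟩
  have h2 : HasDerivAt (fun v => 2 * Real.pi * I * W v) (2 * Real.pi * I * deriv W ζ) ζ :=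
    (hW.diff.differentiableAt (hopen.mem_nhds hζ)).hasDerivAt.const_mul _
  refine h2.unique (key.2.congr_of_eventuallyEq ?_)
  filter_upwards [hopen.mem_nhds hζ] with v hv using (hW.integral_mul_inv hv).symm

/-- The Hardy extension of an eigenfunction solves the differential equation in the upper
half-plane. -/
theorem eigen_ode_upper {ε : ℝ} (hε : 0 < ε) (hz : ∀ p, 0 < (z p).im) {l : ℂ} {W : ℂ → ℂ}
    {w : ℝ → ℂ} (hW : IsHardyPair W w) (hwd : Differentiable ℝ w)
    (hode : ∀ᵐ x : ℝ, deriv w x =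
      (I * ε)⁻¹ * (rat z (fun p => c p * W (z p)) x - (l + u0 c z x) * w x))
    {ζ : ℂ} (hζ : 0 < ζ.im) (hζz : ∀ p, ζ ≠ z p) :
    I * ε * deriv W ζ + (l + u0 c z ζ) * W ζ = rat z (fun p => c p * W (z p)) ζ := by
  set φ : Fin P → ℂ := fun p => c p * W (z p)
  have hεC : (I * ε : ℂ) ≠ 0 := mul_ne_zero I_ne_zero (by exact_mod_cast hε.ne')
  have hq := memLp_inv_sub hζ.ne'
  have hwi := hW.integrable_mul_inv hζ.ne'
  obtain ⟨hi2, hW'⟩ := IsHardyPair.hasDerivAt hW hζ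
  have hi1 : Integrable fun x : ℝ => deriv w x * (x - ζ : ℂ)⁻¹ :=
    MemLp.integrable_mul (p := 2) (q := 2) (eigen_deriv_memLp hz hW.memLp hode) hq
  -- Integration by parts shows that `2πi W' ζ` is the Cauchy integral of `w'`, into which the
  -- boundary equation can be inserted.
  have hparts : ∫ x : ℝ, (deriv w x * (x - ζ : ℂ)⁻¹ - w x * ((x - ζ : ℂ)⁻¹) ^ 2) = 0 := by
    refine integral_eq_zero_of_hasDerivAt_of_integrable (f := fun x : ℝ => w x * (x - ζ : ℂ)⁻¹)
      (fun x => ?_) (hi1.sub hi2) hwi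
    have h0 := sub_ne_zero_of_im_ne hζ.ne' x
    have h1 : HasDerivAt (fun x : ℝ => (x - ζ : ℂ)⁻¹) (-1 / (x - ζ : ℂ) ^ 2) x := by
      have := ((hasDerivAt_id x).ofReal_comp.sub_const ζ).inv h0
      exact this.congr_deriv (by simp)
    convert! (hwd x).hasDerivAt.mul h1 using 1
    field_simp
    ring
  rw [integral_sub hi1 hi2, ← hW', sub_eq_zero] at hparts
  have hu : Integrable fun x : ℝ => u0 c z x * w x * (x - ζ : ℂ)⁻¹ :=
    MemLp.integrable_mul (p := 2) (q := 2) (memLp_u0_mul hz hW.memLp) hq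
  have hr : Integrable fun x : ℝ => rat z φ x * (x - ζ : ℂ)⁻¹ :=
    MemLp.integrable_mul (p := 2) (q := 2) (memLp_rat hz φ) hq
  have e : ∫ x : ℝ, deriv w x * (x - ζ : ℂ)⁻¹ = ∫ x : ℝ, (I * ε)⁻¹ * (rat z φ x * (x - ζ : ℂ)⁻¹ -
      (l * (w x * (x - ζ : ℂ)⁻¹) + u0 c z x * w x * (x - ζ : ℂ)⁻¹)) := by
    refine integral_congr_ae ?_
    filter_upwards [hode] with x hx
    rw [hx]
    ring
  have hs : Integrable fun x : ℝ => l * (w x * (x - ζ : ℂ)⁻¹) + u0 c z x * w x * (x - ζ : ℂ)⁻¹ :=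
    (hwi.const_mul l).add hu
  rw [e, integral_const_mul, integral_sub hr hs,
    integral_add (hwi.const_mul l) hu, integral_const_mul, integral_rat_mul_inv hz φ hζ,
    hW.integral_mul_inv hζ, integral_u0_mul_inv hz hW hζ hζz] at hparts
  have hpi : (2 * Real.pi * I : ℂ) ≠ 0 := by simp [Real.pi_ne_zero]
  have h3 := congrArg (fun t => I * ε * t) hparts
  simp only [← mul_assoc, mul_inv_cancel₀ hεC] at h3
  refine mul_left_cancel₀ hpi ?_
  linear_combination -h3

theorem eq_zero_of_integral_sq {w : ℝ → ℂ} (hw : MemLp w 2 volume) (hc : Continuous w)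
    (h : ∫ x, w x * conj (w x) = 0) : w = 0 := by
  have e : ∀ x, w x * conj (w x) = ((‖w x‖ ^ 2 : ℝ) : ℂ) := fun x => by
    rw [mul_conj, normSq_eq_norm_sq]
  simp_rw [e] at h
  rw [integral_complex_ofReal, ofReal_eq_zero, integral_eq_zero_iff_of_nonneg
    (fun x => by positivity) ((memLp_two_iff_integrable_sq_norm hw.1).1 hw)] at h
  have h2 : w =ᵐ[volume] 0 := by
    filter_upwards [h] with x hx
    simpa using hx
  exact Continuous.ae_eq_iff_eq volume hc continuous_const |>.1 h2

theorem integrable_mul_conj {f g : ℝ → ℂ} (hf : MemLp f 2 volume) (hg : MemLp g 2 volume) :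
    Integrable fun x => f x * conj (g x) :=
  MemLp.integrable_mul (p := 2) (q := 2) hf hg.star

/-- Multiplication by `x` creates the constant `∑ φ p`, the only obstruction to remaining among the
rational functions orthogonal to the Hardy space. -/
theorem mul_rat (hz : ∀ p, 0 < (z p).im) {φ : Fin P → ℂ} (hφ : ∑ p, φ p = 0) (x : ℝ) :
    x * rat z φ x = rat z (fun p => φ p * z p) x := by
  have : x * rat z φ x - rat z (fun p => φ p * z p) x = ∑ p, φ p := by
    simp only [rat, Finset.mul_sum]
    rw [← Finset.sum_sub_distrib]
    refine Finset.sum_congr rfl fun p _ => ?_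
    have := sub_ne_zero_of_im_ne (hz p).ne' x
    field_simp
  rw [hφ] at this
  exact sub_eq_zero.1 this

/-- An eigenfunction for which the residues sum to zero vanishes. -/
theorem eigen_eq_zero_of_sum_eq_zero {ε : ℝ} (hε : 0 < ε) (hz : ∀ p, 0 < (z p).im) {l : ℝ}
    {φ : Fin P → ℂ} (hφ : ∑ p, φ p = 0) {W : ℂ → ℂ} {w : ℝ → ℂ} (hW : IsHardyPair W w)
    (hode : ∀ x : ℝ, HasDerivAt w ((I * ε)⁻¹ * (rat z φ x - (l + u0 c z x) * w x)) x)
    {C : ℝ} (hC : ∀ x : ℝ, ‖w x‖ ≤ C * (1 + |x|)⁻¹) : w = 0 := by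
  have hεC : (I * ε : ℂ) ≠ 0 := mul_ne_zero I_ne_zero (by exact_mod_cast hε.ne')
  have hwc : Continuous w := continuous_iff_continuousAt.2 fun x => (hode x).continuousAt
  set φ' : Fin P → ℂ := fun p => φ p * z p
  have hr := integrable_mul_conj_rat hz hW φ'
  have hr' : Integrable fun x : ℝ => conj (w x * conj (rat z φ' x)) := memLp_one_iff_integrable.1 (memLp_one_iff_integrable.2 hr).star
  have i3 := integrable_mul_conj hW.memLp hW.memLp
  -- Since `l` and `u₀` are real on the axis, they cancel in the derivative of `|w|²`. Beyond
  -- `|w|²`, only pairings of `w` with `x * rat` survive, and these integrate to zero.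
  have hd : ∀ x : ℝ, HasDerivAt (fun x : ℝ => x * (w x * conj (w x)))
      (w x * conj (w x) + (I * ε)⁻¹ *
        (conj (w x * conj (rat z φ' x)) - w x * conj (rat z φ' x))) x := by
    intro x
    have := (hasDerivAt_id x).ofReal_comp.mul ((hode x).mul (hode x).star)
    convert! this using 1
    simp only [id, φ', ← mul_rat hz hφ, map_mul, conj_conj, conj_ofReal, ofReal_one, Pi.mul_apply,
      RCLike.star_def, map_inv₀, map_sub, map_add, conj_u0, conj_I]
    field_simp
    ring
  have hlim : ∀ f : Filter ℝ, Tendsto (fun x : ℝ => |x|) f atTop →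
      Tendsto (fun x : ℝ => x * (w x * conj (w x))) f (𝓝 0) := by
    intro f hf
    have h1 : Tendsto (fun x : ℝ => C ^ 2 * (1 + |x|)⁻¹) f (𝓝 (C ^ 2 * 0)) :=
      (tendsto_inv_atTop_zero.comp (tendsto_const_nhds.add_atTop hf)).const_mul _
    rw [mul_zero] at h1
    refine squeeze_zero_norm (fun x => ?_) h1
    rw [norm_mul, norm_mul, norm_conj, norm_real, Real.norm_eq_abs]
    have h2 : 0 < 1 + |x| := by positivity
    calc |x| * (‖w x‖ * ‖w x‖) ≤ (1 + |x|) * ((C * (1 + |x|)⁻¹) * (C * (1 + |x|)⁻¹)) := by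
          have h3 := hC x
          have h4 := (norm_nonneg _).trans h3
          gcongr
          linarith
      _ = _ := by field_simp
  have h0 := integral_of_hasDerivAt_of_tendsto hd (i3.add ((hr'.sub hr).const_mul _))
    (hlim atBot tendsto_abs_atBot_atTop) (hlim atTop tendsto_abs_atTop_atTop)
  have hs : Integrable fun x : ℝ => conj (w x * conj (rat z φ' x)) - w x * conj (rat z φ' x) :=
    hr'.sub hr
  rw [integral_add i3 (hs.const_mul _), integral_const_mul, integral_sub hr' hr, integral_conj,
    integral_mul_conj_rat hz hW] at h0
  refine eq_zero_of_integral_sq hW.memLp hwc ?_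
  simpa using h0

end BenjaminOno

/-! ### The two branches of the exponential and their growth. -/

namespace BenjaminOno

variable {P : ℕ}

/-- `exp (-i h(ζ; l)/ε)` for complex `l`. -/
noncomputable def expG (ε : ℝ) (c z : Fin P → ℂ) (l ζ : ℂ) : ℂ :=
  Complex.exp (-I * (l * ζ + f c z ζ) / ε)

/-- An antiderivative of `u₀` whose cuts go down from the poles. -/
noncomputable def fHat (c z : Fin P → ℂ) (ζ : ℂ) : ℂ :=
  ∑ p, (c p * Complex.log (-I * (ζ - z p)) + conj (c p) * Complex.log (-I * (ζ - conj (z p))))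

/-- The analogue of `expG` for `fHat`. -/
noncomputable def expHat (ε : ℝ) (c z : Fin P → ℂ) (l ζ : ℂ) : ℂ :=
  Complex.exp (-I * (l * ζ + fHat c z ζ) / ε)

/-- The ratio of `expG` and `expHat` on the vertical line through `x`. -/
noncomputable def ratioG (ε : ℝ) (c z : Fin P → ℂ) (x : ℝ) : ℂ :=
  Complex.exp (-I * (∑ p, (c p * ((if (z p).re < x then Real.pi * I else -(Real.pi * I)) +
    Real.pi * I / 2) - conj (c p) * (Real.pi * I / 2))) / ε)

/-- A height above all poles. -/
noncomputable def top (z : Fin P → ℂ) : ℝ := 1 + ∑ p, (z p).im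

/-- The part of the upper half-plane where `fHat` is analytic. -/
def GHat (z : Fin P → ℂ) : Set ℂ :=
  {ζ | 0 < ζ.im ∧ ∀ p, ζ.re = (z p).re → (z p).im < ζ.im}

variable {ε : ℝ} {c z : Fin P → ℂ}

theorem expG_ne_zero (l ζ : ℂ) : expG ε c z l ζ ≠ 0 := Complex.exp_ne_zero _

theorem expHat_ne_zero (l ζ : ℂ) : expHat ε c z l ζ ≠ 0 := Complex.exp_ne_zero _

theorem ratioG_ne_zero (x : ℝ) : ratioG ε c z x ≠ 0 := Complex.exp_ne_zero _

theorem log_neg_eq {u : ℂ} (hu : u.im ≠ 0) :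
    Complex.log (-u) = Complex.log u + if u.im < 0 then Real.pi * I else -(Real.pi * I) := by
  rw [Complex.log, Complex.log, norm_neg]
  split_ifs with h
  · rw [arg_neg_eq_arg_add_pi_of_im_neg h]; push_cast; ring
  · rw [arg_neg_eq_arg_sub_pi_of_im_pos (lt_of_le_of_ne (not_lt.1 h) hu.symm)]; push_cast; ring

/-- The logarithms of `f` at the `z p` have cuts going up, those of `fHat` cuts going down; off the
vertical lines they differ by `±πi` according to the side, hence by a constant in each gap. -/
theorem expG_eq (l : ℂ) {ζ : ℂ} (hζ : ∀ p, ζ.re ≠ (z p).re) :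
    expG ε c z l ζ = ratioG ε c z ζ.re * expHat ε c z l ζ := by
  rw [expG, expHat, ratioG, ← Complex.exp_add]
  congr 1
  have : f c z ζ = fHat c z ζ + ∑ p, (c p * ((if (z p).re < ζ.re then Real.pi * I else
      -(Real.pi * I)) + Real.pi * I / 2) - conj (c p) * (Real.pi * I / 2)) := by
    rw [f, fHat, ← Finset.sum_add_distrib]
    refine Finset.sum_congr rfl fun p _ => ?_
    have h1 : I * (ζ - z p) = -(-I * (ζ - z p)) := by ring
    have him : (-I * (ζ - z p)).im = (z p).re - ζ.re := by simp
    rw [h1, log_neg_eq (by rw [him]; exact sub_ne_zero.2 (hζ p).symm), him]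
    simp only [sub_neg]
    ring
  rw [this]
  ring

theorem isOpen_G : IsOpen (G z) := by
  have : G z = ⋂ p, {x : ℂ | ¬ (x.re = (z p).re ∧ (z p).im ≤ |x.im|)} := by ext; simp [G]
  rw [this]
  refine isOpen_iInter_of_finite fun p => ?_
  rw [← isClosed_compl_iff]
  have : {x : ℂ | ¬ (x.re = (z p).re ∧ (z p).im ≤ |x.im|)}ᶜ =
      {x : ℂ | x.re = (z p).re} ∩ {x | (z p).im ≤ |x.im|} := by ext; simp
  rw [this]
  exact (isClosed_eq continuous_re continuous_const).inter
    (isClosed_le continuous_const (continuous_abs.comp continuous_im))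

theorem isOpen_GHat : IsOpen (GHat z) := by
  have : GHat z = {ζ : ℂ | 0 < ζ.im} ∩ ⋂ p, {x : ℂ | x.re = (z p).re → (z p).im < x.im} := by
    ext; simp [GHat]
  rw [this]
  refine (isOpen_upperHalfPlane 0).inter (isOpen_iInter_of_finite fun p => ?_)
  have : {x : ℂ | x.re = (z p).re → (z p).im < x.im} =
      {x : ℂ | x.re ≠ (z p).re} ∪ {x | (z p).im < x.im} := by
    ext x
    simp only [mem_ofPred_eq, mem_union, imp_iff_not_or, ne_eq]
  rw [this]
  exact (isOpen_ne_fun continuous_re continuous_const).union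
    (isOpen_lt continuous_const continuous_im)

theorem isComb_G (hz : ∀ p, 0 < (z p).im) : IsComb (G z) univ 0 where
  isOpen := isOpen_G
  ordConnected := ordConnected_univ
  base := fun t _ p h => by
    have := h.2
    simp at this
    linarith [hz p]
  re_mem := fun _ _ => mem_univ _
  vert := fun ζ hζ s hs p h => by
    simp only [add_re, ofReal_re, mul_re, I_re, mul_zero, ofReal_im, I_im, mul_one, sub_self,
      add_zero, add_im, mul_im, zero_add] at h
    refine hζ p ⟨h.1, h.2.trans ?_⟩
    have := abs_sub_left_of_mem_uIcc hs
    simpa using this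

theorem isComb_GHat {y₀ : ℝ} (h0 : 0 < y₀) (hy : ∀ p, (z p).im < y₀) :
    IsComb (GHat z) univ y₀ where
  isOpen := isOpen_GHat
  ordConnected := ordConnected_univ
  base := fun t _ => ⟨by simpa using h0, fun p _ => by simpa using hy p⟩
  re_mem := fun _ _ => mem_univ _
  vert := fun ζ hζ s hs => by
    have hs' : min y₀ ζ.im ≤ s := hs.1
    have : 0 < min y₀ ζ.im := lt_min h0 hζ.1
    refine ⟨by simp; linarith, fun p h => ?_⟩
    simp only [add_re, ofReal_re, mul_re, I_re, mul_zero, ofReal_im, I_im, mul_one, sub_self,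
      add_zero, add_im, mul_im, zero_add] at h ⊢
    exact (lt_min (hy p) (hζ.2 p h)).trans_le hs'

theorem ne_pole_of_mem_G {ζ : ℂ} (hζ : ζ ∈ G z) (p : Fin P) :
    ζ ≠ z p ∧ ζ ≠ conj (z p) := by
  constructor
  · rintro rfl
    exact hζ p ⟨rfl, le_abs_self _⟩
  · rintro rfl
    exact hζ p ⟨by simp, by simpa using le_abs_self _⟩

theorem ne_pole_of_mem_GHat (hz : ∀ p, 0 < (z p).im) {ζ : ℂ} (hζ : ζ ∈ GHat z) (p : Fin P) :
    ζ ≠ z p ∧ ζ ≠ conj (z p) := by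
  constructor
  · rintro rfl
    exact lt_irrefl _ (hζ.2 p rfl)
  · rintro rfl
    have := hζ.1
    simp at this
    linarith [hz p]

theorem mem_G_of_re_ne {ζ : ℂ} (hζ : ∀ p, ζ.re ≠ (z p).re) : ζ ∈ G z := fun p h => hζ p h.1

theorem hasDerivAt_f {ζ : ℂ} (hζ : ζ ∈ G z) :
    HasDerivAt (f c z) (u0 c z ζ) ζ := by
  unfold f u0
  refine HasDerivAt.fun_sum fun p _ => ?_
  obtain ⟨h1, h2⟩ := ne_pole_of_mem_G hζ p
  have hG := hζ p
  have s1 : I * (ζ - z p) ∈ slitPlane := by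
    rw [mem_slitPlane_iff]
    by_cases h : ζ.re = (z p).re
    · left
      have : ζ.im < (z p).im := (le_abs_self _).trans_lt (not_le.1 fun h' => hG ⟨h, h'⟩)
      simpa using this
    · right
      simpa [sub_eq_zero] using h
  have s2 : -I * (ζ - conj (z p)) ∈ slitPlane := by
    rw [mem_slitPlane_iff]
    by_cases h : ζ.re = (z p).re
    · left
      have : -ζ.im < (z p).im := (neg_le_abs _).trans_lt (not_le.1 fun h' => hG ⟨h, h'⟩)
      simp
      linarith
    · right
      simpa [sub_eq_zero, eq_comm] using h
  have d1 := ((((hasDerivAt_id ζ).sub_const (z p)).const_mul I).clog s1).add_const (Real.pi * I / 2)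
  have d2 := ((((hasDerivAt_id ζ).sub_const (conj (z p))).const_mul (-I)).clog s2).sub_const
    (Real.pi * I / 2)
  convert! (d1.const_mul (c p)).add (d2.const_mul (conj (c p))) using 1
  have := sub_ne_zero.2 h1
  have := sub_ne_zero.2 h2
  simp only [id]
  field_simp

theorem hasDerivAt_fHat (hz : ∀ p, 0 < (z p).im) {ζ : ℂ} (hζ : ζ ∈ GHat z) :
    HasDerivAt (fHat c z) (u0 c z ζ) ζ := by
  unfold fHat u0
  refine HasDerivAt.fun_sum fun p _ => ?_
  obtain ⟨h1, h2⟩ := ne_pole_of_mem_GHat hz hζ p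
  have s1 : -I * (ζ - z p) ∈ slitPlane := by
    rw [mem_slitPlane_iff]
    by_cases h : ζ.re = (z p).re
    · left
      simpa using hζ.2 p h
    · right
      simpa [sub_eq_zero, eq_comm] using h
  have s2 : -I * (ζ - conj (z p)) ∈ slitPlane := by
    rw [mem_slitPlane_iff]
    left
    simp
    linarith [hζ.1, hz p]
  have d1 := (((hasDerivAt_id ζ).sub_const (z p)).const_mul (-I)).clog s1
  have d2 := (((hasDerivAt_id ζ).sub_const (conj (z p))).const_mul (-I)).clog s2
  convert! (d1.const_mul (c p)).add (d2.const_mul (conj (c p))) using 1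
  have := sub_ne_zero.2 h1
  have := sub_ne_zero.2 h2
  simp only [id]
  field_simp

theorem hasDerivAt_expG (l : ℂ) {ζ : ℂ} (hζ : ζ ∈ G z) :
    HasDerivAt (expG ε c z l) (expG ε c z l ζ * (-I * (l + u0 c z ζ) / ε)) ζ := by
  have := (((((hasDerivAt_id ζ).const_mul l).add (hasDerivAt_f (c := c) hζ)).const_mul
    (-I)).div_const (ε : ℂ)).cexp
  convert! this using 1
  rw [mul_one]
  rfl

theorem hasDerivAt_expHat (hz : ∀ p, 0 < (z p).im) (l : ℂ) {ζ : ℂ} (hζ : ζ ∈ GHat z) :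
    HasDerivAt (expHat ε c z l) (expHat ε c z l ζ * (-I * (l + u0 c z ζ) / ε)) ζ := by
  have := (((((hasDerivAt_id ζ).const_mul l).add (hasDerivAt_fHat (c := c) hz hζ)).const_mul
    (-I)).div_const (ε : ℂ)).cexp
  convert! this using 1
  rw [mul_one]
  rfl

theorem differentiableOn_expG_mul_rat (l : ℂ) (φ : Fin P → ℂ) :
    DifferentiableOn ℂ (fun ζ => expG ε c z l ζ * rat z φ ζ) (G z) := fun _ hζ =>
  ((hasDerivAt_expG l hζ).differentiableAt.mul
    (rat_differentiableAt fun p => (ne_pole_of_mem_G hζ p).1)).differentiableWithinAt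

theorem differentiableOn_expHat_mul_rat (hz : ∀ p, 0 < (z p).im) (l : ℂ) (φ : Fin P → ℂ) :
    DifferentiableOn ℂ (fun ζ => expHat ε c z l ζ * rat z φ ζ) (GHat z) := fun _ hζ =>
  ((hasDerivAt_expHat hz l hζ).differentiableAt.mul
    (rat_differentiableAt fun p => (ne_pole_of_mem_GHat hz hζ p).1)).differentiableWithinAt

theorem im_add_one_le_top (hz : ∀ p, 0 < (z p).im) (p : Fin P) : (z p).im + 1 ≤ top z := by
  have := Finset.single_le_sum (f := fun p => (z p).im) (fun p _ => (hz p).le) (Finset.mem_univ p)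
  simp only [top]
  linarith

theorem one_le_top (hz : ∀ p, 0 < (z p).im) : 1 ≤ top z := by
  have := Finset.sum_nonneg (f := fun p => (z p).im) (s := Finset.univ) fun p _ => (hz p).le
  simp only [top]
  linarith

theorem mem_GHat_of_top_lt (hz : ∀ p, 0 < (z p).im) {ζ : ℂ} (hζ : top z < ζ.im) : ζ ∈ GHat z :=
  ⟨by linarith [one_le_top hz], fun p _ => by linarith [im_add_one_le_top hz p]⟩

theorem le_norm_sub_pole (hz : ∀ p, 0 < (z p).im) {ζ : ℂ} {T : ℝ}
    (hζ : top z + T < ζ.im) (p : Fin P) : T + 1 ≤ ‖ζ - z p‖ ∧ T + 1 ≤ ‖ζ - conj (z p)‖ := by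
  have h := im_add_one_le_top hz p
  have h1 := abs_im_le_norm (ζ - z p)
  have h2 := abs_im_le_norm (ζ - conj (z p))
  have h3 := le_abs_self (ζ - z p).im
  have h4 := le_abs_self (ζ - conj (z p)).im
  simp only [sub_im, conj_im, sub_neg_eq_add] at h1 h2 h3 h4
  have := hz p
  constructor <;> linarith

theorem norm_u0_le_of_far {ζ : ℂ} {T : ℝ} (hT : 0 < T)
    (h : ∀ p, T ≤ ‖ζ - z p‖ ∧ T ≤ ‖ζ - conj (z p)‖) :
    ‖u0 c z ζ‖ ≤ (2 * ∑ p, ‖c p‖) / T := by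
  rw [u0, Finset.mul_sum, Finset.sum_div]
  refine (norm_sum_le _ _).trans (Finset.sum_le_sum fun p _ => (norm_add_le _ _).trans ?_)
  rw [norm_div, norm_div, norm_conj]
  have h1 := h p
  calc ‖c p‖ / ‖ζ - z p‖ + ‖c p‖ / ‖ζ - conj (z p)‖ ≤ ‖c p‖ / T + ‖c p‖ / T := by
        gcongr
        · exact h1.1
        · exact h1.2
    _ = _ := by ring

theorem norm_rat_le_of_far {φ : Fin P → ℂ} {ζ : ℂ} (h : ∀ p, 1 ≤ ‖ζ - z p‖) :
    ‖rat z φ ζ‖ ≤ ∑ p, ‖φ p‖ := by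
  refine (norm_sum_le _ _).trans (Finset.sum_le_sum fun p _ => ?_)
  rw [norm_div]
  exact div_le_self (norm_nonneg _) (h p)

theorem convex_im_gt (y : ℝ) : Convex ℝ {ζ : ℂ | y < ζ.im} := by
  exact (convex_Ioi y).linear_preimage imLm

theorem norm_fHat_sub_le (hz : ∀ p, 0 < (z p).im) {T : ℝ} (hT : 0 ≤ T) {ζ ω : ℂ}
    (hζ : top z + T < ζ.im) (hω : top z + T < ω.im) :
    ‖fHat c z ζ - fHat c z ω‖ ≤ (2 * ∑ p, ‖c p‖) / (T + 1) * ‖ζ - ω‖ := by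
  refine Convex.norm_image_sub_le_of_norm_hasDerivWithin_le (s := {ζ : ℂ | top z + T < ζ.im})
    (f' := u0 c z) (fun v (hv : top z + T < v.im) => (hasDerivAt_fHat hz
      (mem_GHat_of_top_lt hz (by linarith))).hasDerivWithinAt)
    (fun v hv => norm_u0_le_of_far (by linarith) (le_norm_sub_pole hz hv))
    (convex_im_gt _) hω hζ

/-- `fHat` grows sublinearly in a half-plane above the poles. -/
theorem exists_norm_fHat_le (hz : ∀ p, 0 < (z p).im) {δ : ℝ} (hδ : 0 < δ) :
    ∃ C, 0 ≤ C ∧ ∀ ζ : ℂ, top z < ζ.im → ‖fHat c z ζ‖ ≤ δ * ‖ζ‖ + C := by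
  set M : ℝ := 2 * ∑ p, ‖c p‖
  have hM : 0 ≤ M := by positivity
  -- Above height `top z + T` the bound on `u₀` drops below `δ`, which gives slope `δ` there. Every
  -- point is first raised by `T`, at the bounded cost `M T`.
  set T : ℝ := M / δ
  have hT : 0 ≤ T := by positivity
  have hMT : M / (T + 1) ≤ δ := by
    rw [div_le_iff₀ (by positivity)]
    have : δ * T = M := by simp only [T]; field_simp
    nlinarith
  set ω : ℂ := ((top z + T + 1 : ℝ) : ℂ) * I
  have hω : top z + T < ω.im := by simp [ω]
  refine ⟨M * T + ‖fHat c z ω‖ + δ * (T + ‖ω‖), by positivity, fun ζ hζ => ?_⟩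
  have hζ1 : top z + T < (ζ + T * I).im := by simp; linarith
  have h1 := norm_fHat_sub_le (c := c) hz le_rfl (ζ := ζ) (ω := ζ + T * I) (by linarith)
    (by linarith)
  have h2 := norm_fHat_sub_le (c := c) hz hT hζ1 hω
  have e1 : ‖ζ - (ζ + T * I)‖ = T := by
    rw [sub_add_cancel_left, norm_neg, norm_mul, norm_real, norm_I, mul_one,
      Real.norm_of_nonneg hT]
  rw [e1, zero_add, div_one] at h1
  have e2 : ‖ζ + T * I - ω‖ ≤ ‖ζ‖ + T + ‖ω‖ := by
    refine (norm_sub_le _ _).trans (add_le_add ((norm_add_le _ _).trans ?_) le_rfl)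
    rw [norm_mul, norm_real, norm_I, mul_one, Real.norm_of_nonneg hT]
  have h2' : ‖fHat c z (ζ + T * I) - fHat c z ω‖ ≤ δ * (‖ζ‖ + T + ‖ω‖) :=
    h2.trans (mul_le_mul hMT e2 (norm_nonneg _) hδ.le)
  calc ‖fHat c z ζ‖ = ‖(fHat c z ζ - fHat c z (ζ + T * I)) + (fHat c z (ζ + T * I) - fHat c z ω) +
        fHat c z ω‖ := by ring_nf
    _ ≤ M * T + δ * (‖ζ‖ + T + ‖ω‖) + ‖fHat c z ω‖ := by
      refine (norm_add_le _ _).trans (add_le_add ((norm_add_le _ _).trans (add_le_add h1 h2')) le_rfl)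
    _ = _ := by ring

theorem im_I_div (μ : ℂ) : (I / μ).im = μ.re / normSq μ := by
  simp [div_im]

theorem top_lt_im_ray {ζ μ : ℂ} {y : ℝ} (hμ : 0 < μ.re) (hζ : y < ζ.im) {s : ℝ} (hs : 0 ≤ s) :
    y < (ζ + I / μ * s).im := by
  have : 0 ≤ μ.re / normSq μ * s := by
    have := normSq_nonneg μ
    positivity
  have e : (ζ + I / μ * s).im = ζ.im + μ.re / normSq μ * s := by
    rw [add_im, mul_im, ofReal_im, ofReal_re, im_I_div, mul_zero, zero_add]
  rw [e]
  linarith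

/-- The reason for the direction `i/μ`: the exponent is linear along the ray with slope `-μ`, so `Re
μ > 0` gives exponential decay once the sublinear `fHat` is absorbed. For real positive `μ` the ray
is vertical. -/
theorem ray_exponent {μ : ℂ} (hμ : μ ≠ 0) (ζ : ℂ) (s : ℝ) :
    -I * (-μ ^ 2 * (ζ + I / μ * s)) = I * μ ^ 2 * ζ - μ * s := by
  have h : μ ^ 2 * (I / μ) = μ * I := by field_simp
  linear_combination (I * s) * h + (μ * s) * I_sq

/-- Exponential decay of the integrand along the rays in the direction `i/μ`. -/
theorem exists_norm_expHat_ray_le (hε : 0 < ε) (hz : ∀ p, 0 < (z p).im) (φ : Fin P → ℂ) {m M Z : ℝ}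
    (hm : 0 < m) : ∃ C, ∀ ζ μ : ℂ, top z < ζ.im → ‖ζ‖ ≤ Z → m ≤ μ.re → ‖μ‖ ≤ M → ∀ s : ℝ, 0 ≤ s →
      ‖expHat ε c z (-μ ^ 2) (ζ + I / μ * s) * rat z φ (ζ + I / μ * s)‖ ≤
        C * Real.exp (-(m / (2 * ε)) * s) := by
  -- The ray is traversed at speed at most `1/m`, so growth `m²/2` of `fHat` costs `m/2`, half of
  -- the available decay rate.
  obtain ⟨C, hC0, hC⟩ := exists_norm_fHat_le (c := c) hz (δ := m ^ 2 / 2) (by positivity)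
  refine ⟨Real.exp ((M ^ 2 * Z + m ^ 2 / 2 * Z + C) / ε) * ∑ p, ‖φ p‖,
    fun ζ μ hζ hζZ hmμ hμM s hs => ?_⟩
  have hμ0 : 0 < μ.re := hm.trans_le hmμ
  have hμne : μ ≠ 0 := fun h => by simp [h] at hμ0
  have hmn : m ≤ ‖μ‖ := hmμ.trans ((le_abs_self _).trans (abs_re_le_norm μ))
  have him := top_lt_im_ray hμ0 hζ hs
  have hrat := norm_rat_le_of_far (φ := φ) fun p => by
    have := (le_norm_sub_pole hz (T := 0) (ζ := ζ + I / μ * s) (by rwa [add_zero]) p).1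
    simpa using this
  have hn : ‖ζ + I / μ * s‖ ≤ Z + s / m := by
    refine (norm_add_le _ _).trans (add_le_add hζZ ?_)
    rw [norm_mul, norm_div, norm_I, norm_real, Real.norm_of_nonneg hs, one_div_mul_eq_div]
    gcongr
  have hexp : ‖expHat ε c z (-μ ^ 2) (ζ + I / μ * s)‖ ≤
      Real.exp ((M ^ 2 * Z + m ^ 2 / 2 * Z + C) / ε) * Real.exp (-(m / (2 * ε)) * s) := by
    rw [expHat, norm_exp, ← Real.exp_add, Real.exp_le_exp, div_ofReal_re, mul_add,
      ray_exponent hμne]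
    have e : (M ^ 2 * Z + m ^ 2 / 2 * Z + C) / ε + -(m / (2 * ε)) * s =
        (M ^ 2 * Z + m ^ 2 / 2 * Z + C - m / 2 * s) / ε := by
      field_simp
      ring
    rw [e]
    gcongr
    have h1 : (I * μ ^ 2 * ζ).re ≤ M ^ 2 * Z := by
      refine (re_le_norm _).trans ?_
      rw [norm_mul, norm_mul, norm_I, one_mul, norm_pow]
      gcongr
    have h2 : (-I * fHat c z (ζ + I / μ * s)).re ≤ m ^ 2 / 2 * (Z + s / m) + C := by
      refine (re_le_norm _).trans ?_
      rw [norm_mul, norm_neg, norm_I, one_mul]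
      exact (hC _ him).trans (by gcongr)
    have h3 : m ^ 2 / 2 * (Z + s / m) = m ^ 2 / 2 * Z + m / 2 * s := by field_simp
    have h4 : (μ * s).re = μ.re * s := by simp
    have h5 : m * s ≤ μ.re * s := by gcongr
    rw [add_re, sub_re, h4]
    linarith
  rw [norm_mul]
  calc _ ≤ (Real.exp ((M ^ 2 * Z + m ^ 2 / 2 * Z + C) / ε) * Real.exp (-(m / (2 * ε)) * s)) *
        ∑ p, ‖φ p‖ := by gcongr
    _ = _ := by ring

end BenjaminOno

/-! ### The ray integral `V` and the primitive `Psi`. -/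

namespace BenjaminOno

variable {P : ℕ}

/-- The integral of `expHat * rat` over the ray from `ζ` to infinity in the direction `i/μ`, where
`l = -μ²`. -/
noncomputable def V (ε : ℝ) (c z φ : Fin P → ℂ) (μ ζ : ℂ) : ℂ :=
  ∫ s in Ioi (0 : ℝ), expHat ε c z (-μ ^ 2) (ζ + I / μ * s) * rat z φ (ζ + I / μ * s) * (I / μ)

variable {ε : ℝ} {c z : Fin P → ℂ}

theorem continuousOn_ray (hz : ∀ p, 0 < (z p).im) (φ : Fin P → ℂ) {μ ζ : ℂ} (hμ : 0 < μ.re)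
    (hζ : top z < ζ.im) : ContinuousOn (fun s : ℝ =>
      expHat ε c z (-μ ^ 2) (ζ + I / μ * s) * rat z φ (ζ + I / μ * s) * (I / μ)) (Ici 0) := by
  refine ContinuousOn.mul ?_ continuousOn_const
  exact (differentiableOn_expHat_mul_rat hz (-μ ^ 2) φ).continuousOn.comp
    (f := fun s : ℝ => ζ + I / μ * s) (by fun_prop)
    fun s hs => mem_GHat_of_top_lt hz (top_lt_im_ray hμ hζ hs)

theorem integrableOn_exp_decay {κ : ℝ} (hκ : 0 < κ) (C : ℝ) :
    Integrable (fun s : ℝ => C * Real.exp (-κ * s)) (volume.restrict (Ioi 0)) :=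
  (exp_neg_integrableOn_Ioi 0 hκ).const_mul C

theorem exists_ray_bound (hε : 0 < ε) (hz : ∀ p, 0 < (z p).im) (φ : Fin P → ℂ) {m M Z : ℝ}
    (hm : 0 < m) : ∃ bound : ℝ → ℝ, Integrable bound (volume.restrict (Ioi 0)) ∧
      (∀ s, bound s = bound 0 * Real.exp (-(m / (2 * ε)) * s)) ∧
      ∀ ζ μ : ℂ, top z < ζ.im → ‖ζ‖ ≤ Z → m ≤ μ.re → ‖μ‖ ≤ M → ∀ s : ℝ, 0 ≤ s →
      ‖expHat ε c z (-μ ^ 2) (ζ + I / μ * s) * rat z φ (ζ + I / μ * s) * (I / μ)‖ ≤ bound s := by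
  obtain ⟨C, hC⟩ := exists_norm_expHat_ray_le (c := c) hε hz φ (M := M) (Z := Z) hm
  refine ⟨fun s => C / m * Real.exp (-(m / (2 * ε)) * s), integrableOn_exp_decay (by positivity) _,
    fun s => by simp, fun ζ μ h1 h2 h3 h4 s hs => ?_⟩
  have h5 : m ≤ ‖μ‖ := h3.trans ((le_abs_self _).trans (abs_re_le_norm μ))
  have h6 := hC ζ μ h1 h2 h3 h4 s hs
  rw [norm_mul, norm_div, norm_I]
  calc _ ≤ C * Real.exp (-(m / (2 * ε)) * s) * (1 / m) := by
        gcongr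
        exact (norm_nonneg _).trans h6
    _ = _ := by ring

theorem integrableOn_ray (hε : 0 < ε) (hz : ∀ p, 0 < (z p).im) (φ : Fin P → ℂ) {μ ζ : ℂ}
    (hμ : 0 < μ.re) (hζ : top z < ζ.im) : IntegrableOn (fun s : ℝ =>
      expHat ε c z (-μ ^ 2) (ζ + I / μ * s) * rat z φ (ζ + I / μ * s) * (I / μ)) (Ioi 0) := by
  obtain ⟨b, hb, -, hle⟩ := exists_ray_bound (c := c) hε hz φ (M := ‖μ‖) (Z := ‖ζ‖) hμ
  refine hb.mono' (((continuousOn_ray hz φ hμ hζ).mono Ioi_subset_Ici_self).aestronglyMeasurable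
    measurableSet_Ioi) ?_
  filter_upwards [ae_restrict_mem measurableSet_Ioi] with s hs
  exact hle ζ μ hζ le_rfl le_rfl le_rfl s (le_of_lt hs)

/-- Under the integral the `ζ`-derivative, multiplied by `I / μ`, is the derivative along the ray,
so the integral telescopes to minus the value at the starting point. -/
theorem hasDerivAt_V (hε : 0 < ε) (hz : ∀ p, 0 < (z p).im) (φ : Fin P → ℂ) {μ ζ : ℂ}
    (hμ : 0 < μ.re) (hζ : top z < ζ.im) :
    HasDerivAt (V ε c z φ μ) (-(expHat ε c z (-μ ^ 2) ζ * rat z φ ζ)) ζ := by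
  have hopen := isOpen_upperHalfPlane (top z)
  set g : ℂ → ℂ := fun v => expHat ε c z (-μ ^ 2) v * rat z φ v with hg
  have hgd : DifferentiableOn ℂ g (GHat z) := differentiableOn_expHat_mul_rat hz (-μ ^ 2) φ
  have hgat : ∀ v : ℂ, top z < v.im → ∀ s : ℝ, 0 ≤ s → DifferentiableAt ℂ g (v + I / μ * s) :=
    fun v hv s hs => hgd.differentiableAt
      (isOpen_GHat.mem_nhds (mem_GHat_of_top_lt hz (top_lt_im_ray hμ hv hs)))
  have key := hasDerivAt_integral_of_locally_dominated (m := volume.restrict (Ioi (0 : ℝ))) hopen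
    (F := fun v (s : ℝ) => g (v + I / μ * s) * (I / μ))
    (by
      filter_upwards [ae_restrict_mem measurableSet_Ioi] with s hs v hv
      have := (hgat v hv s (le_of_lt hs)).comp v (f := fun v => v + I / μ * s) (by fun_prop)
      exact (this.mul_const _).differentiableWithinAt)
    (fun v hv => (integrableOn_ray hε hz φ hμ hv).1)
    (fun v hv => by
      obtain ⟨r, hr, hball⟩ := Metric.isOpen_iff.1 hopen v hv
      obtain ⟨b, hb, -, hle⟩ := exists_ray_bound (c := c) hε hz φ (M := ‖μ‖) (Z := ‖v‖ + r) hμ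
      refine ⟨r, hr, b, hb, ?_⟩
      filter_upwards [ae_restrict_mem measurableSet_Ioi] with s hs u hu
      refine hle u μ (hball hu) ?_ le_rfl le_rfl s (le_of_lt hs)
      rw [Metric.mem_ball, dist_eq_norm] at hu
      have := norm_add_le (u - v) v
      rw [sub_add_cancel] at this
      linarith) (w := ζ) hζ
  have hray : ∀ s : ℝ, 0 ≤ s → HasDerivAt (fun s : ℝ => g (ζ + I / μ * s))
      (deriv (fun v => g (v + I / μ * s) * (I / μ)) ζ) s := fun s hs => by
    have h0 := (hgat ζ hζ s hs).hasDerivAt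
    have h1 : HasDerivAt (fun v => g (v + I / μ * s) * (I / μ))
        (deriv g (ζ + I / μ * s) * 1 * (I / μ)) ζ :=
      (h0.comp ζ ((hasDerivAt_id ζ).add_const (I / μ * s))).mul_const _
    have h2 : HasDerivAt (fun s : ℝ => ζ + I / μ * s) (I / μ) s := by
      simpa using ((hasDerivAt_id s).ofReal_comp.const_mul (I / μ)).const_add ζ
    rw [h1.deriv]
    convert! h0.scomp s h2 using 1
    simp only [smul_eq_mul]
    ring
  obtain ⟨b, -, hb0, hle⟩ := exists_ray_bound (c := c) hε hz φ (M := ‖μ‖) (Z := ‖ζ‖) hμ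
  have hμ0 : I / μ ≠ 0 := div_ne_zero I_ne_zero fun h => by simp [h] at hμ
  have hlim : Tendsto (fun s : ℝ => g (ζ + I / μ * s)) atTop (𝓝 0) := by
    have h1 : Tendsto (fun s : ℝ => b 0 * Real.exp (-(μ.re / (2 * ε)) * s)) atTop (𝓝 (b 0 * 0)) := by
      refine (Real.tendsto_exp_atBot.comp ?_).const_mul _
      exact tendsto_id.const_mul_atTop_of_neg (neg_lt_zero.2 (by positivity))
    rw [mul_zero] at h1
    have h2 : Tendsto (fun s : ℝ => g (ζ + I / μ * s) * (I / μ)) atTop (𝓝 0) := by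
      refine squeeze_zero_norm' ?_ h1
      filter_upwards [eventually_ge_atTop 0] with s hs
      rw [← hb0]
      exact hle ζ μ hζ le_rfl le_rfl le_rfl s hs
    have h3 := h2.mul_const (I / μ)⁻¹
    rw [zero_mul] at h3
    exact h3.congr fun s => by rw [mul_assoc, mul_inv_cancel₀ hμ0, mul_one]
  have hint := integral_Ioi_of_hasDerivAt_of_tendsto' (fun s hs => hray s hs) key.1 hlim
  have h2 := key.2
  rw [hint] at h2
  simpa [hg] using! h2

/-- The integration domain stays fixed while the ray turns with `μ`; on the disc of radius `μ.re /
2` the real part stays above half its value, so one exponential bound serves there. -/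
theorem differentiableAt_V_param (hε : 0 < ε) (hz : ∀ p, 0 < (z p).im) (φ : Fin P → ℂ) {ζ μ : ℂ}
    (hμ : 0 < μ.re) (hζ : top z < ζ.im) : DifferentiableAt ℂ (fun μ => V ε c z φ μ ζ) μ := by
  have hopen : IsOpen {μ : ℂ | 0 < μ.re} := isOpen_lt continuous_const continuous_re
  refine (hasDerivAt_integral_of_locally_dominated (m := volume.restrict (Ioi (0 : ℝ))) hopen
    (F := fun μ (s : ℝ) =>
      expHat ε c z (-μ ^ 2) (ζ + I / μ * s) * rat z φ (ζ + I / μ * s) * (I / μ))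
    ?_ (fun v hv => (integrableOn_ray hε hz φ hv hζ).1) ?_ (w := μ) hμ).2.differentiableAt
  · filter_upwards [ae_restrict_mem measurableSet_Ioi] with s hs v hv
    have hv0 : v ≠ 0 := fun h => by
      have : 0 < v.re := hv
      simp [h] at this
    have hmem := mem_GHat_of_top_lt hz (top_lt_im_ray hv hζ (le_of_lt hs))
    have hr : DifferentiableAt ℂ (fun v => ζ + I / v * s) v := by fun_prop (disch := assumption)
    have h1 := DifferentiableAt.comp v (f := fun v => ζ + I / v * s)
      (hasDerivAt_fHat (c := c) hz hmem).differentiableAt hr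
    have h2 := DifferentiableAt.comp v (f := fun v => ζ + I / v * s)
      (rat_differentiableAt (φ := φ) fun p => (ne_pole_of_mem_GHat hz hmem p).1) hr
    simp only [Function.comp_def] at h1 h2
    refine DifferentiableAt.differentiableWithinAt ?_
    unfold expHat
    fun_prop (disch := assumption)
  · intro v hv
    have hv' : 0 < v.re := hv
    obtain ⟨b, hb, -, hle⟩ := exists_ray_bound (c := c) hε hz φ (M := ‖v‖ + v.re / 2) (Z := ‖ζ‖)
      (half_pos hv')
    refine ⟨v.re / 2, by positivity, b, hb, ?_⟩
    filter_upwards [ae_restrict_mem measurableSet_Ioi] with s hs u hu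
    rw [Metric.mem_ball, dist_eq_norm] at hu
    have h1 := norm_add_le (u - v) v
    have h2 := (abs_le.1 (abs_re_le_norm (u - v))).1
    rw [sub_add_cancel] at h1
    rw [sub_re] at h2
    exact hle ζ u hζ le_rfl (by linarith) (by linarith) s (le_of_lt hs)

/-- High up in the half-plane the integrand decays uniformly along the rays. -/
theorem exists_expHat_ray_le (hε : 0 < ε) (hz : ∀ p, 0 < (z p).im) {μ : ℂ} (hμ : 0 < μ.re) :
    ∃ T, 0 ≤ T ∧ ∀ ζ : ℂ, top z + T < ζ.im → ∀ s : ℝ, 0 ≤ s →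
      ‖expHat ε c z (-μ ^ 2) (ζ + I / μ * s)‖ ≤
        ‖expHat ε c z (-μ ^ 2) ζ‖ * Real.exp (-(μ.re / (2 * ε)) * s) := by
  have hμne : μ ≠ 0 := fun h => by simp [h] at hμ
  have hμn : 0 < ‖μ‖ := norm_pos_iff.2 hμne
  set M : ℝ := 2 * ∑ p, ‖c p‖
  have hM : 0 ≤ M := by positivity
  set T : ℝ := M / (μ.re * ‖μ‖ / 2) with hT
  have hT0 : 0 ≤ T := by positivity
  have hMT : M / (T + 1) ≤ μ.re * ‖μ‖ / 2 := by
    rw [div_le_iff₀ (by positivity)]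
    have : μ.re * ‖μ‖ / 2 * T = M := by rw [hT]; field_simp
    have : 0 < μ.re * ‖μ‖ / 2 := by positivity
    nlinarith
  refine ⟨T, hT0, fun ζ hζ s hs => ?_⟩
  have hf := norm_fHat_sub_le (c := c) hz hT0 (top_lt_im_ray hμ hζ hs) hζ
  have hf' : ‖fHat c z (ζ + I / μ * s) - fHat c z ζ‖ ≤ μ.re / 2 * s := by
    refine hf.trans ?_
    rw [add_sub_cancel_left, norm_mul, norm_div, norm_I, norm_real, Real.norm_of_nonneg hs]
    calc _ ≤ μ.re * ‖μ‖ / 2 * (1 / ‖μ‖ * s) := by gcongr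
      _ = _ := by field_simp
  rw [expHat, expHat, norm_exp, norm_exp, ← Real.exp_add, Real.exp_le_exp, div_ofReal_re,
    div_ofReal_re, mul_add, ray_exponent hμne]
  have e : ((-I * (-μ ^ 2 * ζ + fHat c z ζ)).re / ε + -(μ.re / (2 * ε)) * s) =
      ((-I * (-μ ^ 2 * ζ + fHat c z ζ)).re - μ.re / 2 * s) / ε := by
    field_simp
    ring
  rw [e]
  gcongr
  have h1 : I * μ ^ 2 * ζ - μ * s + -I * fHat c z (ζ + I / μ * s) =
      -I * (-μ ^ 2 * ζ + fHat c z ζ) - μ * s +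
        -I * (fHat c z (ζ + I / μ * s) - fHat c z ζ) := by ring
  have h2 : (-I * (fHat c z (ζ + I / μ * s) - fHat c z ζ)).re ≤ μ.re / 2 * s := by
    refine (re_le_norm _).trans ?_
    rwa [norm_mul, norm_neg, norm_I, one_mul]
  have h3 : (μ * s).re = μ.re * s := by simp
  rw [h1, add_re, sub_re, h3]
  linarith

/-- The factor `1/‖ζ‖` comes from `rat`: a pole is closer to the moving point than `‖ζ‖` by at most
a constant plus the travelled length `s/‖μ‖`, and this loss is paid from half of the exponential
decay. It is this factor that later puts the solutions in the Hardy space. -/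
theorem exists_norm_V_le (hε : 0 < ε) (hz : ∀ p, 0 < (z p).im) (φ : Fin P → ℂ) {μ : ℂ}
    (hμ : 0 < μ.re) : ∃ T C, 0 ≤ T ∧ 0 ≤ C ∧ ∀ ζ : ℂ, top z + T < ζ.im →
      ‖V ε c z φ μ ζ‖ ≤ C * (‖expHat ε c z (-μ ^ 2) ζ‖ / ‖ζ‖) := by
  obtain ⟨T, hT, hle⟩ := exists_expHat_ray_le (c := c) hε hz hμ
  have hμne : μ ≠ 0 := fun h => by simp [h] at hμ
  have hμn : 0 < ‖μ‖ := norm_pos_iff.2 hμne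
  set κ := μ.re / (2 * ε) with hκdef
  have hκ : 0 < κ := by positivity
  set B : ℝ := ∑ p, ‖φ p‖ * (1 + ‖z p‖ + 2 / (κ * ‖μ‖)) with hB
  have hB0 : 0 ≤ B := by positivity
  refine ⟨T, ∫ s in Ioi (0 : ℝ), B / ‖μ‖ * Real.exp (-(κ / 2) * s), hT, integral_nonneg fun s => by
    positivity, fun ζ hζ => ?_⟩
  have hζ0 : 0 < ‖ζ‖ := by
    have h1 := one_le_top hz
    have h2 := (le_abs_self _).trans (abs_im_le_norm ζ)
    linarith
  rw [V, ← integral_mul_const]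
  refine norm_integral_le_of_norm_le ((integrableOn_exp_decay (half_pos hκ) _).mul_const _) ?_
  filter_upwards [ae_restrict_mem measurableSet_Ioi] with s hs
  have hs0 : 0 ≤ s := le_of_lt hs
  have hrat : ‖rat z φ (ζ + I / μ * s)‖ ≤ B / ‖ζ‖ * Real.exp (κ / 2 * s) := by
    rw [hB, Finset.sum_div, Finset.sum_mul]
    refine (norm_sum_le _ _).trans (Finset.sum_le_sum fun p _ => ?_)
    have h1 : 1 ≤ ‖ζ + I / μ * s - z p‖ := by
      have := (le_norm_sub_pole hz (T := 0) (ζ := ζ + I / μ * s)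
        (by rw [add_zero]; exact top_lt_im_ray hμ (by linarith) hs0) p).1
      simpa using this
    have h2 : ‖ζ‖ ≤ ‖ζ + I / μ * s - z p‖ + ‖z p‖ + s / ‖μ‖ := by
      have e : ζ = (ζ + I / μ * s - z p) + z p - I / μ * s := by ring
      have e2 : ‖I / μ * s‖ = s / ‖μ‖ := by
        rw [norm_mul, norm_div, norm_I, norm_real, Real.norm_of_nonneg hs0]; ring
      calc ‖ζ‖ = ‖(ζ + I / μ * s - z p) + z p - I / μ * s‖ := by rw [← e]
        _ ≤ _ := by
          rw [← e2]
          exact (norm_sub_le _ _).trans (add_le_add (norm_add_le _ _) le_rfl)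
    have h3 : 1 ≤ Real.exp (κ / 2 * s) := Real.one_le_exp (by positivity)
    have h4 : κ / 2 * s ≤ Real.exp (κ / 2 * s) := by
      linarith [Real.add_one_le_exp (κ / 2 * s)]
    have h5 : s / ‖μ‖ ≤ 2 / (κ * ‖μ‖) * Real.exp (κ / 2 * s) := by
      calc s / ‖μ‖ = 2 / (κ * ‖μ‖) * (κ / 2 * s) := by field_simp
        _ ≤ _ := by gcongr
    have h6 : ‖ζ‖ ≤ ‖ζ + I / μ * s - z p‖ *
        ((1 + ‖z p‖ + 2 / (κ * ‖μ‖)) * Real.exp (κ / 2 * s)) := by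
      have h7 : ‖z p‖ ≤ ‖z p‖ * Real.exp (κ / 2 * s) := le_mul_of_one_le_right (norm_nonneg _) h3
      have h8 : 0 ≤ ‖z p‖ * Real.exp (κ / 2 * s) + 2 / (κ * ‖μ‖) * Real.exp (κ / 2 * s) := by
        positivity
      have h9 := mul_le_mul_of_nonneg_right h1 h8
      have h10 := mul_le_mul_of_nonneg_left h3 (norm_nonneg (ζ + I / μ * s - z p))
      nlinarith
    rw [norm_div, div_le_iff₀ (by linarith)]
    have h7 := mul_le_mul_of_nonneg_left h6 (div_nonneg (norm_nonneg (φ p)) hζ0.le)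
    rw [div_mul_cancel₀ _ hζ0.ne'] at h7
    refine h7.trans_eq ?_
    ring
  rw [norm_mul, norm_mul, norm_div, norm_I]
  have hexp : Real.exp (-(κ / 2) * s) = Real.exp (-κ * s) * Real.exp (κ / 2 * s) := by
    rw [← Real.exp_add]; ring_nf
  calc _ ≤ (‖expHat ε c z (-μ ^ 2) ζ‖ * Real.exp (-κ * s)) * (B / ‖ζ‖ * Real.exp (κ / 2 * s)) *
        (1 / ‖μ‖) := by
        gcongr
        exact hle ζ hζ s hs0
    _ = _ := by rw [hexp]; ring

/-- The abscissae `x` and `y` are not separated by any of the vertical lines through the poles. -/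
def SameGap (z : Fin P → ℂ) (x y : ℝ) : Prop :=
  ∀ p, (z p).re < x ∧ (z p).re < y ∨ x < (z p).re ∧ y < (z p).re

theorem SameGap.left_ne {x y : ℝ} (h : SameGap z x y) (p : Fin P) : x ≠ (z p).re := by
  rcases h p with h | h
  · exact h.1.ne'
  · exact h.1.ne

theorem SameGap.symm {x y : ℝ} (h : SameGap z x y) : SameGap z y x := fun p =>
  (h p).imp And.symm And.symm

theorem sameGap_refl {x : ℝ} (h : ∀ p, x ≠ (z p).re) : SameGap z x x := fun p => by
  rcases lt_or_gt_of_ne (h p) with h | h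
  · exact Or.inr ⟨h, h⟩
  · exact Or.inl ⟨h, h⟩

theorem SameGap.ratioG_eq {x y : ℝ} (h : SameGap z x y) : ratioG ε c z x = ratioG ε c z y := by
  have : ∀ p, ((z p).re < x ↔ (z p).re < y) := fun p => by
    rcases h p with h | h
    · simp [h.1, h.2]
    · simp [h.1.not_gt, h.2.not_gt]
  simp only [ratioG, this]

theorem isOpen_sameGap (z : Fin P → ℂ) (x : ℝ) : IsOpen {t : ℝ | SameGap z t x} := by
  have : {t : ℝ | SameGap z t x} = ⋂ p, {t : ℝ | (z p).re < t ∧ (z p).re < x ∨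
      t < (z p).re ∧ x < (z p).re} := by ext; simp [SameGap]
  rw [this]
  refine isOpen_iInter_of_finite fun p => ?_
  exact ((isOpen_lt continuous_const continuous_id).inter isOpen_const).union
    ((isOpen_lt continuous_id continuous_const).inter isOpen_const)

theorem ordConnected_sameGap (z : Fin P → ℂ) (x : ℝ) : OrdConnected {t : ℝ | SameGap z t x} := by
  refine ⟨fun s hs t ht u hu p => ?_⟩
  rcases hs p with h | h
  · exact Or.inl ⟨h.1.trans_le hu.1, h.2⟩
  · rcases ht p with h' | h'
    · exact absurd h'.2 h.2.not_gt
    · exact Or.inr ⟨hu.2.trans_lt h'.1, h.2⟩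

/-- A vertical strip between poles, above a given height, is a comb. -/
theorem isComb_gap (z : Fin P → ℂ) (x : ℝ) {y y₀ : ℝ} (hy : y < y₀) :
    IsComb {ζ : ℂ | y < ζ.im ∧ SameGap z ζ.re x} {t | SameGap z t x} y₀ where
  isOpen := (isOpen_upperHalfPlane y).inter ((isOpen_sameGap z x).preimage continuous_re)
  ordConnected := ordConnected_sameGap z x
  base := fun t (ht : SameGap z t x) => ⟨by simpa using hy, by simpa using ht⟩
  re_mem := fun ζ hζ => hζ.2
  vert := fun ζ hζ s hs => by
    have hs' : min y₀ ζ.im ≤ s := hs.1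
    have : y < min y₀ ζ.im := lt_min hy hζ.1
    exact ⟨by simp; linarith, by simpa using hζ.2⟩

/-- The antiderivative on `G` of the integrand which vanishes at infinity in the upper left part of
the plane. -/
noncomputable def Psi (ε : ℝ) (c z : Fin P → ℂ) (a : ℝ) (φ : Fin P → ℂ) (μ ζ : ℂ) : ℂ :=
  -(ratioG ε c z a * V ε c z φ μ (a + (top z + 1 : ℝ) * I)) -
    (∫ s in (0 : ℝ)..(top z + 1), expG ε c z (-μ ^ 2) (a + s * I) * rat z φ (a + s * I) * I) +
    ((∫ t in a..ζ.re, expG ε c z (-μ ^ 2) t * rat z φ t) +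
      ∫ s in (0 : ℝ)..ζ.im, expG ε c z (-μ ^ 2) (ζ.re + s * I) * rat z φ (ζ.re + s * I) * I)

theorem hasDerivAt_Psi (hz : ∀ p, 0 < (z p).im) (a : ℝ) (φ : Fin P → ℂ) (μ : ℂ) {ζ : ℂ}
    (hζ : ζ ∈ G z) :
    HasDerivAt (Psi ε c z a φ μ) (expG ε c z (-μ ^ 2) ζ * rat z φ ζ) ζ := by
  have h := ((isComb_G hz).hasDerivAt_combInt
    (differentiableOn_expG_mul_rat (ε := ε) (c := c) (-μ ^ 2) φ) (mem_univ a) hζ).const_add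
    (-(ratioG ε c z a * V ε c z φ μ (a + (top z + 1 : ℝ) * I)) -
    (∫ s in (0 : ℝ)..(top z + 1), expG ε c z (-μ ^ 2) (a + s * I) * rat z φ (a + s * I) * I))
  convert! h using 1
  ext v
  simp [Psi, combInt]

theorem Psi_base (a : ℝ) (φ : Fin P → ℂ) (μ : ℂ) :
    Psi ε c z a φ μ (a + (top z + 1 : ℝ) * I) =
      -(ratioG ε c z a * V ε c z φ μ (a + (top z + 1 : ℝ) * I)) := by
  simp only [Psi, add_re, ofReal_re, mul_re, I_re, mul_zero, ofReal_im, I_im, mul_one, sub_self,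
      add_zero, add_im, mul_im, zero_add, intervalIntegral.integral_same]
  ring

/-- The two derivatives cancel, so the sum is constant in each gap above the poles. The constant is
the integral over a contour from infinity on the left to infinity in that gap. -/
theorem Psi_add_V_eq (hε : 0 < ε) (hz : ∀ p, 0 < (z p).im) (a : ℝ) (φ : Fin P → ℂ) {μ : ℂ}
    (hμ : 0 < μ.re) {ζ ω : ℂ} (hζ : top z < ζ.im) (hω : top z < ω.im)
    (hg : SameGap z ζ.re ω.re) :
    Psi ε c z a φ μ ζ + ratioG ε c z ζ.re * V ε c z φ μ ζ =
      Psi ε c z a φ μ ω + ratioG ε c z ω.re * V ε c z φ μ ω := by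
  have hcomb := isComb_gap z ω.re (y := top z) (y₀ := top z + 1) (by linarith)
  have := hcomb.eq_of_hasDerivAt_zero
    (F := fun v => Psi ε c z a φ μ v + ratioG ε c z ω.re * V ε c z φ μ v) (fun v hv => ?_)
    (ζ := ζ) (ω := ω) ⟨hζ, hg⟩ ⟨hω, sameGap_refl hg.symm.left_ne⟩
  · rw [hg.ratioG_eq]
    exact this
  · have hne := hv.2.left_ne
    have h1 := hasDerivAt_Psi (ε := ε) (c := c) hz a φ μ (mem_G_of_re_ne hne)
    have h2 := (hasDerivAt_V (c := c) hε hz φ hμ hv.1).const_mul (ratioG ε c z ω.re)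
    convert! h1.add h2 using 1
    rw [expG_eq _ hne, hv.2.ratioG_eq]
    ring

/-- The normalization of `Psi` makes the constant zero in the leftmost gap. -/
theorem Psi_eq_left (hε : 0 < ε) (hz : ∀ p, 0 < (z p).im) {a : ℝ} (ha : ∀ p, a < (z p).re)
    (φ : Fin P → ℂ) {μ : ℂ} (hμ : 0 < μ.re) {ζ : ℂ} (hζ : top z < ζ.im)
    (hre : ∀ p, ζ.re < (z p).re) :
    Psi ε c z a φ μ ζ = -(ratioG ε c z ζ.re * V ε c z φ μ ζ) := by
  have h := Psi_add_V_eq (c := c) hε hz a φ hμ hζ (ω := a + (top z + 1 : ℝ) * I) (by simp)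
    fun p => Or.inr ⟨hre p, by simpa using ha p⟩
  rw [Psi_base] at h
  simp only [add_re, ofReal_re, mul_re, I_re, mul_zero, ofReal_im, I_im, mul_one, sub_self,
      add_zero, neg_add_cancel] at h
  exact eq_neg_of_add_eq_zero_left h

end BenjaminOno

/-! ### Exceptional poles. -/

namespace BenjaminOno

variable {P : ℕ}

/-- The factor of `expG` which is analytic at `z m`. -/
noncomputable def regG (ε : ℝ) (c z : Fin P → ℂ) (m : Fin P) (l ζ : ℂ) : ℂ :=
  Complex.exp (-I * (l * ζ + ∑ p, ((if p = m then 0 else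
    c p * (Complex.log (I * (ζ - z p)) + Real.pi * I / 2)) +
    conj (c p) * (Complex.log (-I * (ζ - conj (z p))) - Real.pi * I / 2))) / ε)

/-- The vertical strip in the upper half-plane around `z m` that contains no other pole. -/
def column (z : Fin P → ℂ) (m : Fin P) : Set ℂ :=
  {ζ | 0 < ζ.im ∧ ∀ p, p ≠ m →
    (z p).re < ζ.re ∧ (z p).re < (z m).re ∨ ζ.re < (z p).re ∧ (z m).re < (z p).re}

/-- The integrand `expG * rat`, continued across `z m` when `expG` has a zero of order `n` there. -/
noncomputable def regIntegrand (ε : ℝ) (c z : Fin P → ℂ) (m : Fin P) (n : ℕ) (l : ℂ)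
    (φ : Fin P → ℂ) (ζ : ℂ) : ℂ :=
  regG ε c z m l ζ * ((-(ζ - z m)) ^ n * (∑ p, if p = m then 0 else φ p / (ζ - z p)) -
    φ m * (-(ζ - z m)) ^ (n - 1))

variable {ε : ℝ} {c z : Fin P → ℂ}

theorem sum_eq_sum_ite_add (m : Fin P) (g : Fin P → ℂ) :
    ∑ p, g p = (∑ p, if p = m then 0 else g p) + g m := by
  have h : ∑ p, (if p = m then g p else 0) = g m := by simp
  rw [← h, ← Finset.sum_add_distrib]
  refine Finset.sum_congr rfl fun p _ => ?_
  split_ifs <;> ring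

theorem regG_ne_zero (m : Fin P) (l ζ : ℂ) : regG ε c z m l ζ ≠ 0 := Complex.exp_ne_zero _

/-- With `-i c_m/ε = n` the singular factor is `exp (n (log (i (ζ - z m)) + πi/2))`, and the inner
exponential equals `-(ζ - z m)`. -/
theorem expG_eq_regG_mul (hε : 0 < ε) {m : Fin P} {n : ℕ} (hn : I * c m / ε = -(n : ℂ)) (l : ℂ)
    {ζ : ℂ} (hζ : ζ ≠ z m) : expG ε c z l ζ = regG ε c z m l ζ * (-(ζ - z m)) ^ n := by
  have hε' : (ε : ℂ) ≠ 0 := ofReal_ne_zero.2 hε.ne'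
  have h0 : I * (ζ - z m) ≠ 0 := mul_ne_zero I_ne_zero (sub_ne_zero.2 hζ)
  have hu : (-(ζ - z m)) = Complex.exp (Complex.log (I * (ζ - z m)) + Real.pi * I / 2) := by
    rw [Complex.exp_add, Complex.exp_log h0, mul_div_right_comm, Complex.exp_pi_div_two_mul_I]
    linear_combination (-(ζ - z m)) * I_sq
  rw [hu, ← Complex.exp_nat_mul, expG, regG, ← Complex.exp_add]
  congr 1
  have : f c z ζ = (∑ p, ((if p = m then 0 else
    c p * (Complex.log (I * (ζ - z p)) + Real.pi * I / 2)) +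
    conj (c p) * (Complex.log (-I * (ζ - conj (z p))) - Real.pi * I / 2))) +
      c m * (Complex.log (I * (ζ - z m)) + Real.pi * I / 2) := by
    rw [f, Finset.sum_add_distrib, Finset.sum_add_distrib, sum_eq_sum_ite_add m fun p =>
      c p * (Complex.log (I * (ζ - z p)) + Real.pi * I / 2)]
    ring
  rw [this]
  linear_combination (-(Complex.log (I * (ζ - z m)) + Real.pi * I / 2)) * hn

/-- The zero of order `n ≥ 1` absorbs the simple pole of `rat`; cancelling one factor leaves the
exponent `n - 1`. -/
theorem expG_mul_rat_eq (hε : 0 < ε) {m : Fin P} {n : ℕ} (hn0 : 0 < n)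
    (hn : I * c m / ε = -(n : ℂ)) (l : ℂ) (φ : Fin P → ℂ) {ζ : ℂ} (hζ : ζ ≠ z m) :
    expG ε c z l ζ * rat z φ ζ = regIntegrand ε c z m n l φ ζ := by
  obtain ⟨k, rfl⟩ : ∃ k, n = k + 1 := ⟨n - 1, by omega⟩
  have h0 : ζ - z m ≠ 0 := sub_ne_zero.2 hζ
  have : rat z φ ζ = (∑ p, if p = m then 0 else φ p / (ζ - z p)) + φ m / (ζ - z m) :=
    sum_eq_sum_ite_add m _
  rw [expG_eq_regG_mul hε hn l hζ, this, regIntegrand, Nat.add_sub_cancel, pow_succ]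
  field_simp
  ring

theorem isOpen_column (m : Fin P) : IsOpen (column z m) := by
  have : column z m = {ζ : ℂ | 0 < ζ.im} ∩ ⋂ p : Fin P, {ζ : ℂ | p ≠ m →
    (z p).re < ζ.re ∧ (z p).re < (z m).re ∨ ζ.re < (z p).re ∧ (z m).re < (z p).re} := by
    ext; simp [column]
  rw [this]
  refine (isOpen_upperHalfPlane 0).inter (isOpen_iInter_of_finite fun p => ?_)
  by_cases hp : p = m
  · simp [hp]
  · simp only [ne_eq, hp, not_false_eq_true, forall_const]
    exact (((isOpen_lt continuous_const continuous_re).inter isOpen_const).union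
      ((isOpen_lt continuous_re continuous_const).inter isOpen_const))

theorem mem_column_of_re {m : Fin P} {ζ ω : ℂ} (hζ : ζ ∈ column z m) (hω : 0 < ω.im)
    (h : ω.re = ζ.re) : ω ∈ column z m := ⟨hω, by rw [h]; exact hζ.2⟩

theorem column_segment {m : Fin P} {s t u : ℝ} (hs : ∀ p, p ≠ m →
    (z p).re < s ∧ (z p).re < (z m).re ∨ s < (z p).re ∧ (z m).re < (z p).re)
    (ht : ∀ p, p ≠ m →
    (z p).re < t ∧ (z p).re < (z m).re ∨ t < (z p).re ∧ (z m).re < (z p).re) (hu : u ∈ Icc s t) :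
    ∀ p, p ≠ m → (z p).re < u ∧ (z p).re < (z m).re ∨ u < (z p).re ∧ (z m).re < (z p).re := by
  intro p hp
  rcases hs p hp with h | h
  · exact Or.inl ⟨h.1.trans_le hu.1, h.2⟩
  · rcases ht p hp with h' | h'
    · exact absurd h'.2 h.2.not_gt
    · exact Or.inr ⟨hu.2.trans_lt h'.1, h.2⟩

/-- The abscissae of the column around `z m`. -/
def columnRe (z : Fin P → ℂ) (m : Fin P) : Set ℝ := {t | ∀ p, p ≠ m →
    (z p).re < t ∧ (z p).re < (z m).re ∨ t < (z p).re ∧ (z m).re < (z p).re}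

theorem pole_mem_column (hz : ∀ p, 0 < (z p).im) (hmono : StrictMono fun p => (z p).re)
    (m : Fin P) : z m ∈ column z m := by
  refine ⟨hz m, fun p hp => ?_⟩
  rcases lt_or_gt_of_ne hp with h | h
  · exact Or.inl ⟨hmono h, hmono h⟩
  · exact Or.inr ⟨hmono h, hmono h⟩

theorem ordConnected_columnRe (m : Fin P) : OrdConnected (columnRe z m) :=
  ⟨fun _ hs _ ht _ hu => column_segment hs ht hu⟩

theorem isComb_column (m : Fin P) {y₀ : ℝ} (hy : 0 < y₀) :
    IsComb (column z m) (columnRe z m) y₀ where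
  isOpen := isOpen_column m
  ordConnected := ordConnected_columnRe m
  base := fun t (ht : ∀ p, p ≠ m → _) => ⟨by simpa using hy, by simpa using ht⟩
  re_mem := fun ζ hζ => hζ.2
  vert := fun ζ hζ s hs => by
    have hs' : min y₀ ζ.im ≤ s := hs.1
    have : 0 < min y₀ ζ.im := lt_min hy hζ.1
    exact mem_column_of_re hζ (by simp; linarith) (by simp)

theorem isComb_column_above (m : Fin P) {y y₀ : ℝ} (h0 : 0 ≤ y) (hy : y < y₀) :
    IsComb (column z m ∩ {ζ | y < ζ.im}) (columnRe z m) y₀ where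
  isOpen := (isOpen_column m).inter (isOpen_upperHalfPlane y)
  ordConnected := ordConnected_columnRe m
  base := fun t ht => ⟨(isComb_column m (h0.trans_lt hy)).base t ht, by simpa using hy⟩
  re_mem := fun ζ hζ => hζ.1.2
  vert := fun ζ hζ s hs => by
    have hs' : min y₀ ζ.im ≤ s := hs.1
    have : y < min y₀ ζ.im := lt_min hy hζ.2
    exact ⟨mem_column_of_re hζ.1 (by simp; linarith) (by simp), by simp; linarith⟩

theorem column_re_ne {m : Fin P} {ζ : ℂ} (hζ : ζ ∈ column z m) {p : Fin P} (hp : p ≠ m) :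
    ζ.re ≠ (z p).re := by
  rcases hζ.2 p hp with h | h
  · exact h.1.ne'
  · exact h.1.ne

theorem isComb_G_column (m : Fin P) {y₀ : ℝ} (h0 : 0 < y₀) (hy : y₀ < (z m).im) :
    IsComb (G z ∩ column z m) (columnRe z m) y₀ where
  isOpen := isOpen_G.inter (isOpen_column m)
  ordConnected := ordConnected_columnRe m
  base := fun t ht => by
    have h1 := (isComb_column m h0).base t ht
    refine ⟨fun p hp => ?_, h1⟩
    by_cases hpm : p = m
    · subst hpm
      have := hp.2
      simp [abs_of_pos h0] at this
      linarith
    · exact column_re_ne h1 hpm hp.1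
  re_mem := fun ζ hζ => hζ.2.2
  vert := fun ζ hζ s hs => by
    have h1 := (isComb_column m h0).vert ζ hζ.2 s hs
    refine ⟨fun p hp => ?_, h1⟩
    have h2 : ζ.re = (z p).re := by simpa using hp.1
    by_cases hpm : p = m
    · subst hpm
      have h3 : 0 < s := by simpa using h1.1
      have h4 : (z p).im ≤ s := by simpa [abs_of_pos h3] using hp.2
      have h5 : ζ.im < (z p).im := (le_abs_self _).trans_lt (not_le.1 fun h' => hζ.1 p ⟨h2, h'⟩)
      have h6 : s ≤ max y₀ ζ.im := hs.2
      have h7 : max y₀ ζ.im < (z p).im := max_lt hy h5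
      linarith
    · exact column_re_ne hζ.2 hpm h2

theorem differentiableAt_regG (hz : ∀ p, 0 < (z p).im) {m : Fin P} (l : ℂ) {ζ : ℂ}
    (hζ : ζ ∈ column z m) : DifferentiableAt ℂ (regG ε c z m l) ζ := by
  have h1 : ∀ p, DifferentiableAt ℂ (fun ζ => (if p = m then 0 else
    c p * (Complex.log (I * (ζ - z p)) + Real.pi * I / 2)) +
    conj (c p) * (Complex.log (-I * (ζ - conj (z p))) - Real.pi * I / 2)) ζ := fun p => by
    have s2 : -I * (ζ - conj (z p)) ∈ slitPlane := by
      rw [mem_slitPlane_iff]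
      left
      simp
      linarith [hζ.1, hz p]
    have d2 : DifferentiableAt ℂ (fun ζ => Complex.log (-I * (ζ - conj (z p)))) ζ :=
      DifferentiableAt.clog (by fun_prop) s2
    by_cases hp : p = m
    · simp only [hp, if_true] at d2 ⊢
      fun_prop
    · have s1 : I * (ζ - z p) ∈ slitPlane := by
        rw [mem_slitPlane_iff]
        right
        simpa [sub_eq_zero] using column_re_ne hζ hp
      have d1 : DifferentiableAt ℂ (fun ζ => Complex.log (I * (ζ - z p))) ζ :=
        DifferentiableAt.clog (by fun_prop) s1
      simp only [hp, if_false]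
      fun_prop
  unfold regG
  have h2 := DifferentiableAt.fun_sum (u := Finset.univ) fun p _ => h1 p
  fun_prop

theorem differentiableOn_regIntegrand (hz : ∀ p, 0 < (z p).im) (m : Fin P) (n : ℕ) (l : ℂ)
    (φ : Fin P → ℂ) : DifferentiableOn ℂ (regIntegrand ε c z m n l φ) (column z m) := by
  intro ζ hζ
  have h1 := differentiableAt_regG (ε := ε) (c := c) hz l hζ
  have h2 : ∀ p, DifferentiableAt ℂ (fun ζ => if p = m then 0 else φ p / (ζ - z p)) ζ :=
    fun p => by
    by_cases hp : p = m
    · simp [hp]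
    · simp only [hp, if_false]
      have : ζ - z p ≠ 0 := sub_ne_zero.2 fun h => column_re_ne hζ hp (by rw [h])
      fun_prop (disch := assumption)
  have h3 := DifferentiableAt.fun_sum (u := Finset.univ) fun p _ => h2 p
  unfold regIntegrand
  refine DifferentiableAt.differentiableWithinAt ?_
  fun_prop

/-- The antiderivative of `regIntegrand` that vanishes at `z m`. -/
noncomputable def regPrim (ε : ℝ) (c z : Fin P → ℂ) (m : Fin P) (n : ℕ) (l : ℂ)
    (φ : Fin P → ℂ) (ζ : ℂ) : ℂ :=
  combInt (regIntegrand ε c z m n l φ) (z m).re (z m).im ζ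

theorem regPrim_pole (m : Fin P) (n : ℕ) (l : ℂ) (φ : Fin P → ℂ) :
    regPrim ε c z m n l φ (z m) = 0 := by simp [regPrim, combInt]

theorem hasDerivAt_regPrim (hz : ∀ p, 0 < (z p).im) (hmono : StrictMono fun p => (z p).re)
    (m : Fin P) (n : ℕ) (l : ℂ) (φ : Fin P → ℂ) {ζ : ℂ} (hζ : ζ ∈ column z m) :
    HasDerivAt (regPrim ε c z m n l φ) (regIntegrand ε c z m n l φ ζ) ζ :=
  (isComb_column m (hz m)).hasDerivAt_combInt (differentiableOn_regIntegrand hz m n l φ)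
    (pole_mem_column hz hmono m).2 hζ

/-- Up to an exceptional pole the vertical integral from the real axis converges. -/
theorem vertical_integrable_pole (hε : 0 < ε) (hz : ∀ p, 0 < (z p).im)
    (hmono : StrictMono fun p => (z p).re) {m : Fin P} {n : ℕ} (hn0 : 0 < n)
    (hn : I * c m / ε = -(n : ℂ)) (l : ℂ) (φ : Fin P → ℂ) {y : ℝ} (hy0 : 0 < y)
    (hy : y < (z m).im) :
    IntervalIntegrable (fun s : ℝ => expG ε c z l ((z m).re + s * I) *
      rat z φ ((z m).re + s * I)) volume 0 y ∧
    IntervalIntegrable (fun s : ℝ => expG ε c z l ((z m).re + s * I) *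
      rat z φ ((z m).re + s * I)) volume y (z m).im ∧
    ∫ s in y..(z m).im, expG ε c z l ((z m).re + s * I) * rat z φ ((z m).re + s * I) * I =
      -regPrim ε c z m n l φ ((z m).re + y * I) := by
  have hzm := pole_mem_column hz hmono m
  have hωG : ((z m).re + y * I : ℂ) ∈ G z ∩ column z m :=
    (isComb_G_column m hy0 hy).base _ hzm.2
  have h1 := (isComb_G hz).vertical_intervalIntegrable
    (differentiableOn_expG_mul_rat (ε := ε) (c := c) l φ).continuousOn hωG.1
  have h2 := (isComb_column m (hz m)).vertical_intervalIntegrable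
    (differentiableOn_regIntegrand (ε := ε) (c := c) hz m n l φ).continuousOn hωG.2
  simp only [add_re, ofReal_re, mul_re, I_re, mul_zero, ofReal_im, I_im, mul_one, sub_self,
    add_zero, add_im, mul_im, zero_add] at h1 h2
  have hae : ∀ s ∈ uIoo y (z m).im, regIntegrand ε c z m n l φ ((z m).re + s * I) =
      expG ε c z l ((z m).re + s * I) * rat z φ ((z m).re + s * I) := fun s hs => by
    rw [uIoo_of_lt hy] at hs
    refine (expG_mul_rat_eq hε hn0 hn l φ fun h => ?_).symm
    have := congrArg im h
    simp at this
    exact hs.2.ne this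
  refine ⟨h1, h2.symm.congr_uIoo hae, ?_⟩
  rw [regPrim, combInt]
  simp only [add_re, ofReal_re, mul_re, I_re, mul_zero, ofReal_im, I_im, mul_one, sub_self,
    add_zero, add_im, mul_im, zero_add, intervalIntegral.integral_same]
  rw [intervalIntegral.integral_symm y, neg_neg]
  refine intervalIntegral.integral_congr_uIoo fun s hs => ?_
  simp only [hae s hs]

/-- The vertical integral defining `Psi` at `z m` converges by the cancellation at the pole. Both
primitives have the same derivative on the slit column, and the constant is read off at half the
height of the pole. -/
theorem Psi_eq_add_regPrim (hε : 0 < ε) (hz : ∀ p, 0 < (z p).im)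
    (hmono : StrictMono fun p => (z p).re) (a : ℝ) {m : Fin P} {n : ℕ} (hn0 : 0 < n)
    (hn : I * c m / ε = -(n : ℂ)) (μ : ℂ) (φ : Fin P → ℂ) {ζ : ℂ} (hζ : ζ ∈ G z ∩ column z m) :
    Psi ε c z a φ μ ζ = Psi ε c z a φ μ (z m) + regPrim ε c z m n (-μ ^ 2) φ ζ := by
  have hy0 : 0 < (z m).im / 2 := half_pos (hz m)
  have hy : (z m).im / 2 < (z m).im := half_lt_self (hz m)
  set y := (z m).im / 2
  obtain ⟨h1, h2, h3⟩ := vertical_integrable_pole hε hz hmono hn0 hn (-μ ^ 2) φ hy0 hy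
  have hcomb := isComb_G_column m hy0 hy
  have hωG : ((z m).re + y * I : ℂ) ∈ G z ∩ column z m :=
    hcomb.base _ (pole_mem_column hz hmono m).2
  have h4 := hcomb.eq_of_hasDerivAt_zero
    (F := fun ζ => Psi ε c z a φ μ ζ - regPrim ε c z m n (-μ ^ 2) φ ζ) (fun ζ hζ => by
      convert! (hasDerivAt_Psi hz a φ μ hζ.1).sub (hasDerivAt_regPrim hz hmono m n (-μ ^ 2) φ hζ.2)
        using 1
      rw [expG_mul_rat_eq hε hn0 hn _ φ (ne_pole_of_mem_G hζ.1 m).1, sub_self]) hζ hωG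
  have h5 : Psi ε c z a φ μ (z m) = Psi ε c z a φ μ ((z m).re + y * I) -
      regPrim ε c z m n (-μ ^ 2) φ ((z m).re + y * I) := by
    simp only [Psi, add_re, ofReal_re, mul_re, I_re, mul_zero, ofReal_im, I_im, mul_one, sub_self,
      add_zero, add_im, mul_im, zero_add]
    rw [← intervalIntegral.integral_add_adjacent_intervals (h1.mul_const I) (h2.mul_const I), h3]
    ring
  rw [h5, ← h4]
  ring

end BenjaminOno

/-! ### Vanishing rows make all gap constants vanish. -/

namespace BenjaminOno

variable {P : ℕ}

/-- The monodromy defect of `Psi` on the vertical line through `x`. -/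
noncomputable def Gam (ε : ℝ) (c z : Fin P → ℂ) (a : ℝ) (φ : Fin P → ℂ) (μ : ℂ) (x : ℝ) : ℂ :=
  Psi ε c z a φ μ (x + (top z + 1 : ℝ) * I) +
    ratioG ε c z x * V ε c z φ μ (x + (top z + 1 : ℝ) * I)

open Classical in
/-- The contour integrals from infinity in the upper left part of the plane. -/
noncomputable def row (ε : ℝ) (c z : Fin P → ℂ) (a : ℝ) (b : Fin P → ℝ) (φ : Fin P → ℂ) (μ : ℂ)
    (m : Fin P) : ℂ :=
  if Exceptional ε (c m) then Psi ε c z a φ μ (z m) else Gam ε c z a φ μ (b m)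

variable {ε : ℝ} {c z : Fin P → ℂ}

theorem Psi_add_V_eq_Gam (hε : 0 < ε) (hz : ∀ p, 0 < (z p).im) (a : ℝ) (φ : Fin P → ℂ) {μ : ℂ}
    (hμ : 0 < μ.re) {ζ : ℂ} (hζ : top z < ζ.im) {x : ℝ} (hg : SameGap z ζ.re x) :
    Psi ε c z a φ μ ζ + ratioG ε c z ζ.re * V ε c z φ μ ζ = Gam ε c z a φ μ x := by
  rw [Psi_add_V_eq hε hz a φ hμ hζ (ω := x + (top z + 1 : ℝ) * I) (by simp) (by simpa using hg),
    Gam]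
  simp

theorem Gam_eq (hε : 0 < ε) (hz : ∀ p, 0 < (z p).im) (a : ℝ) (φ : Fin P → ℂ) {μ : ℂ}
    (hμ : 0 < μ.re) {x y : ℝ} (hg : SameGap z x y) :
    Gam ε c z a φ μ x = Gam ε c z a φ μ y := by
  have h := Psi_add_V_eq_Gam (ε := ε) (c := c) hε hz a φ hμ (ζ := x + (top z + 1 : ℝ) * I) (x := y)
    (by simp) (by simpa using hg)
  rw [← h, Gam]
  simp

/-- Crossing the line of an exceptional pole changes `ratioG` by `exp (±2πi n) = 1`. The absence of
monodromy is why a contour passing the pole would give no condition and must end at it. -/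
theorem ratioG_eq_of_exceptional (hε : 0 < ε) {m : Fin P} {n : ℕ} (hn : I * c m / ε = -(n : ℂ))
    {x y : ℝ} (hxy : ∀ p, p ≠ m → ((z p).re < x ↔ (z p).re < y)) :
    ratioG ε c z x = ratioG ε c z y := by
  have hε' : (ε : ℂ) ≠ 0 := ofReal_ne_zero.2 hε.ne'
  have key : ∀ x : ℝ, ratioG ε c z x = Complex.exp (-I * (∑ p, (if p = m then 0 else
      (c p * ((if (z p).re < x then Real.pi * I else -(Real.pi * I)) +
      Real.pi * I / 2) - conj (c p) * (Real.pi * I / 2)))) / ε) *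
      Complex.exp (-I * (c m * (-(Real.pi * I) + Real.pi * I / 2) -
        conj (c m) * (Real.pi * I / 2)) / ε) := fun x => by
    rw [ratioG, sum_eq_sum_ite_add m, ← Complex.exp_add]
    split_ifs with h
    · refine Complex.exp_eq_exp_iff_exists_int.2 ⟨n, ?_⟩
      push_cast
      linear_combination (-2 * Real.pi * I) * hn
    · congr 1
      ring
  rw [key x, key y]
  congr 4
  refine Finset.sum_congr rfl fun p _ => ?_
  by_cases hp : p = m
  · simp [hp]
  · simp only [hp, if_false, hxy p hp]

/-- Above the poles the regularized integrand is the fixed multiple `ratioG x` of `expHat * rat`,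
first off the line through `z m` and on it by continuity. So the constant is the same on both sides
of that line. -/
theorem regPrim_add_V_eq (hε : 0 < ε) (hz : ∀ p, 0 < (z p).im)
    (hmono : StrictMono fun p => (z p).re) {m : Fin P} {n : ℕ} (hn0 : 0 < n)
    (hn : I * c m / ε = -(n : ℂ)) {μ : ℂ} (hμ : 0 < μ.re) (φ : Fin P → ℂ) (x : ℝ) (hx : x ∈ columnRe z m)
    {ζ ω : ℂ}
    (hζ : ζ ∈ column z m ∩ {ζ | top z < ζ.im}) (hω : ω ∈ column z m ∩ {ζ | top z < ζ.im}) :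
    regPrim ε c z m n (-μ ^ 2) φ ζ + ratioG ε c z x * V ε c z φ μ ζ =
      regPrim ε c z m n (-μ ^ 2) φ ω + ratioG ε c z x * V ε c z φ μ ω := by
  have htop : 0 ≤ top z := zero_le_one.trans (one_le_top hz)
  have hne : ∀ ζ ∈ column z m ∩ {ζ | top z < ζ.im}, ζ.re ≠ (z m).re →
      regIntegrand ε c z m n (-μ ^ 2) φ ζ =
        ratioG ε c z x * (expHat ε c z (-μ ^ 2) ζ * rat z φ ζ) := fun ζ hζ h => by
    have h1 : ∀ p, ζ.re ≠ (z p).re := fun p => by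
      by_cases hp : p = m
      · rwa [hp]
      · exact column_re_ne hζ.1 hp
    rw [← expG_mul_rat_eq hε hn0 hn _ φ fun h' => h (by rw [h']), expG_eq _ h1,
      ratioG_eq_of_exceptional hε hn (x := ζ.re) (y := x) fun p hp => ?_, mul_assoc]
    rcases hζ.1.2 p hp with h | h <;> rcases hx p hp with h' | h'
    · simp [h.1, h'.1]
    · exact absurd h.2 h'.2.not_gt
    · exact absurd h'.2 h.2.not_gt
    · simp [h.1.not_gt, h'.1.not_gt]
  have hall : ∀ ζ ∈ column z m ∩ {ζ | top z < ζ.im}, regIntegrand ε c z m n (-μ ^ 2) φ ζ =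
      ratioG ε c z x * (expHat ε c z (-μ ^ 2) ζ * rat z φ ζ) := fun ζ hζ => by
    by_cases h : ζ.re = (z m).re
    · have hopen := (isComb_column_above (z := z) m htop (lt_add_one _)).isOpen
      have hc1 : ContinuousAt (fun t : ℝ => ζ + t) 0 := by fun_prop
      have hmem := hc1.eventually (hopen.mem_nhds (by simpa using hζ))
      have ha := ((differentiableOn_regIntegrand (ε := ε) (c := c) hz m n (-μ ^ 2)
        φ).continuousOn.continuousAt ((isOpen_column m).mem_nhds hζ.1))
      have hb := ((differentiableOn_expHat_mul_rat (ε := ε) (c := c) hz (-μ ^ 2)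
        φ).continuousOn.continuousAt (isOpen_GHat.mem_nhds (mem_GHat_of_top_lt hz hζ.2)))
      have e : ζ + ((0 : ℝ) : ℂ) = ζ := by simp
      have ha' := (ContinuousAt.comp (f := fun t : ℝ => ζ + t) (by rw [e]; exact ha)
        hc1).tendsto.mono_left (nhdsWithin_le_nhds (s := {0}ᶜ))
      have hb' := ((ContinuousAt.comp (f := fun t : ℝ => ζ + t) (by rw [e]; exact hb)
        hc1).tendsto.mono_left (nhdsWithin_le_nhds (s := {0}ᶜ))).const_mul (ratioG ε c z x)
      simp only [Function.comp_def, e] at ha' hb'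
      refine tendsto_nhds_unique_of_eventuallyEq ha' hb' ?_
      filter_upwards [nhdsWithin_le_nhds hmem, self_mem_nhdsWithin] with t ht ht0
      refine hne _ ht ?_
      have : t ≠ 0 := ht0
      simpa [h] using this
    · exact hne ζ hζ h
  refine (isComb_column_above m htop (lt_add_one _)).eq_of_hasDerivAt_zero
    (F := fun ζ => regPrim ε c z m n (-μ ^ 2) φ ζ + ratioG ε c z x * V ε c z φ μ ζ)
    (fun v hv => ?_) hζ hω
  convert! (hasDerivAt_regPrim hz hmono m n (-μ ^ 2) φ hv.1).add
    ((hasDerivAt_V (c := c) hε hz φ hμ hv.2).const_mul (ratioG ε c z x)) using 1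
  rw [hall v hv]
  ring

/-- A sweep from the leftmost gap, where the constant is zero. Past an ordinary pole the row is the
constant of the next gap. Past an exceptional pole the row only says `Psi (z m) = 0`, but then `Psi`
is `regPrim` on the column and the constant is inherited from the gap to the left. -/
theorem Gam_eq_zero_of_row_eq_zero (hε : 0 < ε) (hz : ∀ p, 0 < (z p).im)
    (hmono : StrictMono fun p => (z p).re) {a : ℝ} (ha : ∀ p, a < (z p).re)
    {b : Fin P → ℝ} (hb : ∀ m, (z m).re < b m ∧ ∀ p, m < p → b m < (z p).re) {φ : Fin P → ℂ} {μ : ℂ}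
    (hμ : 0 < μ.re) (hrow : ∀ m, row ε c z a b φ μ m = 0) :
    ∀ x : ℝ, (∀ p, x ≠ (z p).re) → Gam ε c z a φ μ x = 0 := by
  -- Induction on a bound `k` for the indices of the poles to the left of `x`.
  suffices H : ∀ k : ℕ, ∀ x : ℝ, (∀ p : Fin P, (z p).re < x → p.val < k) → (∀ p, x ≠ (z p).re) →
      Gam ε c z a φ μ x = 0 from fun x hx => H P x (fun p _ => p.2) hx
  intro k
  induction k with
  | zero =>
    intro x hx hne
    rw [Gam, Psi_eq_left hε hz ha φ hμ (by simp) fun p => ?_]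
    · simp
    · have : ¬ (z p).re < x := fun h => absurd (hx p h) (by omega)
      simpa using lt_of_le_of_ne (not_lt.1 this) (hne p)
  | succ k ih =>
    intro x hx hne
    by_cases hk : ∃ m : Fin P, m.val = k ∧ (z m).re < x
    · obtain ⟨m, hmk, hmx⟩ := hk
      have hup : ∀ p, m < p → x < (z p).re := fun p hp => by
        have : ¬ (z p).re < x := fun h => by
          have := hx p h
          have : m.val < p.val := hp
          omega
        exact lt_of_le_of_ne (not_lt.1 this) (hne p)
      have hrm := hrow m
      rw [row] at hrm
      split_ifs at hrm with hex
      · obtain ⟨n, hn0, hn⟩ := hex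
        have hxc : x ∈ columnRe z m := fun p hp => by
          rcases lt_or_gt_of_ne hp with h | h
          · exact Or.inl ⟨(hmono h).trans hmx, hmono h⟩
          · exact Or.inr ⟨hup p h, hmono h⟩
        obtain ⟨x', hx'c, hx'⟩ : ∃ x', x' ∈ columnRe z m ∧ x' < (z m).re := by
          have hev : ∀ᶠ t in 𝓝[<] (z m).re, ∀ p : Fin P, p ≠ m →
              (z p).re < t ∧ (z p).re < (z m).re ∨ t < (z p).re ∧ (z m).re < (z p).re := by
            refine eventually_all.2 fun p => ?_
            by_cases hp : p = m
            · simp [hp]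
            · rcases lt_or_gt_of_ne hp with h | h
              · filter_upwards [nhdsWithin_le_nhds (lt_mem_nhds (hmono h))] with t ht _
                exact Or.inl ⟨ht, hmono h⟩
              · filter_upwards [nhdsWithin_le_nhds (gt_mem_nhds (hmono h))] with t ht _
                exact Or.inr ⟨ht, hmono h⟩
          obtain ⟨t, h1, h2⟩ := (hev.and self_mem_nhdsWithin).exists
          exact ⟨t, h1, h2⟩
        have htop := zero_lt_one.trans_le (one_le_top hz)
        have hcol : ∀ t ∈ columnRe z m, (t + (top z + 1 : ℝ) * I : ℂ) ∈
            column z m ∩ {ζ | top z < ζ.im} := fun t ht =>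
          (isComb_column_above m htop.le (lt_add_one _)).base t ht
        have hGam : ∀ t ∈ columnRe z m, t ≠ (z m).re → Gam ε c z a φ μ t =
            regPrim ε c z m n (-μ ^ 2) φ (t + (top z + 1 : ℝ) * I) +
              ratioG ε c z x * V ε c z φ μ (t + (top z + 1 : ℝ) * I) := fun t ht htm => by
          rw [Gam, Psi_eq_add_regPrim hε hz hmono a hn0 hn μ φ ⟨mem_G_of_re_ne fun p => ?_,
            (hcol t ht).1⟩, hrm, zero_add, ratioG_eq_of_exceptional hε hn (x := t) (y := x)
              fun p hp => ?_]
          · rcases ht p hp with h | h <;> rcases hxc p hp with h' | h'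
            · simp [h.1, h'.1]
            · exact absurd h.2 h'.2.not_gt
            · exact absurd h'.2 h.2.not_gt
            · simp [h.1.not_gt, h'.1.not_gt]
          · by_cases hp : p = m
            · simpa [hp] using htm
            · exact column_re_ne (hcol t ht).1 hp
        rw [hGam x hxc hmx.ne', regPrim_add_V_eq hε hz hmono hn0 hn hμ φ x hxc (hcol x hxc)
          (hcol x' hx'c), ← hGam x' hx'c hx'.ne]
        refine ih x' (fun p hp => ?_) fun p => ?_
        · by_contra hcon
          have : m ≤ p := by
            rw [Fin.le_def]
            omega
          exact absurd (hmono.monotone this) (by simpa using hp.trans hx')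
        · by_cases hp : p = m
          · rw [hp]; exact hx'.ne
          · have := column_re_ne (hcol x' hx'c).1 hp
            simpa using this
      · rw [← hrm]
        refine Gam_eq hε hz a φ hμ fun p => ?_
        rcases lt_trichotomy p m with h | h | h
        · exact Or.inl ⟨(hmono h).trans hmx, (hmono h).trans (hb m).1⟩
        · rw [h]; exact Or.inl ⟨hmx, (hb m).1⟩
        · exact Or.inr ⟨hup p h, (hb m).2 p h⟩
    · refine ih x (fun p hp => ?_) hne
      have h1 := hx p hp
      have h2 : p.val ≠ k := fun h => hk ⟨p, h, hp⟩
      omega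

end BenjaminOno

/-! ### Decay of `Psi` far from the imaginary axis. -/

namespace BenjaminOno

variable {P : ℕ} {ε : ℝ} {c z : Fin P → ℂ}

/-- A distance from the imaginary axis beyond which there are no poles. -/
noncomputable def wide (z : Fin P → ℂ) : ℝ := 1 + ∑ p, 2 * ‖z p‖

theorem one_le_wide (z : Fin P → ℂ) : 1 ≤ wide z := by
  have : 0 ≤ ∑ p, 2 * ‖z p‖ := by positivity
  rw [wide]; linarith

theorem two_mul_norm_add_one_le_wide (z : Fin P → ℂ) (p : Fin P) : 1 + 2 * ‖z p‖ ≤ wide z := by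
  have := Finset.single_le_sum (f := fun p => 2 * ‖z p‖) (fun p _ => by positivity)
    (Finset.mem_univ p)
  simp only [wide]
  linarith

theorem re_ne_of_wide {ζ : ℂ} (hζ : wide z < |ζ.re|) (p : Fin P) : ζ.re ≠ (z p).re := fun h => by
  have h1 := two_mul_norm_add_one_le_wide z p
  have h2 := abs_re_le_norm (z p)
  rw [← h] at h2
  linarith [norm_nonneg (z p)]

theorem le_norm_sub_of_wide {ζ : ℂ} (hζ : wide z < |ζ.re|) (p : Fin P) :
    1 ≤ ‖ζ - z p‖ ∧ 1 ≤ ‖ζ - conj (z p)‖ ∧ ‖ζ‖ / 2 ≤ ‖ζ - z p‖ := by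
  have h1 := two_mul_norm_add_one_le_wide z p
  have h2 := abs_re_le_norm ζ
  have h3 := norm_sub_norm_le ζ (z p)
  have h4 := norm_sub_norm_le ζ (conj (z p))
  rw [RCLike.norm_conj] at h4
  have := norm_nonneg (z p)
  exact ⟨by linarith, by linarith, by linarith⟩

/-- Far to the side `u₀` is bounded, so along a vertical line `‖expG‖` varies by a factor controlled
by the difference of heights alone. This carries estimates through a strip of bounded height,
uniformly in `x`. -/
theorem norm_expG_le (hε : 0 < ε) (l : ℂ) {x : ℝ} (hx : wide z < |x|) (s t : ℝ) :
    ‖expG ε c z l (x + s * I)‖ ≤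
      ‖expG ε c z l (x + t * I)‖ * Real.exp ((‖l‖ + 2 * ∑ p, ‖c p‖) / ε * |s - t|) := by
  have hS : Convex ℝ {ζ : ℂ | ζ.re = x} := by
    exact (convex_singleton x).linear_preimage reLm
  have h1 : ‖f c z (x + s * I) - f c z (x + t * I)‖ ≤
      (2 * ∑ p, ‖c p‖) / 1 * ‖(x + s * I : ℂ) - (x + t * I)‖ := by
    refine Convex.norm_image_sub_le_of_norm_hasDerivWithin_le (s := {ζ : ℂ | ζ.re = x})
      (f' := u0 c z) (fun v (hv : v.re = x) => (hasDerivAt_f (mem_G_of_re_ne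
        (re_ne_of_wide (by rwa [hv])))).hasDerivWithinAt) (fun v (hv : v.re = x) => ?_) hS
      (by simp) (by simp)
    refine norm_u0_le_of_far one_pos fun p => ?_
    have := le_norm_sub_of_wide (z := z) (ζ := v) (by rwa [hv]) p
    exact ⟨this.1, this.2.1⟩
  have e1 : ‖(x + s * I : ℂ) - (x + t * I)‖ = |s - t| := by
    rw [add_sub_add_left_eq_sub, ← sub_mul, norm_mul, norm_I, mul_one, ← ofReal_sub, norm_real,
      Real.norm_eq_abs]
  rw [e1, div_one] at h1
  have e2 : expG ε c z l (x + s * I) = expG ε c z l (x + t * I) * Complex.exp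
      (-I * (l * ((x + s * I) - (x + t * I)) + (f c z (x + s * I) - f c z (x + t * I))) / ε) := by
    rw [expG, expG, ← Complex.exp_add]
    ring_nf
  rw [e2, norm_mul]
  refine mul_le_mul_of_nonneg_left ?_ (norm_nonneg _)
  rw [norm_exp]
  refine Real.exp_le_exp.2 ((re_le_norm _).trans ?_)
  rw [norm_div, norm_mul, norm_neg, norm_I, one_mul, norm_real, Real.norm_of_nonneg hε.le,
    div_mul_eq_mul_div]
  gcongr
  refine (norm_add_le _ _).trans ?_
  rw [norm_mul, e1]
  linarith

theorem norm_rat_le_of_wide (φ : Fin P → ℂ) {ζ : ℂ} (hζ : wide z < |ζ.re|) :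
    ‖rat z φ ζ‖ ≤ 2 * (∑ p, ‖φ p‖) / ‖ζ‖ := by
  have h0 : 0 < ‖ζ‖ := by linarith [abs_re_le_norm ζ, one_le_wide z]
  rw [Finset.mul_sum, Finset.sum_div]
  refine (norm_sum_le _ _).trans (Finset.sum_le_sum fun p _ => ?_)
  have := le_norm_sub_of_wide hζ p
  rw [norm_div, div_le_div_iff₀ (by linarith) h0]
  nlinarith [norm_nonneg (φ p)]

/-- High up, `Gam = 0` leaves a multiple of `V`, whose bound applies. Lower down `Psi` is compared
with its value at height `Y` on the same vertical line: the segment has bounded length, `expG`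
varies by at most the factor `Λ`, and `rat` is `O(1/‖ζ‖)`. -/
theorem exists_norm_Psi_le (hε : 0 < ε) (hz : ∀ p, 0 < (z p).im) (a : ℝ) (φ : Fin P → ℂ) {μ : ℂ}
    (hμ : 0 < μ.re) : ∃ C, 0 ≤ C ∧ ∀ ζ : ℂ, 0 ≤ ζ.im → wide z < |ζ.re| →
      Gam ε c z a φ μ ζ.re = 0 →
      ‖Psi ε c z a φ μ ζ‖ ≤ C * (‖expG ε c z (-μ ^ 2) ζ‖ / ‖ζ‖) := by
  obtain ⟨T, C, hT, hC, hV⟩ := exists_norm_V_le (c := c) hε hz φ hμ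
  set Y : ℝ := top z + T + 1 with hY
  have htop := one_le_top hz
  set Λ : ℝ := Real.exp ((‖-μ ^ 2‖ + 2 * ∑ p, ‖c p‖) / ε * Y) with hΛ
  set B : ℝ := 2 * ∑ p, ‖φ p‖ with hB
  have hB0 : 0 ≤ B := by positivity
  have hΛ1 : 1 ≤ Λ := Real.one_le_exp (by positivity)
  have high : ∀ ζ : ℂ, top z + T < ζ.im → wide z < |ζ.re| → Gam ε c z a φ μ ζ.re = 0 →
      ‖Psi ε c z a φ μ ζ‖ ≤ C * (‖expG ε c z (-μ ^ 2) ζ‖ / ‖ζ‖) := fun ζ h1 h2 h3 => by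
    have h4 := Psi_add_V_eq_Gam (ε := ε) (c := c) hε hz a φ hμ (ζ := ζ) (x := ζ.re) (by linarith)
      (sameGap_refl (re_ne_of_wide h2))
    rw [h3] at h4
    rw [eq_neg_of_add_eq_zero_left h4, norm_neg, norm_mul, expG_eq _ (re_ne_of_wide h2), norm_mul]
    calc _ ≤ ‖ratioG ε c z ζ.re‖ * (C * (‖expHat ε c z (-μ ^ 2) ζ‖ / ‖ζ‖)) := by
          gcongr
          exact hV ζ h1
      _ = _ := by ring
  refine ⟨C * Λ + Λ * B * Y, by positivity, fun ζ h1 h2 h3 => ?_⟩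
  have hζ0 : 0 < ‖ζ‖ := by linarith [abs_re_le_norm ζ, one_le_wide z]
  rcases lt_or_ge (top z + T) ζ.im with h4 | h4
  · refine (high ζ h4 h2 h3).trans (mul_le_mul_of_nonneg_right ?_ (by positivity))
    have : 0 ≤ Λ * B * Y := by positivity
    nlinarith
  · set ω : ℂ := ζ.re + Y * I with hω
    have hωre : ω.re = ζ.re := by simp [hω]
    have hωim : ω.im = Y := by simp [hω]
    have hζeq : ((ζ.re : ℂ) + ζ.im * I) = ζ := re_add_im ζ
    have hEω : ‖expG ε c z (-μ ^ 2) ω‖ ≤ ‖expG ε c z (-μ ^ 2) ζ‖ * Λ := by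
      have := norm_expG_le (c := c) hε (-μ ^ 2) h2 Y ζ.im
      rw [hζeq] at this
      refine this.trans ?_
      rw [hΛ]
      gcongr
      rw [abs_of_nonneg (by linarith)]
      linarith
    have hωζ : ‖ζ‖ ≤ ‖ω‖ := by
      rw [norm_def, norm_def]
      refine Real.sqrt_le_sqrt ?_
      rw [normSq_apply, normSq_apply, hωre, hωim]
      nlinarith
    have h5 := high ω (by rw [hωim]; linarith) (by rwa [hωre]) (by rwa [hωre])
    have h6 : ‖Psi ε c z a φ μ ζ - Psi ε c z a φ μ ω‖ ≤
        ‖expG ε c z (-μ ^ 2) ζ‖ * Λ * (B / ‖ζ‖) * ‖ζ - ω‖ := by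
      have hS : Convex ℝ {v : ℂ | v.re = ζ.re ∧ ζ.im ≤ v.im ∧ v.im ≤ Y} :=
        ((convex_singleton ζ.re).linear_preimage reLm).inter
          (((convex_Ici ζ.im).linear_preimage imLm).inter ((convex_Iic Y).linear_preimage imLm))
      refine Convex.norm_image_sub_le_of_norm_hasDerivWithin_le
        (s := {v : ℂ | v.re = ζ.re ∧ ζ.im ≤ v.im ∧ v.im ≤ Y})
        (f' := fun v => expG ε c z (-μ ^ 2) v * rat z φ v)
        (fun v hv => (hasDerivAt_Psi hz a φ μ (mem_G_of_re_ne
          (re_ne_of_wide (by rwa [hv.1])))).hasDerivWithinAt) (fun v hv => ?_) hS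
        ⟨hωre, by rw [hωim]; linarith, hωim.le⟩ ⟨rfl, le_rfl, by linarith⟩
      rw [norm_mul]
      refine mul_le_mul ?_ ?_ (norm_nonneg _) (by positivity)
      · have := norm_expG_le (c := c) hε (-μ ^ 2) h2 v.im ζ.im
        rw [hζeq, ← hv.1, re_add_im] at this
        refine this.trans ?_
        rw [hΛ]
        gcongr
        rw [abs_of_nonneg (by linarith [hv.2.1])]
        linarith [hv.2.2]
      · refine (norm_rat_le_of_wide φ (by rwa [hv.1])).trans ?_
        rw [← hB]
        gcongr
        rw [norm_def, norm_def]
        refine Real.sqrt_le_sqrt ?_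
        rw [normSq_apply, normSq_apply, hv.1]
        nlinarith [hv.2.1]
    have h7 : ‖ζ - ω‖ ≤ Y := by
      have : ζ - ω = ((ζ.im - Y : ℝ) : ℂ) * I := by
        rw [hω]
        push_cast
        linear_combination -hζeq
      rw [this, norm_mul, norm_I, mul_one, norm_real, Real.norm_eq_abs, abs_of_nonpos (by linarith)]
      linarith
    calc ‖Psi ε c z a φ μ ζ‖ ≤ ‖Psi ε c z a φ μ ω‖ + ‖Psi ε c z a φ μ ζ - Psi ε c z a φ μ ω‖ :=
          norm_le_insert' _ _
      _ ≤ C * (‖expG ε c z (-μ ^ 2) ζ‖ * Λ / ‖ζ‖) +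
          ‖expG ε c z (-μ ^ 2) ζ‖ * Λ * (B / ‖ζ‖) * Y := by
        refine add_le_add (h5.trans ?_) (h6.trans ?_)
        · gcongr
        · gcongr
      _ = _ := by ring

end BenjaminOno

/-! ### Gluing the solution around the poles. -/

namespace BenjaminOno

variable {P : ℕ}

/-- The antiderivative of `expHat * rat` on `GHat` which vanishes at infinity in the upper
half-plane. -/
noncomputable def PsiHat (ε : ℝ) (c z : Fin P → ℂ) (φ : Fin P → ℂ) (μ ζ : ℂ) : ℂ :=
  -V ε c z φ μ ((top z + 1 : ℝ) * I) +
    combInt (fun ζ => expHat ε c z (-μ ^ 2) ζ * rat z φ ζ) 0 (top z + 1) ζ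

open Classical in
/-- The solution of the differential equation built from `Psi` on `G` and from `PsiHat` above the
poles. -/
noncomputable def sol (ε : ℝ) (c z : Fin P → ℂ) (a : ℝ) (φ : Fin P → ℂ) (μ ζ : ℂ) : ℂ :=
  if ζ ∈ G z then -(I / ε) * Psi ε c z a φ μ ζ / expG ε c z (-μ ^ 2) ζ
  else -(I / ε) * PsiHat ε c z φ μ ζ / expHat ε c z (-μ ^ 2) ζ

variable {ε : ℝ} {c z : Fin P → ℂ}

theorem pole_im_lt_top (hz : ∀ p, 0 < (z p).im) (p : Fin P) : (z p).im < top z + 1 := by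
  have := im_add_one_le_top hz p
  linarith

theorem hasDerivAt_PsiHat (hz : ∀ p, 0 < (z p).im) (φ : Fin P → ℂ) (μ : ℂ) {ζ : ℂ}
    (hζ : ζ ∈ GHat z) :
    HasDerivAt (PsiHat ε c z φ μ) (expHat ε c z (-μ ^ 2) ζ * rat z φ ζ) ζ :=
  ((isComb_GHat (by linarith [one_le_top hz]) (pole_im_lt_top hz)).hasDerivAt_combInt
    (differentiableOn_expHat_mul_rat hz (-μ ^ 2) φ) (mem_univ 0) hζ).const_add _

theorem PsiHat_eq_neg_V (hε : 0 < ε) (hz : ∀ p, 0 < (z p).im) (φ : Fin P → ℂ) {μ : ℂ}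
    (hμ : 0 < μ.re) {ζ : ℂ} (hζ : top z < ζ.im) : PsiHat ε c z φ μ ζ = -V ε c z φ μ ζ := by
  have hcomb : IsComb {ζ : ℂ | top z < ζ.im} univ (top z + 1) :=
    { isOpen := isOpen_upperHalfPlane _
      ordConnected := ordConnected_univ
      base := fun t _ => by simp
      re_mem := fun _ _ => mem_univ _
      vert := fun ζ (hζ : top z < ζ.im) s hs => by
        have hs' : min (top z + 1) ζ.im ≤ s := hs.1
        have : top z < min (top z + 1) ζ.im := lt_min (lt_add_one _) hζ
        simp
        linarith }
  have h := hcomb.eq_of_hasDerivAt_zero (F := fun ζ => PsiHat ε c z φ μ ζ + V ε c z φ μ ζ)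
    (fun v (hv : top z < v.im) => by
      convert! (hasDerivAt_PsiHat hz φ μ (mem_GHat_of_top_lt hz hv)).add
        (hasDerivAt_V hε hz φ hμ hv) using 1
      ring) (ζ := ζ) (ω := (top z + 1 : ℝ) * I) hζ (by simp)
  refine eq_neg_of_add_eq_zero_left (h.trans ?_)
  simp [PsiHat, combInt]

theorem re_ne_of_mem_inter {ζ : ℂ} (h1 : ζ ∈ G z) (h2 : ζ ∈ GHat z) (p : Fin P) :
    ζ.re ≠ (z p).re := fun h => h1 p ⟨h, (h2.2 p h).le.trans (le_abs_self _)⟩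

/-- The difference is constant down the whole strip of the gap, and at height `top z + 1`, where
`PsiHat` is `-V`, it equals `Gam`. The factor `ratioG` then cancels in the quotient by the
exponential, which continues the solution over the cuts above the poles. -/
theorem Psi_eq_PsiHat (hε : 0 < ε) (hz : ∀ p, 0 < (z p).im) (a : ℝ) (φ : Fin P → ℂ) {μ : ℂ}
    (hμ : 0 < μ.re) {ζ : ℂ} (hζ : 0 < ζ.im) (hne : ∀ p, ζ.re ≠ (z p).re)
    (hG : Gam ε c z a φ μ ζ.re = 0) :
    Psi ε c z a φ μ ζ = ratioG ε c z ζ.re * PsiHat ε c z φ μ ζ := by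
  have htop := one_le_top hz
  have hcomb := isComb_gap z ζ.re (y := 0) (y₀ := top z + 1) (by linarith)
  have h := hcomb.eq_of_hasDerivAt_zero
    (F := fun v => Psi ε c z a φ μ v - ratioG ε c z ζ.re * PsiHat ε c z φ μ v) (fun v hv => ?_)
    (ζ := ζ) (ω := ζ.re + (top z + 1 : ℝ) * I) ⟨hζ, sameGap_refl hne⟩
    (hcomb.base _ (sameGap_refl hne))
  · rw [PsiHat_eq_neg_V hε hz φ hμ (ζ := ζ.re + (top z + 1 : ℝ) * I) (by simp)] at h
    rw [Gam] at hG
    linear_combination h + hG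
  · have hne' := hv.2.left_ne
    have h1 := hasDerivAt_Psi (ε := ε) (c := c) hz a φ μ (mem_G_of_re_ne hne')
    have h2 := (hasDerivAt_PsiHat (ε := ε) (c := c) hz φ μ (ζ := v)
      ⟨hv.1, fun p hp => absurd hp (hne' p)⟩).const_mul (ratioG ε c z ζ.re)
    convert! h1.sub h2 using 1
    rw [expG_eq _ hne', hv.2.ratioG_eq]
    ring

theorem sol_of_mem_G (a : ℝ) (φ : Fin P → ℂ) (μ : ℂ) {ζ : ℂ} (hζ : ζ ∈ G z) :
    sol ε c z a φ μ ζ = -(I / ε) * Psi ε c z a φ μ ζ / expG ε c z (-μ ^ 2) ζ := if_pos hζ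

theorem sol_of_mem_GHat (hε : 0 < ε) (hz : ∀ p, 0 < (z p).im) {a : ℝ} {φ : Fin P → ℂ} {μ : ℂ}
    (hμ : 0 < μ.re) (hG : ∀ x : ℝ, (∀ p, x ≠ (z p).re) → Gam ε c z a φ μ x = 0) {ζ : ℂ}
    (hζ : ζ ∈ GHat z) :
    sol ε c z a φ μ ζ = -(I / ε) * PsiHat ε c z φ μ ζ / expHat ε c z (-μ ^ 2) ζ := by
  by_cases h : ζ ∈ G z
  · have hne := re_ne_of_mem_inter h hζ
    rw [sol_of_mem_G a φ μ h, Psi_eq_PsiHat hε hz a φ hμ hζ.1 hne (hG _ hne), expG_eq _ hne]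
    have := ratioG_ne_zero (ε := ε) (c := c) (z := z) ζ.re
    have := expHat_ne_zero (ε := ε) (c := c) (z := z) (-μ ^ 2) ζ
    rw [← mul_div_mul_left _ (expHat ε c z (-μ ^ 2) ζ) (ratioG_ne_zero (ε := ε) (c := c) (z := z)
      ζ.re)]
    ring
  · exact if_neg h

/-- The quotient of an antiderivative of `E * R` by `E` solves the inhomogeneous equation when `E`
solves the homogeneous one. -/
theorem hasDerivAt_quotient (hε : 0 < ε) {T E : ℂ → ℂ} {ζ R u l : ℂ}
    (hT : HasDerivAt T (E ζ * R) ζ) (hE : HasDerivAt E (E ζ * (-I * (l + u) / ε)) ζ)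
    (hE0 : E ζ ≠ 0) :
    HasDerivAt (fun ζ => -(I / ε) * T ζ / E ζ)
      (-(I / ε) * R + I / ε * (l + u) * (-(I / ε) * T ζ / E ζ)) ζ := by
  have hε' : (ε : ℂ) ≠ 0 := ofReal_ne_zero.2 hε.ne'
  convert! (hT.const_mul (-(I / ε))).div hE hE0 using 1
  field_simp
  ring

theorem hasDerivAt_sol (hε : 0 < ε) (hz : ∀ p, 0 < (z p).im) {a : ℝ} {φ : Fin P → ℂ} {μ : ℂ}
    (hμ : 0 < μ.re) (hG : ∀ x : ℝ, (∀ p, x ≠ (z p).re) → Gam ε c z a φ μ x = 0) {ζ : ℂ}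
    (hζ : ζ ∈ G z ∪ GHat z) :
    HasDerivAt (sol ε c z a φ μ)
      (-(I / ε) * rat z φ ζ + I / ε * (-μ ^ 2 + u0 c z ζ) * sol ε c z a φ μ ζ) ζ := by
  by_cases h : ζ ∈ G z
  · rw [sol_of_mem_G a φ μ h]
    refine (hasDerivAt_quotient hε (hasDerivAt_Psi hz a φ μ h) (hasDerivAt_expG _ h)
      (expG_ne_zero _ _)).congr_of_eventuallyEq ?_
    filter_upwards [isOpen_G.mem_nhds h] with v hv
    exact sol_of_mem_G a φ μ hv
  · have h' := hζ.resolve_left h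
    rw [sol_of_mem_GHat hε hz hμ hG h']
    refine (hasDerivAt_quotient hε (hasDerivAt_PsiHat hz φ μ h') (hasDerivAt_expHat hz _ h')
      (expHat_ne_zero _ _)).congr_of_eventuallyEq ?_
    filter_upwards [isOpen_GHat.mem_nhds h'] with v hv
    exact sol_of_mem_GHat hε hz hμ hG hv

/-- The cuts above and below `z m` are opposite, so the two domains cover the punctured column. -/
theorem column_subset (m : Fin P) : column z m \ {z m} ⊆ G z ∪ GHat z := by
  rintro ζ ⟨hζ, hne⟩
  by_cases h : ζ.re = (z m).re
  · have him : ζ.im ≠ (z m).im := fun h' => hne (Complex.ext h h')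
    rcases lt_or_gt_of_ne him with h1 | h1
    · refine Or.inl fun p hp => ?_
      by_cases hpm : p = m
      · have := hp.2
        rw [hpm, abs_of_pos hζ.1] at this
        linarith
      · exact column_re_ne hζ hpm hp.1
    · refine Or.inr ⟨hζ.1, fun p hp => ?_⟩
      by_cases hpm : p = m
      · rwa [hpm]
      · exact absurd hp (column_re_ne hζ hpm)
  · refine Or.inl (mem_G_of_re_ne fun p => ?_)
    by_cases hp : p = m
    · rwa [hp]
    · exact column_re_ne hζ hp

theorem mem_union_of_im_nonneg (hz : ∀ p, 0 < (z p).im) (hmono : StrictMono fun p => (z p).re)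
    {ζ : ℂ} (hζ : 0 ≤ ζ.im) (hne : ∀ p, ζ ≠ z p) : ζ ∈ G z ∪ GHat z := by
  by_cases h : ζ ∈ G z
  · exact Or.inl h
  · obtain ⟨m, h1, h2⟩ : ∃ m, ζ.re = (z m).re ∧ (z m).im ≤ |ζ.im| := by
      simpa [G] using h
    rw [abs_of_nonneg hζ] at h2
    have him : 0 < ζ.im := (hz m).trans_le h2
    refine column_subset m ⟨mem_column_of_re (pole_mem_column hz hmono m) him h1, hne m⟩

/-- The part of `u0` that is regular at `z m`, multiplied by `ζ - z m`, plus the residue. -/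
noncomputable def resU (c z : Fin P → ℂ) (m : Fin P) (ζ : ℂ) : ℂ :=
  c m + (ζ - z m) * ((∑ p, if p = m then 0 else c p / (ζ - z p)) +
    ∑ p, conj (c p) / (ζ - conj (z p)))

/-- The analogue of `resU` for `rat`. -/
noncomputable def resR (z φ : Fin P → ℂ) (m : Fin P) (ζ : ℂ) : ℂ :=
  φ m + (ζ - z m) * (∑ p, if p = m then 0 else φ p / (ζ - z p))

theorem mul_u0_eq (m : Fin P) {ζ : ℂ} (hζ : ζ ≠ z m) : (ζ - z m) * u0 c z ζ = resU c z m ζ := by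
  have h0 := sub_ne_zero.2 hζ
  rw [u0, resU, Finset.sum_add_distrib, sum_eq_sum_ite_add m fun p => c p / (ζ - z p)]
  field_simp
  ring

theorem mul_rat_eq (φ : Fin P → ℂ) (m : Fin P) {ζ : ℂ} (hζ : ζ ≠ z m) :
    (ζ - z m) * rat z φ ζ = resR z φ m ζ := by
  have h0 := sub_ne_zero.2 hζ
  rw [rat, resR, sum_eq_sum_ite_add m fun p => φ p / (ζ - z p)]
  field_simp
  ring

theorem continuousAt_sum_ite (φ : Fin P → ℂ) (m : Fin P) {ζ : ℂ} (hζ : ζ ∈ column z m) :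
    ContinuousAt (fun ζ => ∑ p, if p = m then 0 else φ p / (ζ - z p)) ζ := by
  refine tendsto_finsetSum _ fun p _ => ?_
  by_cases hp : p = m
  · simp [hp]
  · simp only [hp, if_false]
    exact (continuousAt_const.div (by fun_prop)
      (sub_ne_zero.2 fun h => column_re_ne hζ hp (by rw [h]))).tendsto

theorem continuousAt_resR (φ : Fin P → ℂ) (m : Fin P) {ζ : ℂ} (hζ : ζ ∈ column z m) :
    ContinuousAt (resR z φ m) ζ := by
  have h1 := continuousAt_sum_ite φ m hζ
  unfold resR
  fun_prop

theorem continuousAt_resU (hz : ∀ p, 0 < (z p).im) (m : Fin P) {ζ : ℂ} (hζ : ζ ∈ column z m) :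
    ContinuousAt (resU c z m) ζ := by
  have h1 := continuousAt_sum_ite c m hζ
  have h2 : ContinuousAt (fun ζ => ∑ p, conj (c p) / (ζ - conj (z p))) ζ := by
    refine tendsto_finsetSum _ fun p _ => ?_
    refine (continuousAt_const.div (by fun_prop) (sub_ne_zero.2 fun h => ?_)).tendsto
    have := congrArg im h
    simp at this
    linarith [hζ.1, hz p]
  unfold resU
  fun_prop

theorem tendsto_pole_path (v : ℂ) :
    Tendsto (fun t : ℝ => v - t * I) (𝓝[>] 0) (𝓝[≠] v) := by
  refine tendsto_nhdsWithin_iff.2 ⟨?_, ?_⟩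
  · refine Tendsto.mono_left ?_ nhdsWithin_le_nhds
    have : ContinuousAt (fun t : ℝ => v - t * I) 0 := by fun_prop
    simpa [ContinuousAt] using this
  · filter_upwards [self_mem_nhdsWithin] with t ht
    have : t ≠ 0 := ne_of_gt ht
    simpa using this

theorem pole_path_mem (hz : ∀ p, 0 < (z p).im) (hmono : StrictMono fun p => (z p).re)
    (m : Fin P) {t : ℝ} (h0 : 0 < t) (ht : t < (z m).im) :
    z m - t * I ∈ G z ∩ column z m := by
  have h1 : z m - t * I ∈ column z m :=
    mem_column_of_re (pole_mem_column hz hmono m) (by simpa using ht) (by simp)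
  refine ⟨fun p hp => ?_, h1⟩
  by_cases hpm : p = m
  · have h2 := hp.2
    rw [hpm, abs_of_pos h1.1] at h2
    simp at h2
    linarith
  · exact column_re_ne h1 hpm hp.1

/-- The exponent of the equation at `z m` is `i c_m/ε`, so a pole of order `k` forces `i c_m/ε =
-k`, the exceptional case. There `Psi (z m) = 0` makes `(ζ - z m)^k * sol` a multiple of
`regPrim/regG`, which tends to zero as `z m` is approached from below, against the nonzero leading
coefficient. -/
theorem exists_sol_analytic_at_pole (hε : 0 < ε) (hz : ∀ p, 0 < (z p).im)
    (hmono : StrictMono fun p => (z p).re) {a : ℝ} {φ : Fin P → ℂ} {μ : ℂ}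
    (hμ : 0 < μ.re) (hG : ∀ x : ℝ, (∀ p, x ≠ (z p).re) → Gam ε c z a φ μ x = 0) {m : Fin P}
    (hex : Exceptional ε (c m) → Psi ε c z a φ μ (z m) = 0) :
    ∃ K : ℂ → ℂ, AnalyticAt ℂ K (z m) ∧ ∀ᶠ ζ in 𝓝[≠] z m, sol ε c z a φ μ ζ = K ζ := by
  have hzm := pole_mem_column hz hmono m
  obtain ⟨ρ, hρ, hball⟩ := Metric.isOpen_iff.1 (isOpen_column (z := z) m) _ hzm
  have hsub : Metric.ball (z m) ρ \ {z m} ⊆ G z ∪ GHat z :=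
    (sdiff_subset_sdiff_left hball).trans (column_subset m)
  rcases removable_or_pole_of_ode (q := fun ζ => I / ε * ((ζ - z m) * (-μ ^ 2) + resU c z m ζ))
    (r := fun ζ => -(I / ε) * resR z φ m ζ) hρ
    (fun ζ hζ => (hasDerivAt_sol hε hz hμ hG (hsub hζ)).differentiableAt.differentiableWithinAt)
    (fun ζ hζ => by
      rw [(hasDerivAt_sol hε hz hμ hG (hsub hζ)).deriv, ← mul_u0_eq m hζ.2, ← mul_rat_eq φ m hζ.2]
      ring)
    (fun ζ hζ => by
      have := continuousAt_resU (c := c) hz m (hball hζ)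
      exact ContinuousAt.continuousWithinAt (by fun_prop))
    (fun ζ hζ => by
      have := continuousAt_resR φ m (hball hζ)
      exact ContinuousAt.continuousWithinAt (by fun_prop)) with
    ⟨k, hk0, hk, K, hK, hK0, hev⟩ | h
  · exfalso
    have hn : I * c m / ε = -(k : ℂ) := by
      rw [← hk]
      simp [resU]
      ring
    have hPsi := hex ⟨k, hk0, hn⟩
    have hpath := tendsto_pole_path (z m)
    have hlim1 : Tendsto (fun t : ℝ => K (z m - t * I)) (𝓝[>] 0) (𝓝 (K (z m))) :=
      (hK.continuousAt.tendsto.mono_left nhdsWithin_le_nhds).comp hpath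
    have hcont : ContinuousAt (fun ζ => -(I / ε) * (-1) ^ k * regPrim ε c z m k (-μ ^ 2) φ ζ /
        regG ε c z m (-μ ^ 2) ζ) (z m) :=
      ((hasDerivAt_regPrim hz hmono m k (-μ ^ 2) φ hzm).continuousAt.const_mul _).div
        (differentiableAt_regG hz (-μ ^ 2) hzm).continuousAt (regG_ne_zero _ _ _)
    have hlim2 := (hcont.tendsto.mono_left nhdsWithin_le_nhds).comp hpath
    rw [regPrim_pole, mul_zero, zero_div] at hlim2
    refine hK0 (tendsto_nhds_unique_of_eventuallyEq hlim1 hlim2 ?_)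
    filter_upwards [hpath.eventually hev, self_mem_nhdsWithin,
      nhdsWithin_le_nhds (gt_mem_nhds (hz m))] with t ht ht0 htz
    have hmem := pole_path_mem hz hmono m ht0 htz
    have hne := (ne_pole_of_mem_G hmem.1 m).1
    rw [← ht, sol_of_mem_G a φ μ hmem.1, Psi_eq_add_regPrim hε hz hmono a hk0 hn μ φ hmem, hPsi,
      zero_add, expG_eq_regG_mul hε hn _ hne]
    have h1 := regG_ne_zero (ε := ε) (c := c) (z := z) m (-μ ^ 2) (z m - t * I)
    have h2 : (-(z m - t * I - z m)) ^ k ≠ 0 := pow_ne_zero _ (neg_ne_zero.2 (sub_ne_zero.2 hne))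
    have h3 : (z m - t * I - z m) ^ k = (-1) ^ k * (-(z m - t * I - z m)) ^ k := by
      rw [← mul_pow]; ring
    rw [h3]
    simp only [Function.comp_apply]
    generalize (-(z m - t * I - z m)) ^ k = A at h2 ⊢
    field_simp
  · exact h

/-- Nullvectors give solutions analytic in the closed upper half-plane. -/
theorem exists_analytic_of_Gam_eq_zero (hε : 0 < ε) (hz : ∀ p, 0 < (z p).im)
    (hmono : StrictMono fun p => (z p).re) {a : ℝ} {φ : Fin P → ℂ} {μ : ℂ}
    (hμ : 0 < μ.re) (hG : ∀ x : ℝ, (∀ p, x ≠ (z p).re) → Gam ε c z a φ μ x = 0)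
    (hex : ∀ m, Exceptional ε (c m) → Psi ε c z a φ μ (z m) = 0) :
    ∃ F : ℂ → ℂ, AnalyticOnNhd ℂ F {x | 0 ≤ x.im} ∧
      ∀ ζ ∈ G z ∪ GHat z, F ζ = sol ε c z a φ μ ζ := by
  have hopen : IsOpen (G z ∪ GHat z) := isOpen_G.union isOpen_GHat
  -- Punctured limits reproduce `sol` where it is continuous and supply the missing values at the
  -- poles.
  have hF : ∀ ζ ∈ G z ∪ GHat z, limUnder (𝓝[≠] ζ) (sol ε c z a φ μ) = sol ε c z a φ μ ζ :=
    fun ζ hζ => ((hasDerivAt_sol hε hz hμ hG hζ).continuousAt.tendsto.mono_left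
      nhdsWithin_le_nhds).limUnder_eq
  refine ⟨fun ζ => limUnder (𝓝[≠] ζ) (sol ε c z a φ μ), fun ζ hζ => ?_, hF⟩
  by_cases hp : ∃ m, ζ = z m
  · obtain ⟨m, rfl⟩ := hp
    obtain ⟨K, hK, hev⟩ := exists_sol_analytic_at_pole hε hz hmono hμ hG (hex m)
    refine hK.congr ?_
    have h1 : ∀ᶠ ζ in 𝓝[≠] z m, K ζ = limUnder (𝓝[≠] ζ) (sol ε c z a φ μ) := by
      filter_upwards [hev, self_mem_nhdsWithin, nhdsWithin_le_nhds ((isOpen_column m).mem_nhds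
        (pole_mem_column hz hmono m))] with v hv hne hcol
      rw [hF v (column_subset m ⟨hcol, hne⟩), hv]
    rw [eventually_nhdsWithin_iff] at h1
    filter_upwards [h1] with v hv
    by_cases hvm : v = z m
    · rw [hvm]
      refine (Tendsto.limUnder_eq ?_).symm
      exact (hK.continuousAt.tendsto.mono_left nhdsWithin_le_nhds).congr'
        (hev.mono fun _ h => h.symm)
    · exact hv hvm
  · have hmem := mem_union_of_im_nonneg hz hmono hζ (not_exists.1 hp)
    have : AnalyticAt ℂ (sol ε c z a φ μ) ζ := DifferentiableOn.analyticAt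
      (fun v hv => (hasDerivAt_sol hε hz hμ hG hv).differentiableAt.differentiableWithinAt)
      (hopen.mem_nhds hmem)
    refine this.congr ?_
    filter_upwards [hopen.mem_nhds hmem] with v hv
    exact (hF v hv).symm

end BenjaminOno

/-! ### Decay, residues, and the converse implication. -/

namespace BenjaminOno

variable {P : ℕ} {ε : ℝ} {c z : Fin P → ℂ}

theorem hasDerivAt_of_eq_sol (hε : 0 < ε) (hz : ∀ p, 0 < (z p).im) {a : ℝ} {φ : Fin P → ℂ} {μ : ℂ}
    (hμ : 0 < μ.re) (hG : ∀ x : ℝ, (∀ p, x ≠ (z p).re) → Gam ε c z a φ μ x = 0) {F : ℂ → ℂ}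
    (hF : ∀ ζ ∈ G z ∪ GHat z, F ζ = sol ε c z a φ μ ζ) {ζ : ℂ} (hζ : ζ ∈ G z ∪ GHat z) :
    HasDerivAt F (-(I / ε) * rat z φ ζ + I / ε * (-μ ^ 2 + u0 c z ζ) * F ζ) ζ := by
  rw [hF ζ hζ]
  refine (hasDerivAt_sol hε hz hμ hG hζ).congr_of_eventuallyEq ?_
  filter_upwards [(isOpen_G.union isOpen_GHat).mem_nhds hζ] with v hv using hF v hv

/-- Three regions: high up the bound on `V`, far to the sides the bound on `Psi`, and a compact
rectangle where continuity suffices. -/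
theorem exists_norm_le_of_eq_sol (hε : 0 < ε) (hz : ∀ p, 0 < (z p).im) {a : ℝ} {φ : Fin P → ℂ}
    {μ : ℂ} (hμ : 0 < μ.re) (hG : ∀ x : ℝ, (∀ p, x ≠ (z p).re) → Gam ε c z a φ μ x = 0) {F : ℂ → ℂ}
    (hFan : AnalyticOnNhd ℂ F {x | 0 ≤ x.im}) (hF : ∀ ζ ∈ G z ∪ GHat z, F ζ = sol ε c z a φ μ ζ) :
    ∃ C, ∀ ζ : ℂ, 0 ≤ ζ.im → ‖F ζ‖ ≤ C * (1 + ‖ζ‖)⁻¹ := by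
  obtain ⟨T, C₁, hT, hC₁, hV⟩ := exists_norm_V_le (c := c) hε hz φ hμ
  obtain ⟨C₂, hC₂, hPsi⟩ := exists_norm_Psi_le (c := c) hε hz a φ hμ
  have htop := one_le_top hz
  have hwide := one_le_wide z
  have hcpt : IsCompact (Icc (-wide z) (wide z) ×ℂ Icc 0 (top z + T)) :=
    isCompact_Icc.reProdIm isCompact_Icc
  obtain ⟨M, hM⟩ := hcpt.exists_bound_of_continuousOn (f := F) fun ζ hζ =>
    (hFan ζ hζ.2.1).continuousAt.continuousWithinAt
  have hM0 : 0 ≤ M := (norm_nonneg _).trans (hM 0 ⟨by simp; linarith, by simp; linarith⟩)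
  have hbig : ∀ {C x : ℝ}, 0 ≤ C → 1 ≤ x → 1 / ε * (C / x) ≤ 2 * C / ε * (1 + x)⁻¹ := by
    intro C x hC hx
    rw [one_div, inv_mul_eq_div, div_div, ← div_eq_mul_inv, div_div,
      div_le_div_iff₀ (by positivity) (by positivity)]
    nlinarith [mul_nonneg hC hε.le]
  have h2 : 0 ≤ 2 * C₁ / ε := by positivity
  have h3 : 0 ≤ 2 * C₂ / ε := by positivity
  have h4 : 0 ≤ M * (1 + wide z + top z + T) := by positivity
  refine ⟨2 * C₁ / ε + 2 * C₂ / ε + M * (1 + wide z + top z + T), fun ζ hζ => ?_⟩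
  have h1 : 0 ≤ (1 + ‖ζ‖)⁻¹ := by positivity
  have hnorm : ‖-(I / (ε : ℂ))‖ = 1 / ε := by
    rw [norm_neg, norm_div, norm_I, norm_real, Real.norm_of_nonneg hε.le]
  rcases lt_or_ge (top z + T) ζ.im with hi | hi
  · have hζ1 : 1 ≤ ‖ζ‖ := by linarith [le_abs_self ζ.im, abs_im_le_norm ζ]
    have hmem := mem_GHat_of_top_lt hz (ζ := ζ) (by linarith)
    have hE : 0 < ‖expHat ε c z (-μ ^ 2) ζ‖ := norm_pos_iff.2 (expHat_ne_zero _ _)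
    rw [hF ζ (Or.inr hmem), sol_of_mem_GHat hε hz hμ hG hmem,
      PsiHat_eq_neg_V hε hz φ hμ (by linarith), norm_div, norm_mul, norm_neg (V _ _ _ _ _ _), hnorm]
    have h5 : 1 / ε * ‖V ε c z φ μ ζ‖ / ‖expHat ε c z (-μ ^ 2) ζ‖ ≤ 1 / ε * (C₁ / ‖ζ‖) := by
      rw [div_le_iff₀ hE]
      calc _ ≤ 1 / ε * (C₁ * (‖expHat ε c z (-μ ^ 2) ζ‖ / ‖ζ‖)) := by
            gcongr
            exact hV ζ hi
        _ = _ := by ring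
    refine (h5.trans (hbig hC₁ hζ1)).trans (mul_le_mul_of_nonneg_right ?_ h1)
    linarith
  · rcases lt_or_ge (wide z) |ζ.re| with hr | hr
    · have hζ1 : 1 ≤ ‖ζ‖ := by linarith [abs_re_le_norm ζ]
      have hne := re_ne_of_wide hr
      have hmem := mem_G_of_re_ne hne
      have hE : 0 < ‖expG ε c z (-μ ^ 2) ζ‖ := norm_pos_iff.2 (expG_ne_zero _ _)
      rw [hF ζ (Or.inl hmem), sol_of_mem_G a φ μ hmem, norm_div, norm_mul, hnorm]
      have h5 : 1 / ε * ‖Psi ε c z a φ μ ζ‖ / ‖expG ε c z (-μ ^ 2) ζ‖ ≤ 1 / ε * (C₂ / ‖ζ‖) := by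
        rw [div_le_iff₀ hE]
        calc _ ≤ 1 / ε * (C₂ * (‖expG ε c z (-μ ^ 2) ζ‖ / ‖ζ‖)) := by
              gcongr
              exact hPsi ζ hζ hr (hG _ hne)
          _ = _ := by ring
      refine (h5.trans (hbig hC₂ hζ1)).trans (mul_le_mul_of_nonneg_right ?_ h1)
      linarith
    · have h5 : ‖ζ‖ ≤ wide z + (top z + T) := by
        refine (norm_le_abs_re_add_abs_im ζ).trans (add_le_add hr ?_)
        rwa [abs_of_nonneg hζ]
      have h6 : M ≤ M * (1 + wide z + top z + T) * (1 + ‖ζ‖)⁻¹ := by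
        rw [mul_assoc]
        refine le_mul_of_one_le_right hM0 ?_
        rw [← div_eq_mul_inv, one_le_div (by positivity)]
        linarith
      refine ((hM ζ ⟨abs_le.1 hr, hζ, hi⟩).trans h6).trans (mul_le_mul_of_nonneg_right ?_ h1)
      linarith

/-- A solution that is analytic at a pole determines the residue there. -/
theorem residue_eq_of_ode (hz : ∀ p, 0 < (z p).im) (hmono : StrictMono fun p => (z p).re)
    {l : ℂ} {φ : Fin P → ℂ} {F : ℂ → ℂ} {m : Fin P} (hF : AnalyticAt ℂ F (z m))
    (hode : ∃ᶠ ζ in 𝓝[≠] z m, I * ε * deriv F ζ + (l + u0 c z ζ) * F ζ = rat z φ ζ) :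
    φ m = c m * F (z m) := by
  have hzm := pole_mem_column hz hmono m
  -- The equation multiplied by `ζ - z m` is continuous at `z m`, with value `c m * F (z m) - φ m`
  -- there.
  have hcont : ContinuousAt (fun ζ => (ζ - z m) * (I * ε * deriv F ζ + l * F ζ) +
      resU c z m ζ * F ζ - resR z φ m ζ) (z m) := by
    have h1 := continuousAt_resU (c := c) hz m hzm
    have h2 := continuousAt_resR φ m hzm
    have h3 := hF.continuousAt
    have h4 := hF.deriv.continuousAt
    fun_prop
  by_contra hne
  have h0 : (z m - z m) * (I * ε * deriv F (z m) + l * F (z m)) +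
      resU c z m (z m) * F (z m) - resR z φ m (z m) ≠ 0 := by
    simp only [resU, resR, sub_self, zero_mul, zero_add, add_zero]
    exact fun h => hne (sub_eq_zero.1 h).symm
  have hev := (hcont.eventually_ne h0).filter_mono (nhdsWithin_le_nhds (s := {z m}ᶜ))
  obtain ⟨ζ, h1, h2, h3⟩ := (hode.and_eventually (hev.and self_mem_nhdsWithin)).exists
  apply h2
  have h3' : ζ ≠ z m := h3
  rw [← mul_u0_eq m h3', ← mul_rat_eq φ m h3', ← h1]
  ring

theorem ode_of_hasDerivAt (hε : 0 < ε) {l u r F F' : ℂ}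
    (h : F' = -(I / ε) * r + I / ε * (l + u) * F) : I * ε * F' + (l + u) * F = r := by
  have hε' : (ε : ℂ) ≠ 0 := ofReal_ne_zero.2 hε.ne'
  rw [h]
  field_simp
  linear_combination (-r + (l + u) * F) * I_sq

/-- A solution that extends analytically to the upper half-plane has vanishing contour integrals. -/
theorem row_eq_zero_of_ext (hε : 0 < ε) (hz : ∀ p, 0 < (z p).im)
    (hmono : StrictMono fun p => (z p).re) {a : ℝ} (ha : ∀ p, a < (z p).re)
    {b : Fin P → ℝ} (hb : ∀ m, (z m).re < b m ∧ ∀ p, m < p → b m < (z p).re) {φ : Fin P → ℂ} {μ : ℂ}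
    (hμ : 0 < μ.re) {F : ℂ → ℂ} (hF : DifferentiableOn ℂ F {ζ | 0 < ζ.im})
    (hPsi : ∀ ζ ∈ G z, 0 < ζ.im → Psi ε c z a φ μ ζ = I * ε * expG ε c z (-μ ^ 2) ζ * F ζ)
    (m : Fin P) : row ε c z a b φ μ m = 0 := by
  rw [row]
  split_ifs with hex
  -- On the approach from below `Psi` tends to `Psi (z m)`, while `expG * F` tends to zero because
  -- `expG` has a zero of order `n` and `F` is continuous.
  · obtain ⟨n, hn0, hn⟩ := hex
    have hzm := pole_mem_column hz hmono m
    have hpath := tendsto_pole_path (z m)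
    have hc1 : ContinuousAt (fun ζ => Psi ε c z a φ μ (z m) + regPrim ε c z m n (-μ ^ 2) φ ζ)
        (z m) := (hasDerivAt_regPrim hz hmono m n (-μ ^ 2) φ hzm).continuousAt.const_add _
    have hc2 : ContinuousAt (fun ζ => I * ε * (regG ε c z m (-μ ^ 2) ζ * (-(ζ - z m)) ^ n) * F ζ)
        (z m) := by
      have h1 := (differentiableAt_regG (ε := ε) (c := c) hz (-μ ^ 2) hzm).continuousAt
      have h2 := (hF.differentiableAt ((isOpen_upperHalfPlane 0).mem_nhds (hz m))).continuousAt
      fun_prop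
    have hl1 := (hc1.tendsto.mono_left nhdsWithin_le_nhds).comp hpath
    have hl2 := (hc2.tendsto.mono_left nhdsWithin_le_nhds).comp hpath
    rw [regPrim_pole, add_zero] at hl1
    rw [sub_self, neg_zero, zero_pow hn0.ne', mul_zero, mul_zero, zero_mul] at hl2
    refine tendsto_nhds_unique_of_eventuallyEq hl1 hl2 ?_
    filter_upwards [self_mem_nhdsWithin, nhdsWithin_le_nhds (gt_mem_nhds (hz m))] with t ht htz
    have hmem := pole_path_mem hz hmono m ht htz
    simp only [Function.comp_apply]
    rw [← Psi_eq_add_regPrim hε hz hmono a hn0 hn μ φ hmem, hPsi _ hmem.1 hmem.2.1,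
      expG_eq_regG_mul hε hn _ (ne_pole_of_mem_G hmem.1 m).1]
  · have htop := one_le_top hz
    have hne : ∀ p, b m ≠ (z p).re := fun p => by
      rcases le_or_gt p m with h | h
      · exact ((hmono.monotone h).trans_lt (hb m).1).ne'
      · exact ((hb m).2 p h).ne
    -- `D` is holomorphic in the entire half-plane above the poles, across all gaps, and vanishes in
    -- the leftmost one. By the identity theorem it vanishes everywhere, and over `b m` it is `Gam`
    -- up to the factor `ratioG`.
    set D : ℂ → ℂ := fun ζ => I * ε * expHat ε c z (-μ ^ 2) ζ * F ζ + V ε c z φ μ ζ with hD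
    have hDd : DifferentiableOn ℂ D {ζ | top z < ζ.im} := fun ζ (hζ : top z < ζ.im) => by
      have h1 := (hasDerivAt_expHat (ε := ε) (c := c) hz (-μ ^ 2)
        (mem_GHat_of_top_lt hz hζ)).differentiableAt
      have h2 := hF.differentiableAt ((isOpen_upperHalfPlane 0).mem_nhds
        (show 0 < ζ.im by linarith))
      have h3 := (hasDerivAt_V (c := c) hε hz φ hμ hζ).differentiableAt
      exact DifferentiableAt.differentiableWithinAt (by fun_prop)
    have hω : (a + (top z + 1 : ℝ) * I : ℂ) ∈ {ζ : ℂ | top z < ζ.im} := by simp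
    have hDev : D =ᶠ[𝓝 (a + (top z + 1 : ℝ) * I : ℂ)] 0 := by
      have h1 : ∀ᶠ ζ : ℂ in 𝓝 (a + (top z + 1 : ℝ) * I : ℂ), ∀ p, ζ.re < (z p).re :=
        eventually_all.2 fun p => (isOpen_lt continuous_re continuous_const).mem_nhds
          (by simpa using ha p)
      filter_upwards [h1, (isOpen_upperHalfPlane (top z)).mem_nhds hω] with ζ h2 h3
      have h3' : top z < ζ.im := h3
      have h4 : ∀ p, ζ.re ≠ (z p).re := fun p => (h2 p).ne
      have h5 := hPsi ζ (mem_G_of_re_ne h4) (by linarith)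
      rw [Psi_eq_left hε hz ha φ hμ h3 h2, expG_eq _ h4] at h5
      have h6 : ratioG ε c z ζ.re * D ζ = 0 := by
        rw [hD]
        linear_combination -h5
      simpa [ratioG_ne_zero] using h6
    have hD0 := (hDd.analyticOnNhd (isOpen_upperHalfPlane _)).eqOn_zero_of_preconnected_of_eventuallyEq_zero
      (convex_im_gt _).isPreconnected hω hDev
    have h7 := hD0 (show (b m + (top z + 1 : ℝ) * I : ℂ) ∈ {ζ : ℂ | top z < ζ.im} by simp)
    have hre : (b m + (top z + 1 : ℝ) * I : ℂ).re = b m := by simp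
    rw [Gam, hPsi _ (mem_G_of_re_ne fun p => by rw [hre]; exact hne p) (by simp; linarith),
      expG_eq _ fun p => by rw [hre]; exact hne p, hre]
    simp only [hD, Pi.zero_apply] at h7
    linear_combination ratioG ε c z (b m) * h7

end BenjaminOno

/-! ### The matrix as an analytic function of `μ`. -/

namespace BenjaminOno

variable {P : ℕ} {ε : ℝ} {c z : Fin P → ℂ}

theorem rat_add (φ ψ : Fin P → ℂ) (ζ : ℂ) : rat z (φ + ψ) ζ = rat z φ ζ + rat z ψ ζ := by
  simp [rat, add_div, Finset.sum_add_distrib]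

theorem rat_smul (k : ℂ) (φ : Fin P → ℂ) (ζ : ℂ) : rat z (k • φ) ζ = k * rat z φ ζ := by
  simp [rat, mul_div_assoc, Finset.mul_sum]

theorem rat_single (p : Fin P) (ζ : ℂ) : rat z (Pi.single p 1) ζ = 1 / (ζ - z p) := by
  simp [rat, Pi.single_apply, ite_div]

theorem rat_zero (ζ : ℂ) : rat z 0 ζ = 0 := by simp [rat]

theorem V_add (hε : 0 < ε) (hz : ∀ p, 0 < (z p).im) (φ ψ : Fin P → ℂ) {μ ζ : ℂ}
    (hμ : 0 < μ.re) (hζ : top z < ζ.im) :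
    V ε c z (φ + ψ) μ ζ = V ε c z φ μ ζ + V ε c z ψ μ ζ := by
  rw [V, V, V, ← integral_add (integrableOn_ray hε hz φ hμ hζ) (integrableOn_ray hε hz ψ hμ hζ)]
  simp only [rat_add, mul_add, add_mul]

theorem V_smul (k : ℂ) (φ : Fin P → ℂ) (μ ζ : ℂ) :
    V ε c z (k • φ) μ ζ = k * V ε c z φ μ ζ := by
  rw [V, V, ← integral_const_mul]
  simp only [rat_smul]
  congr 1
  ext s
  ring

/-- The vertical segment from the real axis to `ζ` carries an integrable integrand. -/
def VerticalIntegrable (ε : ℝ) (c z : Fin P → ℂ) (ζ : ℂ) : Prop :=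
  ∀ (l : ℂ) (φ : Fin P → ℂ), IntervalIntegrable (fun s : ℝ => expG ε c z l (ζ.re + s * I) *
    rat z φ (ζ.re + s * I)) volume 0 ζ.im

theorem verticalIntegrable_of_mem_G (hz : ∀ p, 0 < (z p).im) {ζ : ℂ} (hζ : ζ ∈ G z) :
    VerticalIntegrable ε c z ζ := fun l φ =>
  (isComb_G hz).vertical_intervalIntegrable
    (differentiableOn_expG_mul_rat (ε := ε) (c := c) l φ).continuousOn hζ

theorem verticalIntegrable_of_exceptional (hε : 0 < ε) (hz : ∀ p, 0 < (z p).im)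
    (hmono : StrictMono fun p => (z p).re) {m : Fin P} (hex : Exceptional ε (c m)) :
    VerticalIntegrable ε c z (z m) := fun l φ => by
  obtain ⟨n, hn0, hn⟩ := hex
  obtain ⟨h1, h2, -⟩ := vertical_integrable_pole (c := c) hε hz hmono hn0 hn l φ (half_pos (hz m))
    (half_lt_self (hz m))
  exact h1.trans h2

theorem horizontalIntegrable (hz : ∀ p, 0 < (z p).im) (l : ℂ) (φ : Fin P → ℂ) (x y : ℝ) :
    IntervalIntegrable (fun t : ℝ => expG ε c z l t * rat z φ t) volume x y := by
  simpa using (isComb_G hz).horizontal_intervalIntegrable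
    (differentiableOn_expG_mul_rat (ε := ε) (c := c) l φ).continuousOn (mem_univ x) (mem_univ y)

theorem verticalIntegrable_line (hz : ∀ p, 0 < (z p).im) {x : ℝ} (hx : ∀ p, x ≠ (z p).re)
    (l : ℂ) (φ : Fin P → ℂ) (y : ℝ) :
    IntervalIntegrable (fun s : ℝ => expG ε c z l (x + s * I) * rat z φ (x + s * I)) volume 0 y := by
  simpa using verticalIntegrable_of_mem_G (ε := ε) (c := c) hz (ζ := x + y * I)
    (mem_G_of_re_ne fun p => by simpa using hx p) l φ

theorem Psi_add (hε : 0 < ε) (hz : ∀ p, 0 < (z p).im) {a : ℝ} (ha : ∀ p, a < (z p).re)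
    (φ ψ : Fin P → ℂ) {μ ζ : ℂ} (hμ : 0 < μ.re) (hζ : VerticalIntegrable ε c z ζ) :
    Psi ε c z a (φ + ψ) μ ζ = Psi ε c z a φ μ ζ + Psi ε c z a ψ μ ζ := by
  have h1 := fun φ => verticalIntegrable_line (ε := ε) (c := c) hz (fun p => (ha p).ne) (-μ ^ 2) φ
    (top z + 1)
  have h2 := fun φ => horizontalIntegrable (ε := ε) (c := c) hz (-μ ^ 2) φ a ζ.re
  have h3 := hζ (-μ ^ 2)
  rw [Psi, Psi, Psi, V_add hε hz φ ψ hμ (by simp)]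
  simp only [rat_add, mul_add, add_mul]
  rw [intervalIntegral.integral_add ((h1 φ).mul_const I) ((h1 ψ).mul_const I),
    intervalIntegral.integral_add (h2 φ) (h2 ψ),
    intervalIntegral.integral_add ((h3 φ).mul_const I) ((h3 ψ).mul_const I)]
  ring

theorem Psi_smul (a : ℝ) (k : ℂ) (φ : Fin P → ℂ) (μ ζ : ℂ) :
    Psi ε c z a (k • φ) μ ζ = k * Psi ε c z a φ μ ζ := by
  have e : ∀ u v : ℂ, u * (k * v) = k * (u * v) := fun u v => by ring
  rw [Psi, Psi, V_smul]
  simp only [rat_smul, e, mul_assoc k, intervalIntegral.integral_const_mul]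
  ring

theorem gap_re_ne (hmono : StrictMono fun p => (z p).re) {b : Fin P → ℝ}
    (hb : ∀ m, (z m).re < b m ∧ ∀ p, m < p → b m < (z p).re) (m p : Fin P) : b m ≠ (z p).re := by
  rcases le_or_gt p m with h | h
  · exact ((hmono.monotone h).trans_lt (hb m).1).ne'
  · exact ((hb m).2 p h).ne

/-- The contour integrals as linear functionals of the coefficients. -/
noncomputable def rowMap (hε : 0 < ε) (hz : ∀ p, 0 < (z p).im)
    (hmono : StrictMono fun p => (z p).re) {a : ℝ} (ha : ∀ p, a < (z p).re)
    {b : Fin P → ℝ} (hb : ∀ m, (z m).re < b m ∧ ∀ p, m < p → b m < (z p).re) {μ : ℂ}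
    (hμ : 0 < μ.re) (m : Fin P) : (Fin P → ℂ) →ₗ[ℂ] ℂ where
  toFun φ := row ε c z a b φ μ m
  map_add' φ ψ := by
    have hre : ∀ p, (b m + (top z + 1 : ℝ) * I : ℂ).re ≠ (z p).re := fun p => by
      simpa using gap_re_ne hmono hb m p
    unfold row
    split_ifs with hex
    · exact Psi_add hε hz ha φ ψ hμ (verticalIntegrable_of_exceptional hε hz hmono hex)
    · rw [Gam, Gam, Gam, V_add hε hz φ ψ hμ (by simp), Psi_add hε hz ha φ ψ hμ
        (verticalIntegrable_of_mem_G hz (mem_G_of_re_ne hre))]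
      ring
  map_smul' k φ := by
    unfold row
    split_ifs with hex
    · exact Psi_smul a k φ μ _
    · rw [Gam, Gam, V_smul, Psi_smul, RingHom.id_apply, smul_eq_mul]
      ring

/-- The matrix of the contour integrals, as a function of `μ`. -/
noncomputable def evansMatrix (ε : ℝ) (c z : Fin P → ℂ) (a : ℝ) (b : Fin P → ℝ) (μ : ℂ) :
    Matrix (Fin P) (Fin P) ℂ := Matrix.of fun m p => row ε c z a b (Pi.single p 1) μ m

theorem evansMatrix_mulVec (hε : 0 < ε) (hz : ∀ p, 0 < (z p).im)
    (hmono : StrictMono fun p => (z p).re) {a : ℝ} (ha : ∀ p, a < (z p).re)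
    {b : Fin P → ℝ} (hb : ∀ m, (z m).re < b m ∧ ∀ p, m < p → b m < (z p).re) {μ : ℂ}
    (hμ : 0 < μ.re) (φ : Fin P → ℂ) (m : Fin P) :
    (evansMatrix ε c z a b μ).mulVec φ m = row ε c z a b φ μ m := by
  have h := LinearMap.pi_apply_eq_sum_univ (rowMap (c := c) hε hz hmono ha hb hμ m) φ
  have h' : rowMap (c := c) hε hz hmono ha hb hμ m φ = row ε c z a b φ μ m := rfl
  rw [← h', h, Matrix.mulVec, dotProduct]
  refine Finset.sum_congr rfl fun p _ => ?_
  rw [smul_eq_mul, mul_comm, evansMatrix, Matrix.of_apply]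
  congr 1
  change row ε c z a b _ μ m = row ε c z a b _ μ m
  congr 1
  ext q
  simp [Pi.single_apply, eq_comm]

/-- Over a finite path the parameter enters only through the entire factor `exp (i μ² γ/ε)`, so
integrability of the remaining factor is enough. -/
theorem differentiable_integral_exp (ε : ℝ) {γ : ℝ → ℂ} (hγ : Continuous γ) {g : ℝ → ℂ} {x y : ℝ}
    (hg : IntervalIntegrable g volume x y) :
    Differentiable ℂ fun μ : ℂ => ∫ s in x..y, Complex.exp (I * μ ^ 2 * γ s / ε) * g s := by
  obtain ⟨B, hB⟩ := (isCompact_uIcc (a := x) (b := y)).exists_bound_of_continuousOn hγ.continuousOn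
  have hint : IntegrableOn g (uIoc x y) := intervalIntegrable_iff.1 hg
  have hmeas : ∀ μ : ℂ, AEStronglyMeasurable (fun s => Complex.exp (I * μ ^ 2 * γ s / ε) * g s)
      (volume.restrict (uIoc x y)) := fun μ =>
    (Continuous.aestronglyMeasurable (by fun_prop)).mul hint.1
  have key : ∀ μ : ℂ, DifferentiableAt ℂ
      (fun μ : ℂ => ∫ s in uIoc x y, Complex.exp (I * μ ^ 2 * γ s / ε) * g s) μ := fun μ =>
    (hasDerivAt_integral_of_locally_dominated (m := volume.restrict (uIoc x y)) isOpen_univ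
      (F := fun μ s => Complex.exp (I * μ ^ 2 * γ s / ε) * g s)
      (Eventually.of_forall fun s => by fun_prop) (fun μ _ => hmeas μ) (fun μ _ => by
        refine ⟨1, one_pos, fun s => Real.exp ((‖μ‖ + 1) ^ 2 * B / |ε|) * ‖g s‖,
          hint.norm.const_mul _, ?_⟩
        filter_upwards [ae_restrict_mem measurableSet_uIoc] with s hs v hv
        rw [Metric.mem_ball, dist_eq_norm] at hv
        rw [norm_mul, norm_exp]
        refine mul_le_mul_of_nonneg_right (Real.exp_le_exp.2 ((re_le_norm _).trans ?_))
          (norm_nonneg _)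
        rw [norm_div, norm_mul, norm_mul, norm_I, one_mul, norm_pow, norm_real, Real.norm_eq_abs]
        have h1 : ‖v‖ ≤ ‖μ‖ + 1 := by
          have := norm_add_le (v - μ) μ
          rw [sub_add_cancel] at this
          linarith
        have h2 := hB s (uIoc_subset_uIcc hs)
        gcongr) (w := μ) (mem_univ μ)).2.differentiableAt
  intro μ
  simp only [intervalIntegral.intervalIntegral_eq_integral_uIoc]
  exact (key μ).const_smul _

theorem expG_sq (μ ζ : ℂ) :
    expG ε c z (-μ ^ 2) ζ = Complex.exp (I * μ ^ 2 * ζ / ε) * expG ε c z 0 ζ := by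
  rw [expG, expG, ← Complex.exp_add]
  ring_nf

theorem differentiableAt_Psi_param (hε : 0 < ε) (hz : ∀ p, 0 < (z p).im) {a : ℝ}
    (ha : ∀ p, a < (z p).re) (φ : Fin P → ℂ) {μ ζ : ℂ} (hμ : 0 < μ.re)
    (hζ : VerticalIntegrable ε c z ζ) :
    DifferentiableAt ℂ (fun μ => Psi ε c z a φ μ ζ) μ := by
  have h1 := differentiable_integral_exp ε (γ := fun s : ℝ => a + s * I) (by fun_prop)
    ((verticalIntegrable_line (ε := ε) (c := c) hz (fun p => (ha p).ne) 0 φ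
    (top z + 1)).mul_const I) μ
  have h2 := differentiable_integral_exp ε (γ := fun t : ℝ => t) (by fun_prop)
    (horizontalIntegrable (ε := ε) (c := c) hz 0 φ a ζ.re) μ
  have h3 := differentiable_integral_exp ε (γ := fun s : ℝ => ζ.re + s * I) (by fun_prop)
    ((hζ 0 φ).mul_const I) μ
  have h4 := differentiableAt_V_param (ε := ε) (c := c) hε hz φ (μ := μ)
    (ζ := a + (top z + 1 : ℝ) * I) hμ (by simp)
  unfold Psi
  simp only [expG_sq, mul_assoc] at h1 h2 h3 ⊢
  fun_prop

theorem differentiableAt_row (hε : 0 < ε) (hz : ∀ p, 0 < (z p).im)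
    (hmono : StrictMono fun p => (z p).re) {a : ℝ} (ha : ∀ p, a < (z p).re)
    {b : Fin P → ℝ} (hb : ∀ m, (z m).re < b m ∧ ∀ p, m < p → b m < (z p).re) {μ : ℂ}
    (hμ : 0 < μ.re) (φ : Fin P → ℂ) (m : Fin P) :
    DifferentiableAt ℂ (fun μ => row ε c z a b φ μ m) μ := by
  unfold row
  split_ifs with hex
  · exact differentiableAt_Psi_param hε hz ha φ hμ
      (verticalIntegrable_of_exceptional hε hz hmono hex)
  · have hre : ∀ p, (b m + (top z + 1 : ℝ) * I : ℂ).re ≠ (z p).re := fun p => by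
      simpa using gap_re_ne hmono hb m p
    exact (differentiableAt_Psi_param hε hz ha φ hμ
      (verticalIntegrable_of_mem_G hz (mem_G_of_re_ne hre))).add
      ((differentiableAt_V_param hε hz φ hμ (by simp)).const_mul _)

theorem differentiableAt_det_evansMatrix (hε : 0 < ε) (hz : ∀ p, 0 < (z p).im)
    (hmono : StrictMono fun p => (z p).re) {a : ℝ} (ha : ∀ p, a < (z p).re)
    {b : Fin P → ℝ} (hb : ∀ m, (z m).re < b m ∧ ∀ p, m < p → b m < (z p).re) {μ : ℂ}
    (hμ : 0 < μ.re) : DifferentiableAt ℂ (fun μ => (evansMatrix ε c z a b μ).det) μ := by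
  simp only [Matrix.det_apply, evansMatrix, Matrix.of_apply]
  refine DifferentiableAt.fun_sum fun σ _ => DifferentiableAt.const_smul ?_ _
  exact DifferentiableAt.fun_finsetProd fun p _ => differentiableAt_row hε hz hmono ha hb hμ _ _

/-- For negative real `l` the vertical ray integral can be split at height `top z + 1`. -/
theorem rayIntegral_eq (hε : 0 < ε) (hz : ∀ p, 0 < (z p).im) {x : ℝ} (hx : ∀ p, x ≠ (z p).re)
    (φ : Fin P → ℂ) {r : ℝ} (hr : 0 < r) :
    rayIntegral (fun ζ => expG ε c z (-(r : ℂ) ^ 2) ζ * rat z φ ζ) x =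
      (∫ s in (0 : ℝ)..(top z + 1),
        expG ε c z (-(r : ℂ) ^ 2) (x + s * I) * rat z φ (x + s * I) * I) +
      ratioG ε c z x * V ε c z φ r (x + (top z + 1 : ℝ) * I) := by
  have htop := one_le_top hz
  set Y := top z + 1 with hY
  set k : ℝ → ℂ := fun s => expHat ε c z (-(r : ℂ) ^ 2) (x + s * I) * rat z φ (x + s * I) * I
    with hk
  have hr0 : (r : ℂ) ≠ 0 := ofReal_ne_zero.2 hr.ne'
  have hre : ∀ s : ℝ, (x + s * I : ℂ).re = x := fun s => by simp
  -- For real `μ = r` the ray is vertical, and the substitution `s ↦ s/r + Y` turns it into the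
  -- half-line above height `Y`.
  have e1 : ∀ s : ℝ, expHat ε c z (-(r : ℂ) ^ 2) (x + Y * I + I / r * s) *
      rat z φ (x + Y * I + I / r * s) * (I / r) = (r : ℂ)⁻¹ * k (r⁻¹ * s + Y) := fun s => by
    have : (x + Y * I + I / r * s : ℂ) = x + (r⁻¹ * s + Y : ℝ) * I := by
      push_cast
      field_simp
      ring
    rw [this, hk]
    field_simp
  have hint := integrableOn_ray (c := c) hε hz φ (μ := r) (ζ := x + Y * I) (by simpa using hr)
    (by simp [hY])
  simp only [e1] at hint
  have hint2 : IntegrableOn (fun s : ℝ => k (r⁻¹ * s + Y)) (Ioi 0) := by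
    have := hint.const_mul (r : ℂ)
    refine IntegrableOn.congr_fun this (fun s _ => ?_) measurableSet_Ioi
    simp only [mul_inv_cancel_left₀ hr0]
  have hint3 : IntegrableOn (fun s : ℝ => k (s + Y)) (Ioi 0) := by
    have := (integrableOn_Ioi_comp_mul_left_iff (fun s => k (s + Y)) 0 (inv_pos.2 hr)).1 hint2
    simpa using this
  have hint4 : IntegrableOn k (Ioi Y) := by
    have := (measurePreserving_add_right volume Y).integrableOn_comp_preimage
      (Homeomorph.addRight Y).measurableEmbedding (f := k) (s := Ioi Y)
    refine this.1 ?_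
    simpa [Function.comp_def] using hint3
  have hV : V ε c z φ r (x + Y * I) = ∫ s in Ioi Y, k s := by
    rw [V]
    simp only [e1]
    rw [integral_const_mul, integral_comp_mul_left_Ioi (fun s => k (s + Y)) 0 (inv_pos.2 hr),
      mul_zero, inv_inv, real_smul, inv_mul_cancel_left₀ hr0]
    have := (measurePreserving_add_right volume Y).setIntegral_preimage_emb
      (Homeomorph.addRight Y).measurableEmbedding k (Ioi Y)
    simpa using this
  have hk2 : ∀ s : ℝ, expG ε c z (-(r : ℂ) ^ 2) (x + s * I) * rat z φ (x + s * I) * I =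
      ratioG ε c z x * k s := fun s => by
    rw [expG_eq _ fun p => by rw [hre]; exact hx p, hre, hk]
    ring
  rw [rayIntegral, hV, ← integral_const_mul]
  simp only [hk2]
  refine (intervalIntegral.integral_interval_add_Ioi ?_ (hint4.const_mul _)).symm
  have h5 := ((verticalIntegrable_line (ε := ε) (c := c) hz hx (-(r : ℂ) ^ 2) φ Y).mul_const I)
  simp only [hk2] at h5
  have h6 : IntegrableOn (fun s => ratioG ε c z x * k s) (Ioc 0 Y) :=
    (intervalIntegrable_iff_integrableOn_Ioc_of_le (by linarith)).1 h5
  have := h6.union (hint4.const_mul (ratioG ε c z x))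
  rwa [Ioc_union_Ioi_eq_Ioi (by linarith)] at this

/-- Splitting the vertical rays at height `top z + 1` turns the contour integrals into `Psi` and
`Gam`. The matrix in `μ` is thus the analytic continuation of `A`. -/
theorem A_eq_evansMatrix (hε : 0 < ε) (hz : ∀ p, 0 < (z p).im)
    (hmono : StrictMono fun p => (z p).re) {a : ℝ} (ha : ∀ p, a < (z p).re)
    {b : Fin P → ℝ} (hb : ∀ m, (z m).re < b m ∧ ∀ p, m < p → b m < (z p).re) {r : ℝ} (hr : 0 < r) :
    A ε c z a b (-r ^ 2) = evansMatrix ε c z a b r := by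
  ext m p
  have hg : (fun ζ => Complex.exp (-I * h c z (-r ^ 2) ζ / ε) / (ζ - z p)) =
      fun ζ => expG ε c z (-(r : ℂ) ^ 2) ζ * rat z (Pi.single p 1) ζ := by
    ext ζ
    rw [rat_single, expG, h]
    push_cast
    ring
  simp only [A, evansMatrix, Matrix.of_apply, row, hg]
  split_ifs with hex
  · rw [integralEll, rayIntegral_eq hε hz (fun p => (ha p).ne) _ hr, Psi]
    ring
  · rw [integralU, rayIntegral_eq hε hz (fun p => (ha p).ne) _ hr,
      rayIntegral_eq hε hz (gap_re_ne hmono hb m) _ hr, Gam, Psi]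
    simp only [add_re, ofReal_re, mul_re, I_re, mul_zero, ofReal_im, I_im, mul_one, sub_self,
      add_zero, add_im, mul_im, zero_add]
    ring

end BenjaminOno

/-! ### Eigenvalues, nullvectors and uniqueness. -/

/-- Cauchy–Schwarz in Cauchy's formula. Boundedness high up is enough against the exponential decay
of `expHat` along the rays. -/
theorem IsHardyPair.exists_norm_le {W : ℂ → ℂ} {w : ℝ → ℂ} (hW : IsHardyPair W w) :
    ∃ C, ∀ ζ : ℂ, 1 ≤ ζ.im → ‖W ζ‖ ≤ C := by
  refine ⟨(eLpNorm w 2 volume * ENNReal.ofReal (√Real.pi)).toReal / (2 * Real.pi),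
    fun ζ hζ => ?_⟩
  have h0 : 0 < ζ.im := by linarith
  have h1 := hW.integral_mul_inv h0
  have h2 : ‖∫ x : ℝ, w x * (x - ζ : ℂ)⁻¹‖ₑ ≤ eLpNorm w 2 volume * ENNReal.ofReal (√Real.pi) := by
    refine (enorm_integral_le_lintegral_enorm _).trans ((lintegral_mul_le_eLpNorm hW.memLp.1
      (memLp_inv_sub h0.ne').1).trans ?_)
    rw [eLpNorm_inv_sub h0.ne', abs_of_pos h0]
    gcongr
    exact div_le_self Real.pi_pos.le hζ
  have h3 := ENNReal.toReal_mono (ENNReal.mul_ne_top hW.memLp.2.ne ENNReal.ofReal_ne_top) h2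
  rw [toReal_enorm, h1, norm_mul, norm_mul, norm_mul, norm_I, norm_real, norm_ofNat, mul_one,
    Real.norm_of_nonneg Real.pi_pos.le] at h3
  rw [le_div_iff₀ (by positivity)]
  linarith

/-- A function that is analytic in the closed upper half-plane and vanishes on the real line is
zero. -/
theorem eq_zero_of_real_eq_zero {F : ℂ → ℂ} (hF : AnalyticOnNhd ℂ F {x | 0 ≤ x.im})
    (h : ∀ x : ℝ, F x = 0) {ζ : ℂ} (hζ : 0 ≤ ζ.im) : F ζ = 0 := by
  have hconv : Convex ℝ {x : ℂ | 0 ≤ x.im} := by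
    exact (convex_Ici 0).linear_preimage imLm
  refine hF.eqOn_zero_of_preconnected_of_frequently_eq_zero hconv.isPreconnected
    (z₀ := ((0 : ℝ) : ℂ)) (by simp) ?_ hζ
  have ht : Tendsto (fun t : ℝ => (t : ℂ)) (𝓝[≠] 0) (𝓝[≠] ((0 : ℝ) : ℂ)) := by
    refine tendsto_nhdsWithin_iff.2 ⟨(continuous_ofReal.tendsto 0).mono_left nhdsWithin_le_nhds, ?_⟩
    filter_upwards [self_mem_nhdsWithin] with t ht
    simpa using ht
  exact ht.frequently (Frequently.of_forall fun t => h t)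

namespace BenjaminOno

variable {P : ℕ} {ε : ℝ} {c z : Fin P → ℂ}

theorem Psi_zero (a : ℝ) (μ ζ : ℂ) : Psi ε c z a 0 μ ζ = 0 := by simp [Psi, V, rat_zero]

theorem exists_pos_lt_im (hz : ∀ p, 0 < (z p).im) : ∃ y : ℝ, 0 < y ∧ ∀ p, y < (z p).im := by
  have : ∀ᶠ y in 𝓝[>] (0 : ℝ), ∀ p, y < (z p).im :=
    eventually_all.2 fun p => nhdsWithin_le_nhds (gt_mem_nhds (hz p))
  obtain ⟨y, h1, h2⟩ := (this.and self_mem_nhdsWithin).exists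
  exact ⟨y, h2, h1⟩

theorem isComb_G_upper {y₀ : ℝ} (h0 : 0 < y₀) (hy : ∀ p, y₀ < (z p).im) :
    IsComb (G z ∩ {ζ | 0 < ζ.im}) univ y₀ where
  isOpen := isOpen_G.inter (isOpen_upperHalfPlane 0)
  ordConnected := ordConnected_univ
  base := fun t _ => ⟨fun p hp => by
    have := hp.2
    simp [abs_of_pos h0] at this
    linarith [hy p], by simpa using h0⟩
  re_mem := fun _ _ => mem_univ _
  vert := fun ζ hζ s hs => by
    have hs1 : min y₀ ζ.im ≤ s := hs.1
    have hs0 : 0 < s := (lt_min h0 hζ.2).trans_le hs1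
    refine ⟨fun p hp => ?_, by simpa using hs0⟩
    have h1 : ζ.re = (z p).re := by simpa using hp.1
    have h2 : (z p).im ≤ s := by simpa [abs_of_pos hs0] using hp.2
    have h3 : ζ.im < (z p).im := (le_abs_self _).trans_lt (not_le.1 fun h' => hζ.1 p ⟨h1, h'⟩)
    have h4 : s ≤ max y₀ ζ.im := hs.2
    have h5 : max y₀ ζ.im < (z p).im := max_lt (hy p) h3
    linarith

/-- For a solution that is bounded high up, `V` is its product with `expHat`. -/
theorem V_eq_of_bounded_solution (hε : 0 < ε) (hz : ∀ p, 0 < (z p).im) {φ : Fin P → ℂ} {μ : ℂ}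
    (hμ : 0 < μ.re) {W : ℂ → ℂ} (hW : DifferentiableOn ℂ W {ζ | 0 < ζ.im}) {B : ℝ}
    (hB : ∀ ζ : ℂ, 1 ≤ ζ.im → ‖W ζ‖ ≤ B)
    (hode : ∀ ζ : ℂ, 0 < ζ.im → (∀ p, ζ ≠ z p) →
      I * ε * deriv W ζ + (-μ ^ 2 + u0 c z ζ) * W ζ = rat z φ ζ) {ζ : ℂ} (hζ : top z < ζ.im) :
    V ε c z φ μ ζ = -(I * ε * expHat ε c z (-μ ^ 2) ζ * W ζ) := by
  have htop := one_le_top hz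
  have hε' : (ε : ℂ) ≠ 0 := ofReal_ne_zero.2 hε.ne'
  obtain ⟨T₁, hT₁, hE⟩ := exists_expHat_ray_le (c := c) hε hz hμ
  obtain ⟨T₂, C, hT₂, hC, hV⟩ := exists_norm_V_le (c := c) hε hz φ hμ
  -- By the equation `D` is constant above the poles; both of its terms tend to zero along a ray, so
  -- the constant is zero.
  set D : ℂ → ℂ := fun ζ => I * ε * expHat ε c z (-μ ^ 2) ζ * W ζ + V ε c z φ μ ζ with hD
  have hcomb : IsComb {ζ : ℂ | top z < ζ.im} univ (top z + 1) :=
    { isOpen := isOpen_upperHalfPlane _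
      ordConnected := ordConnected_univ
      base := fun t _ => by simp
      re_mem := fun _ _ => mem_univ _
      vert := fun ζ (hζ : top z < ζ.im) s hs => by
        have hs' : min (top z + 1) ζ.im ≤ s := hs.1
        have : top z < min (top z + 1) ζ.im := lt_min (lt_add_one _) hζ
        simp
        linarith }
  have hconst : ∀ v : ℂ, top z < v.im → D ζ = D v := fun v hv =>
    hcomb.eq_of_hasDerivAt_zero (F := D) (fun u (hu : top z < u.im) => by
      have hmem := mem_GHat_of_top_lt hz hu
      have h1 := hasDerivAt_expHat (ε := ε) (c := c) hz (-μ ^ 2) hmem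
      have h2 := (hW.differentiableAt ((isOpen_upperHalfPlane 0).mem_nhds
        (show 0 < u.im by linarith))).hasDerivAt
      have h3 := hasDerivAt_V (c := c) hε hz φ hμ hu
      have h4 := hode u (by linarith) fun p => (ne_pole_of_mem_GHat hz hmem p).1
      convert! ((h1.const_mul (I * ε)).mul h2).add h3 using 1
      rw [← h4]
      field_simp
      linear_combination (expHat ε c z (-μ ^ 2) u * (-μ ^ 2 + u0 c z u) * W u) * I_sq) hζ hv
  set ω : ℂ := (top z + T₁ + T₂ + 1 : ℝ) * I with hω
  have hωim : ω.im = top z + T₁ + T₂ + 1 := by simp [hω]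
  have hlim : Tendsto (fun s : ℝ => D (ω + I / μ * s)) atTop (𝓝 0) := by
    have h1 : Tendsto (fun s : ℝ => (ε * B + C) * (‖expHat ε c z (-μ ^ 2) ω‖ *
        Real.exp (-(μ.re / (2 * ε)) * s))) atTop (𝓝 ((ε * B + C) * (‖expHat ε c z (-μ ^ 2) ω‖ * 0))) := by
      refine ((Real.tendsto_exp_atBot.comp ?_).const_mul _).const_mul _
      exact tendsto_id.const_mul_atTop_of_neg (neg_lt_zero.2 (by positivity))
    rw [mul_zero, mul_zero] at h1
    refine squeeze_zero_norm' ?_ h1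
    filter_upwards [eventually_ge_atTop 0] with s hs
    have him : top z + T₁ + T₂ < (ω + I / μ * s).im := top_lt_im_ray hμ (by linarith) hs
    set v := ω + I / μ * s with hv
    have hv1 : 1 ≤ ‖v‖ := by linarith [le_abs_self v.im, abs_im_le_norm v]
    have h2 : ‖expHat ε c z (-μ ^ 2) v‖ ≤ ‖expHat ε c z (-μ ^ 2) ω‖ *
        Real.exp (-(μ.re / (2 * ε)) * s) := hE ω (by linarith) s hs
    have hB0 : 0 ≤ B := (norm_nonneg _).trans (hB v (by linarith))
    calc ‖D v‖ ≤ ε * ‖expHat ε c z (-μ ^ 2) v‖ * ‖W v‖ + ‖V ε c z φ μ v‖ := by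
          refine (norm_add_le _ _).trans_eq ?_
          rw [norm_mul, norm_mul, norm_mul, norm_I, norm_real, Real.norm_of_nonneg hε.le, one_mul]
      _ ≤ ε * ‖expHat ε c z (-μ ^ 2) v‖ * B + C * (‖expHat ε c z (-μ ^ 2) v‖ / 1) := by
          refine add_le_add ?_ ((hV v (by linarith)).trans ?_)
          · gcongr
            exact hB v (by linarith)
          · gcongr
      _ = (ε * B + C) * ‖expHat ε c z (-μ ^ 2) v‖ := by ring
      _ ≤ _ := by gcongr
  have h0 : D ζ = 0 := by
    refine tendsto_nhds_unique (tendsto_const_nhds.congr' ?_) hlim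
    filter_upwards [eventually_ge_atTop 0] with s hs
    exact hconst _ (top_lt_im_ray hμ (by linarith) hs)
  rw [hD] at h0
  linear_combination h0

/-- The coefficients are those of the principal parts of `u₀ W`. The function `iε expG W` is then a
primitive of `expG * rat`, and `V_eq_of_bounded_solution` identifies it with `Psi` in the leftmost
gap. -/
theorem exists_row_eq_zero_of_isEigenvalue (hε : 0 < ε) (hz : ∀ p, 0 < (z p).im)
    (hmono : StrictMono fun p => (z p).re) {a : ℝ} (ha : ∀ p, a < (z p).re)
    {b : Fin P → ℝ} (hb : ∀ m, (z m).re < b m ∧ ∀ p, m < p → b m < (z p).re) {μ : ℂ}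
    (hμ : 0 < μ.re) (hl : IsEigenvalue ε c z (-μ ^ 2)) :
    ∃ φ : Fin P → ℂ, φ ≠ 0 ∧ ∀ m, row ε c z a b φ μ m = 0 := by
  obtain ⟨w, hw0, ⟨hwL, W, hWd, hWb, hWl⟩, hwd, v, hv, heq⟩ := hl
  have hW : IsHardyPair W w := ⟨hwL, hWd, hWb, hWl⟩
  have htop := one_le_top hz
  have hε' : (ε : ℂ) ≠ 0 := ofReal_ne_zero.2 hε.ne'
  set φ : Fin P → ℂ := fun p => c p * W (z p) with hφ
  have hode : ∀ ζ : ℂ, 0 < ζ.im → (∀ p, ζ ≠ z p) →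
      I * ε * deriv W ζ + (-μ ^ 2 + u0 c z ζ) * W ζ = rat z φ ζ := fun ζ h1 h2 =>
    eigen_ode_upper hε hz hW hwd (eigen_ode_real hε hz hW hv heq) h1 h2
  obtain ⟨B, hB⟩ := hW.exists_norm_le
  have hV := fun {ζ : ℂ} (hζ : top z < ζ.im) => V_eq_of_bounded_solution hε hz hμ hWd hB hode hζ
  obtain ⟨y₀, hy0, hy⟩ := exists_pos_lt_im hz
  have hPsi : ∀ ζ ∈ G z, 0 < ζ.im →
      Psi ε c z a φ μ ζ = I * ε * expG ε c z (-μ ^ 2) ζ * W ζ := fun ζ h1 h2 => by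
    set ω : ℂ := a + (top z + 1 : ℝ) * I with hω
    have hωre : ω.re = a := by simp [hω]
    have hωim : ω.im = top z + 1 := by simp [hω]
    have hne : ∀ p, ω.re ≠ (z p).re := fun p => by rw [hωre]; exact (ha p).ne
    have h := (isComb_G_upper hy0 hy).eq_of_hasDerivAt_zero
      (F := fun ζ => Psi ε c z a φ μ ζ - I * ε * expG ε c z (-μ ^ 2) ζ * W ζ) (fun u hu => by
        have h1 := hasDerivAt_expG (ε := ε) (c := c) (-μ ^ 2) hu.1
        have h2 := (hWd.differentiableAt ((isOpen_upperHalfPlane 0).mem_nhds hu.2)).hasDerivAt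
        have h4 := hode u hu.2 fun p => (ne_pole_of_mem_G hu.1 p).1
        convert! (hasDerivAt_Psi hz a φ μ hu.1).sub ((h1.const_mul (I * ε)).mul h2) using 1
        rw [← h4]
        field_simp
        linear_combination (-expG ε c z (-μ ^ 2) u * (-μ ^ 2 + u0 c z u) * W u) * I_sq)
      (ζ := ζ) (ω := ω) ⟨h1, h2⟩ ⟨mem_G_of_re_ne hne, by rw [Set.mem_ofPred_eq, hωim]; linarith⟩
    have h5 : Psi ε c z a φ μ ω - I * ε * expG ε c z (-μ ^ 2) ω * W ω = 0 := by
      rw [Psi_eq_left hε hz ha φ hμ (by linarith) fun p => by rw [hωre]; exact ha p,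
        hV (by linarith), expG_eq _ hne]
      ring
    exact sub_eq_zero.1 (h.trans h5)
  -- If `φ` vanished, so would `Psi`, hence `W` in the strip between the axis and the poles and with
  -- it the boundary values `w`.
  refine ⟨φ, fun h0 => hw0 ?_, row_eq_zero_of_ext hε hz hmono ha hb hμ hWd hPsi⟩
  rw [h0] at hPsi
  refine (Continuous.ae_eq_iff_eq volume hwd.continuous continuous_const).1 ?_
  filter_upwards [hWl] with x hx
  refine tendsto_nhds_unique_of_eventuallyEq hx (tendsto_const_nhds (x := (0 : ℂ))) ?_
  filter_upwards [self_mem_nhdsWithin, nhdsWithin_le_nhds (gt_mem_nhds hy0)] with y h1 h2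
  have hmem := (isComb_G_upper (z := z) (y₀ := y) h1 fun p => h2.trans (hy p)).base x (mem_univ x)
  have := hPsi _ hmem.1 hmem.2
  rw [Psi_zero] at this
  simpa [expG_ne_zero, hε'] using this.symm

/-- The solutions given by nullvectors. -/
theorem exists_solution_of_row_eq_zero (hε : 0 < ε) (hz : ∀ p, 0 < (z p).im)
    (hmono : StrictMono fun p => (z p).re) {a : ℝ} (ha : ∀ p, a < (z p).re)
    {b : Fin P → ℝ} (hb : ∀ m, (z m).re < b m ∧ ∀ p, m < p → b m < (z p).re) {μ : ℂ}
    (hμ : 0 < μ.re) {φ : Fin P → ℂ} (hrow : ∀ m, row ε c z a b φ μ m = 0) :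
    ∃ F : ℂ → ℂ, AnalyticOnNhd ℂ F {x | 0 ≤ x.im} ∧
      (∀ ζ ∈ G z, F ζ = -(I / ε) * Psi ε c z a φ μ ζ / expG ε c z (-μ ^ 2) ζ) ∧
      (∀ ζ ∈ G z ∪ GHat z,
        HasDerivAt F (-(I / ε) * rat z φ ζ + I / ε * (-μ ^ 2 + u0 c z ζ) * F ζ) ζ) ∧
      (∃ C, ∀ ζ : ℂ, 0 ≤ ζ.im → ‖F ζ‖ ≤ C * (1 + ‖ζ‖)⁻¹) ∧ ∀ p, φ p = c p * F (z p) := by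
  have hG := Gam_eq_zero_of_row_eq_zero hε hz hmono ha hb hμ hrow
  obtain ⟨F, hFan, hF⟩ := exists_analytic_of_Gam_eq_zero hε hz hmono hμ hG fun m hex => by
    have := hrow m
    rwa [row, if_pos hex] at this
  have hd := fun {ζ : ℂ} (hζ : ζ ∈ G z ∪ GHat z) => hasDerivAt_of_eq_sol hε hz hμ hG hF hζ
  refine ⟨F, hFan, fun ζ hζ => (hF ζ (Or.inl hζ)).trans (sol_of_mem_G a φ μ hζ), fun ζ => hd,
    exists_norm_le_of_eq_sol hε hz hμ hG hFan hF, fun p => ?_⟩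
  refine residue_eq_of_ode (ε := ε) (l := -μ ^ 2) hz hmono (hFan _ (hz p).le)
    (Eventually.frequently ?_)
  filter_upwards [self_mem_nhdsWithin, nhdsWithin_le_nhds ((isOpen_column p).mem_nhds
    (pole_mem_column hz hmono p))] with ζ h1 h2
  exact ode_of_hasDerivAt hε (hd (column_subset p ⟨h2, h1⟩)).deriv

theorem ofReal_mem_G (hz : ∀ p, 0 < (z p).im) (x : ℝ) : (x : ℂ) ∈ G z := fun p h => by
  have := h.2
  simp at this
  linarith [hz p]

/-- The bound `O(1/ζ)` gives Hardy membership. The relation `φ p = c p * F (z p)` says that the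
inhomogeneity is exactly what the Cauchy projection removes from `u₀ F`, and it also shows that `F`
is nonzero on the axis. -/
theorem isEigenvalue_of_row_eq_zero (hε : 0 < ε) (hz : ∀ p, 0 < (z p).im)
    (hmono : StrictMono fun p => (z p).re) {a : ℝ} (ha : ∀ p, a < (z p).re)
    {b : Fin P → ℝ} (hb : ∀ m, (z m).re < b m ∧ ∀ p, m < p → b m < (z p).re) {μ : ℂ}
    (hμ : 0 < μ.re) {φ : Fin P → ℂ} (hφ : φ ≠ 0) (hrow : ∀ m, row ε c z a b φ μ m = 0) :
    IsEigenvalue ε c z (-μ ^ 2) := by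
  obtain ⟨F, hFan, -, hd, ⟨C, hC⟩, hres⟩ :=
    exists_solution_of_row_eq_zero hε hz hmono ha hb hμ hrow
  have hW := isHardyPair_of_decay hFan hC
  have hdx : ∀ x : ℝ, HasDerivAt (fun x : ℝ => F x)
      (-(I / ε) * rat z φ x + I / ε * (-μ ^ 2 + u0 c z x) * F x) x := fun x =>
    (hd x (Or.inl (ofReal_mem_G hz x))).comp_ofReal
  refine ⟨fun x => F x, fun h0 => hφ ?_, ⟨hW.memLp, F, hW.diff, hW.bound, hW.lim⟩,
    fun x => (hdx x).differentiableAt, fun x => u0 c z x * F x - rat z φ x, fun x => ?_, fun x => ?_⟩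
  · ext p
    rw [hres p, eq_zero_of_real_eq_zero hFan (fun x => congrFun h0 x) (hz p).le]
    simp
  · have hφ' : φ = fun p => c p * F (z p) := funext hres
    rw [hφ']
    refine isCauchyPlus_u0_mul hz hW ?_
    have h1 : ContinuousAt (fun y : ℝ => F (x + y * I)) 0 := by
      refine ContinuousAt.comp (g := F) ?_ (by fun_prop)
      simpa using (hFan x (by simp)).continuousAt
    simpa [ContinuousAt] using h1.tendsto.mono_left nhdsWithin_le_nhds
  · rw [(hdx x).deriv]
    have := ode_of_hasDerivAt hε (l := -μ ^ 2) (u := u0 c z x) (r := rat z φ x) (F := F x) rfl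
    linear_combination this

/-- For real `l` the norm identity makes the solution vanish on the axis, hence at the poles, and
the residue relation then annihilates `φ`. -/
theorem eq_zero_of_sum_eq_zero (hε : 0 < ε) (hz : ∀ p, 0 < (z p).im)
    (hmono : StrictMono fun p => (z p).re) {a : ℝ} (ha : ∀ p, a < (z p).re)
    {b : Fin P → ℝ} (hb : ∀ m, (z m).re < b m ∧ ∀ p, m < p → b m < (z p).re) {r : ℝ}
    (hr : 0 < r) {φ : Fin P → ℂ} (hφ : ∑ p, φ p = 0) (hrow : ∀ m, row ε c z a b φ r m = 0) :
    φ = 0 := by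
  obtain ⟨F, hFan, -, hd, ⟨C, hC⟩, hres⟩ :=
    exists_solution_of_row_eq_zero hε hz hmono ha hb (μ := r) (by simpa using hr) hrow
  have hε' : (ε : ℂ) ≠ 0 := ofReal_ne_zero.2 hε.ne'
  have h0 : (fun x : ℝ => F x) = 0 := by
    refine eigen_eq_zero_of_sum_eq_zero (c := c) (l := -r ^ 2) (C := C) hε hz hφ
      (isHardyPair_of_decay hFan hC) (fun x => ?_) fun x => ?_
    · convert! (hd x (Or.inl (ofReal_mem_G hz x))).comp_ofReal using 1
      push_cast
      field_simp
      linear_combination (rat z φ x - (-(r : ℂ) ^ 2 + u0 c z x) * F x) * I_sq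
    · simpa using hC x (by simp)
  ext p
  rw [hres p, eq_zero_of_real_eq_zero hFan (fun x => congrFun h0 x) (hz p).le]
  simp

/-- The functional `φ ↦ ∑ φ p` is injective on the null space, which fixes the factor as the ratio
of the two sums. -/
theorem exists_smul_of_mulVec_eq_zero (hε : 0 < ε) (hz : ∀ p, 0 < (z p).im)
    (hmono : StrictMono fun p => (z p).re) {a : ℝ} (ha : ∀ p, a < (z p).re)
    {b : Fin P → ℝ} (hb : ∀ m, (z m).re < b m ∧ ∀ p, m < p → b m < (z p).re) {r : ℝ}
    (hr : 0 < r) {φ ψ : Fin P → ℂ} (hφ0 : φ ≠ 0) (hφ : (evansMatrix ε c z a b r).mulVec φ = 0)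
    (hψ : (evansMatrix ε c z a b r).mulVec ψ = 0) : ∃ k : ℂ, ψ = k • φ := by
  have key : ∀ χ : Fin P → ℂ, ∑ p, χ p = 0 → (evansMatrix ε c z a b r).mulVec χ = 0 → χ = 0 :=
    fun χ h1 h2 => eq_zero_of_sum_eq_zero hε hz hmono ha hb hr h1 fun m => by
      rw [← evansMatrix_mulVec hε hz hmono ha hb (by simpa using hr), h2, Pi.zero_apply]
  have hS : ∑ p, φ p ≠ 0 := fun h => hφ0 (key φ h hφ)
  refine ⟨(∑ p, ψ p) / ∑ p, φ p, sub_eq_zero.1 (key _ ?_ ?_)⟩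
  · simp [← Finset.mul_sum, div_mul_cancel₀ _ hS]
  · rw [Matrix.mulVec_sub, Matrix.mulVec_smul, hφ, hψ, smul_zero, sub_zero]

end BenjaminOno

/-! ### The function `Φ` and the improper integral. -/

namespace BenjaminOno

variable {P : ℕ} {ε : ℝ} {c z : Fin P → ℂ}

theorem conj_f_ofReal (hz : ∀ p, 0 < (z p).im) (x : ℝ) : conj (f c z x) = f c z x := by
  rw [f, map_sum]
  refine Finset.sum_congr rfl fun p _ => ?_
  have harg : (I * (x - z p)).arg ≠ Real.pi := fun h => by
    have := (arg_eq_pi_iff.1 h).1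
    simp at this
    linarith [hz p]
  have h1 : conj (Complex.log (I * (x - z p))) = Complex.log (-I * (x - conj (z p))) := by
    rw [← log_conj _ harg]
    simp
  have h2 : conj (Complex.log (-I * (x - conj (z p)))) = Complex.log (I * (x - z p)) := by
    rw [← h1, conj_conj]
  simp only [map_add, map_sub, map_mul, map_div₀, conj_conj, h1, h2, conj_ofReal, conj_I,
    map_ofNat]
  ring

/-- By Schwarz reflection `f` is real on the axis. -/
theorem norm_expG_ofReal (hz : ∀ p, 0 < (z p).im) (l x : ℝ) : ‖expG ε c z l x‖ = 1 := by
  have him : (f c z x).im = 0 := conj_eq_iff_im.1 (conj_f_ofReal hz x)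
  rw [expG, norm_exp, div_ofReal_re]
  simp [him]

theorem Gam_eq_zero_of_left (hε : 0 < ε) (hz : ∀ p, 0 < (z p).im) {a : ℝ}
    (ha : ∀ p, a < (z p).re) (φ : Fin P → ℂ) {μ : ℂ} (hμ : 0 < μ.re) {x : ℝ}
    (hx : ∀ p, x < (z p).re) : Gam ε c z a φ μ x = 0 := by
  rw [Gam, Psi_eq_left hε hz ha φ hμ (by simp) fun p => by simpa using hx p]
  simp

/-- On the left `Gam = 0`, so the bound on `Psi` applies, and with a unimodular exponential it reads
`O(1/R)`. Hence the improper integral from `-∞` converges conditionally to the primitive normalized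
at infinity in the upper left. -/
theorem tendsto_Psi_neg (hε : 0 < ε) (hz : ∀ p, 0 < (z p).im) {a : ℝ}
    (ha : ∀ p, a < (z p).re) (φ : Fin P → ℂ) {r : ℝ} (hr : 0 < r) :
    Tendsto (fun R : ℝ => Psi ε c z a φ r (-R : ℝ)) atTop (𝓝 0) := by
  obtain ⟨C, hC, hle⟩ := exists_norm_Psi_le (c := c) hε hz a φ (μ := r) (by simpa using hr)
  have h0 : Tendsto (fun R : ℝ => C * R⁻¹) atTop (𝓝 (C * 0)) :=
    tendsto_inv_atTop_zero.const_mul C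
  rw [mul_zero] at h0
  refine squeeze_zero_norm' ?_ h0
  filter_upwards [eventually_gt_atTop (wide z)] with R hR
  have hwide := one_le_wide z
  have hR0 : 0 < R := by linarith
  have h1 := hle (-R : ℝ) (by simp) (by simpa [abs_of_pos hR0] using hR)
    (Gam_eq_zero_of_left hε hz ha φ (by simpa using hr) fun p => by
      have h2 := two_mul_norm_add_one_le_wide z p
      have h3 := (abs_le.1 (abs_re_le_norm (z p))).1
      have := norm_nonneg (z p)
      simp
      linarith)
  have h2 := norm_expG_ofReal (ε := ε) (c := c) hz (-r ^ 2) (-R)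
  push_cast at h1 h2 ⊢
  rw [h2, norm_neg, norm_real, Real.norm_of_nonneg hR0.le, one_div] at h1
  exact h1

theorem tendsto_integral_Psi (hε : 0 < ε) (hz : ∀ p, 0 < (z p).im) {a : ℝ}
    (ha : ∀ p, a < (z p).re) (φ : Fin P → ℂ) {r : ℝ} (hr : 0 < r) (x : ℝ) :
    Tendsto (fun R : ℝ => ∫ t in (-R)..x, integrand ε c z (-r ^ 2) φ t) atTop
      (𝓝 (Psi ε c z a φ r x)) := by
  have h := (tendsto_Psi_neg (c := c) hε hz ha φ hr).const_sub (Psi ε c z a φ r x)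
  rw [sub_zero] at h
  refine h.congr fun R => ?_
  have hint := horizontalIntegrable (ε := ε) (c := c) hz (-(r : ℂ) ^ 2) φ
  have he : ∀ t : ℂ, integrand ε c z (-r ^ 2) φ t = expG ε c z (-(r : ℂ) ^ 2) t * rat z φ t :=
    fun t => by
      rw [integrand, expG, rat, BenjaminOno.h]
      push_cast
      rfl
  simp only [he]
  rw [← intervalIntegral.integral_interval_sub_left (hint a x) (hint a (-R)), Psi, Psi]
  simp

theorem Phi_eq (hε : 0 < ε) (hz : ∀ p, 0 < (z p).im) {a : ℝ}
    (ha : ∀ p, a < (z p).re) (φ : Fin P → ℂ) {r : ℝ} (hr : 0 < r) (x : ℂ) :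
    Phi ε c z (-r ^ 2) φ x = -(I / ε) * Psi ε c z a φ r x / expG ε c z (-(r : ℂ) ^ 2) x := by
  have he : ∀ t : ℂ, integrand ε c z (-r ^ 2) φ t = expG ε c z (-(r : ℂ) ^ 2) t * rat z φ t :=
    fun t => by
      rw [integrand, expG, rat, BenjaminOno.h]
      push_cast
      rfl
  have hexp : Complex.exp (I * BenjaminOno.h c z (-r ^ 2) x / ε) =
      (expG ε c z (-(r : ℂ) ^ 2) x)⁻¹ := by
    rw [expG, ← Complex.exp_neg, BenjaminOno.h]
    push_cast
    ring_nf
  have hPsi : Psi ε c z a φ r x = Psi ε c z a φ r x.re +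
      ∫ s in (0 : ℝ)..x.im, expG ε c z (-(r : ℂ) ^ 2) (x.re + s * I) *
        rat z φ (x.re + s * I) * I := by
    rw [Psi, Psi]
    simp
    ring
  rw [Phi, (tendsto_integral_Psi hε hz ha φ hr x.re).limUnder_eq, hexp, hPsi, div_eq_mul_inv]
  simp only [he]
  ring

theorem Psi_eq_of_extension (hε : 0 < ε) (hz : ∀ p, 0 < (z p).im) {a : ℝ}
    (ha : ∀ p, a < (z p).re) {φ : Fin P → ℂ} {r : ℝ} (hr : 0 < r) {F : ℂ → ℂ}
    (hF : IsAnalyticExtension ε c z (-r ^ 2) φ F) {ζ : ℂ} (hζ : ζ ∈ G z) (him : 0 < ζ.im) :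
    Psi ε c z a φ r ζ = I * ε * expG ε c z (-(r : ℂ) ^ 2) ζ * F ζ := by
  have hε' : (ε : ℂ) ≠ 0 := ofReal_ne_zero.2 hε.ne'
  have := expG_ne_zero (ε := ε) (c := c) (z := z) (-(r : ℂ) ^ 2) ζ
  rw [hF.2 ζ hζ him.le, Phi_eq hε hz ha φ hr]
  field_simp
  linear_combination Psi ε c z a φ r ζ * I_sq

/-- The differential equation is known only inside `G`, but it holds on the vertical approach to `z
p` from below, and that already determines the residue of an extension analytic at `z p`. -/
theorem coefficient_eq_of_extension (hε : 0 < ε) (hz : ∀ p, 0 < (z p).im)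
    (hmono : StrictMono fun p => (z p).re) {a : ℝ} (ha : ∀ p, a < (z p).re) {φ : Fin P → ℂ}
    {r : ℝ} (hr : 0 < r) {F : ℂ → ℂ} (hF : IsAnalyticExtension ε c z (-r ^ 2) φ F) (p : Fin P) :
    φ p = c p * F (z p) := by
  refine residue_eq_of_ode (ε := ε) (l := -(r : ℂ) ^ 2) hz hmono (hF.1 _ (hz p).le) ?_
  refine (tendsto_pole_path (z p)).frequently (Eventually.frequently ?_)
  filter_upwards [self_mem_nhdsWithin, nhdsWithin_le_nhds (gt_mem_nhds (hz p))] with t h1 h2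
  have hmem := pole_path_mem hz hmono p h1 h2
  set v := z p - t * I
  refine ode_of_hasDerivAt hε (HasDerivAt.deriv ?_)
  rw [hF.2 v hmem.1 hmem.2.1.le, Phi_eq hε hz ha φ hr]
  refine (hasDerivAt_quotient hε (hasDerivAt_Psi (c := c) hz a φ r hmem.1) (hasDerivAt_expG _ hmem.1)
      (expG_ne_zero _ _)).congr_of_eventuallyEq ?_
  filter_upwards [(isOpen_G.inter (isOpen_upperHalfPlane 0)).mem_nhds
    (show v ∈ G z ∩ {ζ | 0 < ζ.im} from ⟨hmem.1, hmem.2.1⟩)] with u hu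
  have hu2 : 0 < u.im := hu.2
  rw [hF.2 u hu.1 hu2.le, Phi_eq hε hz ha φ hr]

theorem phi_analytic_iff (hε : 0 < ε) (hz : ∀ p, 0 < (z p).im)
    (hmono : StrictMono fun p => (z p).re) {a : ℝ} (ha : ∀ p, a < (z p).re)
    {b : Fin P → ℝ} (hb : ∀ m, (z m).re < b m ∧ ∀ p, m < p → b m < (z p).re) {r : ℝ} (hr : 0 < r)
    (φ : Fin P → ℂ) :
    (PhiNontrivial ε c z (-r ^ 2) φ ∧ PhiAnalytic ε c z (-r ^ 2) φ) ↔
      (φ ≠ 0 ∧ (evansMatrix ε c z a b r).mulVec φ = 0) := by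
  have hμ : 0 < (r : ℂ).re := by simpa using hr
  constructor
  · rintro ⟨⟨x, hx, him, hne⟩, F, hF⟩
    refine ⟨fun h0 => hne ?_, funext fun m => ?_⟩
    · rw [Phi_eq hε hz ha φ hr, h0, Psi_zero]
      simp
    · rw [evansMatrix_mulVec hε hz hmono ha hb hμ]
      exact row_eq_zero_of_ext hε hz hmono ha hb hμ
        (fun ζ (hζ : 0 < ζ.im) => (hF.1 ζ hζ.le).differentiableAt.differentiableWithinAt)
        (fun ζ h1 h2 => Psi_eq_of_extension hε hz ha hr hF h1 h2) m
  · rintro ⟨h0, hnull⟩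
    obtain ⟨F, hFan, hFG, -, -, hres⟩ := exists_solution_of_row_eq_zero hε hz hmono ha hb hμ
      (φ := φ) fun m => by rw [← evansMatrix_mulVec hε hz hmono ha hb hμ, hnull, Pi.zero_apply]
    have hF : IsAnalyticExtension ε c z (-r ^ 2) φ F :=
      ⟨hFan, fun x hx _ => by rw [hFG x hx, Phi_eq hε hz ha φ hr]⟩
    refine ⟨?_, F, hF⟩
    -- If `Φ` were trivial, the extension would vanish on the axis, hence at every pole, and so
    -- would each `φ p = c p * F (z p)`.
    by_contra hcon
    refine h0 (funext fun p => ?_)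
    rw [hres p, eq_zero_of_real_eq_zero hFan (fun x => ?_) (hz p).le, mul_zero, Pi.zero_apply]
    rw [hF.2 x (ofReal_mem_G hz x) (by simp)]
    by_contra hne
    exact hcon ⟨x, ofReal_mem_G hz x, by simp, hne⟩

theorem det_evansMatrix_eq_zero_iff (hε : 0 < ε) (hz : ∀ p, 0 < (z p).im)
    (hmono : StrictMono fun p => (z p).re) {a : ℝ} (ha : ∀ p, a < (z p).re)
    {b : Fin P → ℝ} (hb : ∀ m, (z m).re < b m ∧ ∀ p, m < p → b m < (z p).re) {μ : ℂ}
    (hμ : 0 < μ.re) : (evansMatrix ε c z a b μ).det = 0 ↔ IsEigenvalue ε c z (-μ ^ 2) := by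
  rw [← Matrix.exists_mulVec_eq_zero_iff]
  constructor
  · rintro ⟨φ, h0, hnull⟩
    exact isEigenvalue_of_row_eq_zero hε hz hmono ha hb hμ h0 fun m => by
      rw [← evansMatrix_mulVec hε hz hmono ha hb hμ, hnull, Pi.zero_apply]
  · intro h
    obtain ⟨φ, h0, hrow⟩ := exists_row_eq_zero_of_isEigenvalue hε hz hmono ha hb hμ h
    exact ⟨φ, h0, funext fun m => by
      rw [evansMatrix_mulVec hε hz hmono ha hb hμ, hrow, Pi.zero_apply]⟩

/-- The square root of `-l` with positive real part. -/
noncomputable def rootNeg (l : ℂ) : ℂ := Complex.exp (Complex.log (-l) / 2)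

theorem neg_mem_slitPlane {l : ℂ} (hl : l.re < 0 ∨ l.im ≠ 0) : -l ∈ slitPlane := by
  rw [mem_slitPlane_iff]
  simpa using hl

theorem rootNeg_re_pos {l : ℂ} (hl : l.re < 0 ∨ l.im ≠ 0) : 0 < (rootNeg l).re := by
  rw [rootNeg, exp_re]
  refine mul_pos (Real.exp_pos _) (Real.cos_pos_of_mem_Ioo ?_)
  have h1 : (Complex.log (-l) / 2).im = (-l).arg / 2 := by
    rw [← log_im]
    exact div_ofNat_im _ _
  have h2 := neg_pi_lt_arg (-l)
  have h3 := lt_of_le_of_ne (arg_le_pi (-l)) (slitPlane_arg_ne_pi (neg_mem_slitPlane hl))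
  rw [h1]
  constructor <;> linarith

theorem neg_rootNeg_sq {l : ℂ} (hl : l.re < 0 ∨ l.im ≠ 0) : -rootNeg l ^ 2 = l := by
  rw [rootNeg, ← Complex.exp_nat_mul, Nat.cast_ofNat, mul_div_cancel₀ _ two_ne_zero,
    Complex.exp_log (slitPlane_ne_zero (neg_mem_slitPlane hl)), neg_neg]

theorem rootNeg_ofReal {l : ℝ} (hl : l < 0) :
    rootNeg l = (Real.exp (Real.log (-l) / 2) : ℝ) := by
  rw [rootNeg, ← ofReal_neg, ← ofReal_log (by linarith)]
  push_cast
  rfl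

theorem neg_exp_log_sq {l : ℝ} (hl : l < 0) : -Real.exp (Real.log (-l) / 2) ^ 2 = l := by
  rw [← Real.exp_nat_mul, Nat.cast_ofNat, mul_div_cancel₀ _ two_ne_zero,
    Real.exp_log (by linarith), neg_neg]

end BenjaminOno

/-! ### The main theorem. -/

open BenjaminOno
theorem corollary3p3 {P : ℕ} (ε : ℝ) (hε : 0 < ε) (c z : Fin P → ℂ)
    (hc : ∀ p, c p ≠ 0) (hz : ∀ p, 0 < (z p).im)
    (hmono : StrictMono (fun p => (z p).re))
    (hsum : ∑ p, (c p + conj (c p)) = 0)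
    (a : ℝ) (ha : ∀ p, a < (z p).re)
    (b : Fin P → ℝ) (hb : ∀ m, (z m).re < b m ∧ ∀ p, m < p → b m < (z p).re) :
    -- the improper integral defining `Φ` converges
    (∀ l : ℝ, l < 0 → ∀ φ : Fin P → ℂ, ∀ x : ℝ, ∃ L : ℂ,
      Tendsto (fun R : ℝ => ∫ t in (-R)..x, integrand ε c z l φ (t : ℂ)) atTop (𝓝 L)) ∧
    -- the characterization of nontriviality and analyticity
    (∀ l : ℝ, l < 0 → ∀ φ : Fin P → ℂ,
      (PhiNontrivial ε c z l φ ∧ PhiAnalytic ε c z l φ) ↔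
        (D ε c z a b l = 0 ∧ φ ≠ 0 ∧ (A ε c z a b l).mulVec φ = 0)) ∧
    -- in that case the coefficients are `φ_p = c_p Φ(z_p)`
    (∀ l : ℝ, l < 0 → ∀ φ : Fin P → ℂ, ∀ F : ℂ → ℂ, IsAnalyticExtension ε c z l φ F →
      ∀ p, φ p = c p * F (z p)) ∧
    -- uniqueness of the nullvector up to scaling
    (∀ l : ℝ, l < 0 → ∀ φ ψ : Fin P → ℂ, φ ≠ 0 → (A ε c z a b l).mulVec φ = 0 →
      (A ε c z a b l).mulVec ψ = 0 → ∃ k : ℂ, ψ = k • φ) ∧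
    -- `D` is an Evans function
    (∃ E : ℂ → ℂ, AnalyticOnNhd ℂ E {l : ℂ | l.re < 0 ∨ l.im ≠ 0} ∧
      (∀ l : ℝ, l < 0 → E l = D ε c z a b l) ∧
      ∀ l : ℂ, (l.re < 0 ∨ l.im ≠ 0) → (E l = 0 ↔ IsEigenvalue ε c z l)) := by
  -- Negative `l` correspond to positive real `μ`; on the whole cut plane `rootNeg` takes values in
  -- the right half-plane, and the Evans function is the determinant of the matrix composed with it.
  have hroot : ∀ l : ℝ, l < 0 → ∃ r : ℝ, 0 < r ∧ rootNeg l = r ∧ l = -r ^ 2 := fun l hl =>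
    ⟨_, Real.exp_pos _, rootNeg_ofReal hl, (neg_exp_log_sq hl).symm⟩
  refine ⟨fun l hl φ x => ?_, fun l hl φ => ?_, fun l hl φ F hF p => ?_,
    fun l hl φ ψ h0 hφ hψ => ?_, fun l => (evansMatrix ε c z a b (rootNeg l)).det, ?_,
    fun l hl => ?_, fun l hl => ?_⟩
  · obtain ⟨r, hr, -, rfl⟩ := hroot l hl
    exact ⟨_, tendsto_integral_Psi hε hz ha φ hr x⟩
  · obtain ⟨r, hr, -, rfl⟩ := hroot l hl
    rw [phi_analytic_iff hε hz hmono ha hb hr, D, A_eq_evansMatrix hε hz hmono ha hb hr,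
      ← Matrix.exists_mulVec_eq_zero_iff]
    exact ⟨fun h => ⟨⟨φ, h⟩, h⟩, fun h => h.2⟩
  · obtain ⟨r, hr, -, rfl⟩ := hroot l hl
    exact coefficient_eq_of_extension hε hz hmono ha hr hF p
  · obtain ⟨r, hr, -, rfl⟩ := hroot l hl
    rw [A_eq_evansMatrix hε hz hmono ha hb hr] at hφ hψ
    exact exists_smul_of_mulVec_eq_zero hε hz hmono ha hb hr h0 hφ hψ
  · have hopen : IsOpen {l : ℂ | l.re < 0 ∨ l.im ≠ 0} :=
      (isOpen_lt continuous_re continuous_const).union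
        (isOpen_ne_fun continuous_im continuous_const)
    refine DifferentiableOn.analyticOnNhd (fun l hl => ?_) hopen
    have h1 : DifferentiableAt ℂ rootNeg l := by
      have := (differentiableAt_id.neg (x := l)).clog (neg_mem_slitPlane hl)
      unfold rootNeg
      exact (this.div_const 2).cexp
    exact ((differentiableAt_det_evansMatrix hε hz hmono ha hb (rootNeg_re_pos hl)).comp l
      h1).differentiableWithinAt
  · obtain ⟨r, hr, h1, h2⟩ := hroot l hl
    dsimp only
    rw [h1, D, h2, A_eq_evansMatrix hε hz hmono ha hb hr]
  · rw [det_evansMatrix_eq_zero_iff hε hz hmono ha hb (rootNeg_re_pos hl), neg_rootNeg_sq hl]
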